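/- Consider a rose graph: one vertex and $B$ loops (bonds), the $b$-th identified with an interval $[0,L_b]$, $L_b>0$. Let $\mathcal D=-\mathrm i\,\boldsymbol\alpha\,\frac{\mathrm d}{\mathrm dx}$ be the massless Dirac operator in $\bigoplus_{b=1}^B L^2([0,L_b])\otimes\mathbb C^4$, with $$\boldsymbol\alpha=\begin{pmatrix}0&0&0&-\mathrm i\\0&0&\mathrm i&0\\0&-\mathrm i&0&0\\\mathrm i&0&0&0\end{pmatrix}.$$ Its domain consists of the $\psi=(\psi^b)$ with all components in $H^1$ which, with $v^b=(\psi^b_1,\psi^b_2)^T$ and $w^b=(-\psi^b_4,\psi^b_3)^T$, satisfy $$u_o^b v^b(0)=u_t^b v^b(L_b)=\xi\ \text{ for all } b \text{ (a common value } \xi),\qquad \sum_b u_o^b w^b(0)-\sum_b u_t^b w^b(L_b)=0,$$ where $u_o^b,u_t^b\in \mathrm{SU}(2)$ are given and $u_o^b\ne u_t^b$ for at least one $b$. Let $\cos\theta_b=\frac12\operatorname{tr}\big(u_o^b(u_t^b)^{-1}\big)$. All eigenspaces of $\mathcal D$ for real $k$ are finite dimensional. If $\sin kL_b\neq0$ for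 all $b$, then $k$ is an eigenvalue if and only if $\sum_b\frac{\cos\theta_b-\cos kL_b}{\sin kL_b}=0$, and it then has multiplicity $2$. Fix $\alpha\in(0,\pi)$ and take powers $z^{-s}$ of the eigenvalues with the branch $\arg z\in(\alpha-2\pi,\alpha]$ (cut along the ray at angle $\alpha$). The spectral zeta function $\zeta(s)=\sum_k k^{-s}$, the sum running over the nonzero eigenvalues of $\mathcal D$ repeated according to multiplicity (Kramers' degeneracy included), converges absolutely for $\operatorname{Re}s>1$ and has a unique analytic continuation to an entire function. For $\operatorname{Re}s<2$, $$\zeta(s)=\mathrm e^{\mathrm i(\pi-\alpha)s}\,\frac{2\sin\pi s}{\pi}\left[\int_0^1u^{-s}\frac{\mathrm d}{\mathrm du}\log\big(u\mathrm e^{\mathrm i\alpha}\hat f(u)\big)\,\mathrm du+\int_1^\infty u^{-s}\frac{\mathrm d}{\mathrm du}\log\hat f(u)\,\mathrm du+\frac1s\right]+2(\mathrm e^{\mathrm i\pi s}+1)\,\zeta_R(s)\sum_{b=1}^B\Big(\frac{\pi}{L_b}\Big)^{-s},$$ where $$\hat f(u)=\sum_{b=1}^B\frac{\cos\theta_b-\cos(L_b\mathrm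 e^{\mathrm i\alpha}u)}{\sin(L_b\mathrm e^{\mathrm i\alpha}u)}$$ is differentiable and has no zero for $u>0$, $\zeta_R$ is the Riemann zeta function, both integrals converge absolutely, and the removable singularities of the right-hand side at $s=0$ and $s=1$ are understood as limits. If instead $\pi<\alpha<2\pi$, the same holds with $\mathrm e^{-\mathrm i\pi s}$ in place of $\mathrm e^{\mathrm i\pi s}$. -/

import Mathlib

open MeasureTheory Filter Topology

/-- The special unitary group `SU(2)`. -/
abbrev SU2 : Type := Matrix.specialUnitaryGroup (Fin 2) ℂ

/-- Values of the wave function: four component spinors. -/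
abbrev Spinor : Type := EuclideanSpace ℂ (Fin 4)

/-- Lebesgue measure on the bond `[0, ℓ]`. -/
noncomputable abbrev bondMeasure (ℓ : ℝ) : Measure ℝ := volume.restrict (Set.Icc 0 ℓ)

/-- The Hilbert space `⨁ b, L²([0, L b]) ⊗ ℂ⁴` of a metric graph with bond lengths `L`. -/
abbrev SpinorSpace {B : ℕ} (L : Fin B → ℝ) : Type :=
  PiLp 2 (fun b => Lp Spinor 2 (bondMeasure (L b)))

/-- The matrix `α` of the one-dimensional Dirac algebra. -/
def diracAlpha : Matrix (Fin 4) (Fin 4) ℂ :=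
  !![0, 0, 0, -Complex.I;
     0, 0, Complex.I, 0;
     0, -Complex.I, 0, 0;
     Complex.I, 0, 0, 0]

/-- The action `-i α φ` on a spinor `φ`. -/
noncomputable def negIAlpha : Spinor →ₗ[ℂ] Spinor :=
  (-Complex.I) • Matrix.toEuclideanLin diracAlpha

/-- The upper pair `v = (ψ₁, ψ₂)` of a spinor. -/
def upperPair : Spinor →ₗ[ℂ] (Fin 2 → ℂ) where
  toFun ψ := ![ψ 0, ψ 1]
  map_add' ψ φ := by ext i; fin_cases i <;> simp
  map_smul' c ψ := by ext i; fin_cases i <;> simp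

/-- The lower pair `w = (-ψ₄, ψ₃)` of a spinor. -/
def lowerPair : Spinor →ₗ[ℂ] (Fin 2 → ℂ) where
  toFun ψ := ![-ψ 3, ψ 2]
  map_add' ψ φ := by ext i; fin_cases i <;> simp [add_comm]
  map_smul' c ψ := by ext i; fin_cases i <;> simp

/-- `f` is the absolutely continuous representative of an element of `H¹([0, ℓ]) ⊗ ℂ⁴`
whose weak derivative is `g ∈ L²`. -/
def HasH1Deriv (ℓ : ℝ) (f g : ℝ → Spinor) : Prop :=
  MemLp g 2 (bondMeasure ℓ) ∧ ∀ x ∈ Set.Icc 0 ℓ, f x = f 0 + ∫ t in (0 : ℝ)..x, g t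

/-- The vertex conditions at the only vertex of the rose:
`uₒᵇ vᵇ(0) = uₜᵇ vᵇ(L_b) = ξ` for all `b`, with a common value `ξ`, and
`∑ b, uₒᵇ wᵇ(0) - ∑ b, uₜᵇ wᵇ(L_b) = 0`. -/
def RoseVertexConditions {B : ℕ} (L : Fin B → ℝ) (uo ut : Fin B → SU2)
    (f : Fin B → ℝ → Spinor) : Prop :=
  (∃ ξ : Fin 2 → ℂ, ∀ b,
    (uo b : Matrix (Fin 2) (Fin 2) ℂ).mulVec (upperPair (f b 0)) = ξ ∧
    (ut b : Matrix (Fin 2) (Fin 2) ℂ).mulVec (upperPair (f b (L b))) = ξ) ∧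
  ∑ b, (uo b : Matrix (Fin 2) (Fin 2) ℂ).mulVec (lowerPair (f b 0))
    - ∑ b, (ut b : Matrix (Fin 2) (Fin 2) ℂ).mulVec (lowerPair (f b (L b))) = 0

/-- `ψ` lies in the domain of the massless Dirac operator `D = -i α d/dx` of the rose
(componentwise `H¹`, with the vertex conditions), and `D ψ = φ`. -/
def IsRoseDiracPair {B : ℕ} (L : Fin B → ℝ) (uo ut : Fin B → SU2)
    (ψ φ : SpinorSpace L) : Prop :=
  ∃ f g : Fin B → ℝ → Spinor,
    (∀ b, ψ b =ᵐ[bondMeasure (L b)] f b) ∧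
    (∀ b, HasH1Deriv (L b) (f b) (g b)) ∧
    RoseVertexConditions L uo ut f ∧
    ∀ b, φ b =ᵐ[bondMeasure (L b)] fun x => negIAlpha (g b x)

theorem HasH1Deriv.intervalIntegrable {ℓ : ℝ} {f g : ℝ → Spinor} (h : HasH1Deriv ℓ f g)
    {x : ℝ} (hx : x ∈ Set.Icc 0 ℓ) : IntervalIntegrable g volume 0 x := by
  have h1 : IntegrableOn g (Set.Icc 0 ℓ) volume := h.1.integrable (by norm_num)
  rw [intervalIntegrable_iff_integrableOn_Ioc_of_le hx.1]
  exact h1.mono_set (fun y hy => ⟨hy.1.le, hy.2.trans hx.2⟩)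

/-- The graph of the massless Dirac operator `D = -i α d/dx` on the rose, as an unbounded
operator in the Hilbert space `⨁ b, L²([0, L b]) ⊗ ℂ⁴`. -/
noncomputable def roseDiracGraph {B : ℕ} (L : Fin B → ℝ) (uo ut : Fin B → SU2) :
    Submodule ℂ (SpinorSpace L × SpinorSpace L) where
  carrier := {p | IsRoseDiracPair L uo ut p.1 p.2}
  zero_mem' := by
    refine ⟨fun _ _ => 0, fun _ _ => 0, fun b => ?_, fun b => ⟨?_, ?_⟩, ⟨⟨0, ?_⟩, ?_⟩, fun b => ?_⟩
    · filter_upwards [Lp.coeFn_zero Spinor 2 (bondMeasure (L b))] with x hx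
      simpa using hx
    · exact MemLp.zero'
    · simp
    · simp
    · simp
    · filter_upwards [Lp.coeFn_zero Spinor 2 (bondMeasure (L b))] with x hx
      simpa using hx
  add_mem' := by
    rintro ⟨ψ, φ⟩ ⟨ψ', φ'⟩ ⟨f, g, h1, h2, ⟨⟨ξ, h3⟩, h4⟩, h5⟩ ⟨f', g', h1', h2', ⟨⟨ξ', h3'⟩, h4'⟩, h5'⟩
    refine ⟨fun b x => f b x + f' b x, fun b x => g b x + g' b x, fun b => ?_,
      fun b => ⟨(h2 b).1.add (h2' b).1, fun x hx => ?_⟩, ⟨⟨ξ + ξ', fun b => ⟨?_, ?_⟩⟩, ?_⟩,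
      fun b => ?_⟩
    · filter_upwards [Lp.coeFn_add (ψ b) (ψ' b), h1 b, h1' b] with x hx e e'
      simpa [e, e'] using hx
    · beta_reduce
      rw [intervalIntegral.integral_add ((h2 b).intervalIntegrable hx)
        ((h2' b).intervalIntegrable hx), (h2 b).2 x hx, (h2' b).2 x hx]
      abel
    · rw [map_add, Matrix.mulVec_add, (h3 b).1, (h3' b).1]
    · rw [map_add, Matrix.mulVec_add, (h3 b).2, (h3' b).2]
    · simp only [map_add, Matrix.mulVec_add, Finset.sum_add_distrib]
      rw [add_sub_add_comm, h4, h4', add_zero]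
    · filter_upwards [Lp.coeFn_add (φ b) (φ' b), h5 b, h5' b] with x hx e e'
      simpa [e, e'] using hx
  smul_mem' := by
    rintro c ⟨ψ, φ⟩ ⟨f, g, h1, h2, ⟨⟨ξ, h3⟩, h4⟩, h5⟩
    refine ⟨fun b x => c • f b x, fun b x => c • g b x, fun b => ?_,
      fun b => ⟨(h2 b).1.const_smul c, fun x hx => ?_⟩, ⟨⟨c • ξ, fun b => ⟨?_, ?_⟩⟩, ?_⟩,
      fun b => ?_⟩
    · filter_upwards [Lp.coeFn_smul c (ψ b), h1 b] with x hx e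
      simpa [e] using hx
    · beta_reduce
      rw [intervalIntegral.integral_smul, (h2 b).2 x hx, smul_add]
    · rw [map_smul, Matrix.mulVec_smul, (h3 b).1]
    · rw [map_smul, Matrix.mulVec_smul, (h3 b).2]
    · simp only [map_smul, Matrix.mulVec_smul, ← Finset.smul_sum]
      rw [← smul_sub, h4, smul_zero]
    · filter_upwards [Lp.coeFn_smul c (φ b), h5 b] with x hx e
      simpa [e] using hx

/-- The eigenspace `{ψ ∈ dom D | D ψ = k ψ}` of the massless Dirac operator on the rose. -/
noncomputable def roseEigenspace {B : ℕ} (L : Fin B → ℝ) (uo ut : Fin B → SU2) (k : ℝ) :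
    Submodule ℂ (SpinorSpace L) :=
  (roseDiracGraph L uo ut).comap (LinearMap.prod LinearMap.id ((k : ℂ) • LinearMap.id))

/-- The branch of the logarithm with cut along the ray at angle `α` to the positive real axis
and with argument in `(α - 2π, α]`. -/
noncomputable def logCut (α : ℝ) (z : ℂ) : ℂ :=
  Complex.log (z * Complex.exp (-((α - Real.pi : ℝ) * Complex.I)))
    + (α - Real.pi : ℝ) * Complex.I

/-- The power `z ^ s` for the branch `logCut α` of the logarithm. -/
noncomputable def powCut (α : ℝ) (z s : ℂ) : ℂ := Complex.exp (s * logCut α z)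

/-- `ζ` is the spectral zeta function of the massless Dirac operator on the rose: the sum of
`k ^ (-s)` over the nonzero eigenvalues `k`, each repeated according to its multiplicity
(so including Kramers' degeneracy), where this converges absolutely on `Re s > 1`, and its
analytic continuation. Powers use the logarithm with cut at angle `α`. -/
def IsRoseZeta {B : ℕ} (L : Fin B → ℝ) (uo ut : Fin B → SU2) (α : ℝ) (ζ : ℂ → ℂ) : Prop :=
  Differentiable ℂ ζ ∧
  ∀ s : ℂ, 1 < s.re →
    HasSum (fun k : {k : ℝ // k ≠ 0} =>
      (Module.finrank ℂ (roseEigenspace L uo ut k) : ℂ) * powCut α ((k : ℝ) : ℂ) (-s)) (ζ s)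

/-- The function `f̂(u) = ∑ b, (cos θ_b - cos (L_b e^{iα} u)) / sin (L_b e^{iα} u)`. -/
noncomputable def fHat {B : ℕ} (L θ : Fin B → ℝ) (α : ℝ) (u : ℝ) : ℂ :=
  ∑ b, ((Real.cos (θ b) : ℂ) - Complex.cos (L b * Complex.exp (α * Complex.I) * u)) /
    Complex.sin (L b * Complex.exp (α * Complex.I) * u)

/-- The integrand `u^{-s} d/du log (u e^{iα} f̂(u))`. -/
noncomputable def integrandNear {B : ℕ} (L θ : Fin B → ℝ) (α : ℝ) (s : ℂ) (u : ℝ) : ℂ :=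
  (u : ℂ) ^ (-s) *
    logDeriv (fun x : ℝ => (x : ℂ) * Complex.exp (α * Complex.I) * fHat L θ α x) u

/-- The integrand `u^{-s} d/du log f̂(u)`. -/
noncomputable def integrandFar {B : ℕ} (L θ : Fin B → ℝ) (α : ℝ) (s : ℂ) (u : ℝ) : ℂ :=
  (u : ℂ) ^ (-s) * logDeriv (fHat L θ α) u

/-- The explicit expression for the zeta function. The value `(-1)^{-s}` of the power with
cut at angle `α` is `e^{iπs}` for `0 < α < π` and `e^{-iπs}` for `π < α < 2π`. -/
noncomputable def roseZetaFormula {B : ℕ} (L θ : Fin B → ℝ) (α : ℝ) (s : ℂ) : ℂ :=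
  Complex.exp (Complex.I * (Real.pi - α) * s) * (2 * Complex.sin (Real.pi * s) / Real.pi) *
    ((∫ u in Set.Ioc (0 : ℝ) 1, integrandNear L θ α s u) +
      (∫ u in Set.Ioi (1 : ℝ), integrandFar L θ α s u) + 1 / s) +
  2 * (Complex.exp ((if α < Real.pi then 1 else -1) * (Complex.I * Real.pi * s)) + 1) *
    riemannZeta s * ∑ b, ((Real.pi / L b : ℝ) : ℂ) ^ (-s)

/-! The spectral problem is reduced to the divisor of one odd Herglotz function. On a bond the
equation D ψ = k ψ is a rotation of the pair (v, w) with speed k, so an eigenfunction is fixed by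
its data at the start of each bond. If sin kL_b ≠ 0, the vertex value ξ determines the data on bond
b; if sin kL_b = 0, w at the start of b remains free. For a matrix U in SU(2) one has U + U* = (tr
U)·1, so only the angles θ_b enter, and counting dimensions gives multiplicity 2·(#{b : sin kL_b =
0} + ord_k f), where f(z) = ∑ (cos θ_b - cos L_b z) / sin L_b z (`finrank_roseEigenspace_eq`,
`finrank_roseEigenspace_eq_ord`). The first summand produces the Riemann zeta terms, the second a
Dirichlet series over the zeros and poles of f (`CotSum.ordSeries`).

Half-angle formulas write f as -∑ c_j cot(λ_j z - τ_j) with c_j > 0 and τ_j equal to 0 or π/2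
(`roseCot_eval`). Such a function is odd, has positive imaginary part in the upper half-plane and
increases between its real poles. Hence its zeros and poles are real and simple, two positive zeros
are separated by a pole, and ∑ q^(-σ) converges over the positive ones for σ > 1
(`CotSum.summable_rpow_crit`). Comparing the terms of f' with those of Im f gives |f'/f| ≤ 1/|Im z|
(`CotSum.norm_logD_le`). With a Liouville theorem for functions that may blow up at the real axis
(`eq_affine_of_norm_mul_im_le`) this yields the exact expansion f'/f = -1/z + ∑ ord(q) 2z/(z² - q²),
the sum being over q > 0 (`CotSum.logD_eq_critSum`).

No contour has to be deformed: along the ray at angle α the Mellin transform of each pole pair is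
q^(-s) times an explicit factor (`mellin_rayTerm`), and summing over q for 1 < Re s < 2 expresses
the Dirichlet series through integrals of the logarithmic derivative (`CotSum.hasSum_ord_mul_cpow`).
The integrals over (0, 1] and (1, ∞) continue to Re s < 2, since z f has logarithmic derivative O(u)
at 0 and that of f decays exponentially (`CotSum.norm_logD_le_exp`). The spectrum is symmetric, so
the negative eigenvalues contribute the factor (-1)^(-s), and the factors depending on α recombine
(`cut_prefactor`). Gluing the formula on Re s < 2 to the series on Re s > 1 gives the entire
function (`exists_isRoseZeta`). -/

/-- The data of a finite sum `-∑ j, c j * cot (lam j * z - tau j)` with positive weights and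
frequencies, which is an odd function with a pole at the origin. -/
structure CotSum (ι : Type) where
  c : ι → ℝ
  lam : ι → ℝ
  tau : ι → ℝ
  c_pos : ∀ j, 0 < c j
  lam_pos : ∀ j, 0 < lam j
  tau_eq : ∀ j, tau j = 0 ∨ tau j = Real.pi / 2
  exists_tau : ∃ j, tau j = 0

/-! ### Real and imaginary parts of the sine and cotangent. -/

theorem Complex.normSq_sin_eq (w : ℂ) :
    Complex.normSq (Complex.sin w) = Real.sin w.re ^ 2 + Real.sinh w.im ^ 2 := by
  have h : Complex.sin w = (Real.sin w.re * Real.cosh w.im : ℝ)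
      + (Real.cos w.re * Real.sinh w.im : ℝ) * Complex.I := by
    rw [Complex.sin_eq w]; push_cast; ring
  rw [h, Complex.normSq_add_mul_I]
  have h1 := Real.cosh_sq w.im
  have h2 := Real.sin_sq_add_cos_sq w.re
  have : Real.cos w.re ^ 2 = 1 - Real.sin w.re ^ 2 := by linarith
  rw [mul_pow, mul_pow, h1, this]; ring

theorem Complex.sin_ne_zero_of_im_ne_zero {w : ℂ} (h : w.im ≠ 0) : Complex.sin w ≠ 0 := by
  intro h0
  have h1 := Complex.normSq_sin_eq w
  rw [h0, map_zero] at h1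
  have h2 : 0 < Real.sinh w.im ^ 2 := by
    have : Real.sinh w.im ≠ 0 := by simpa using h
    positivity
  nlinarith [sq_nonneg (Real.sin w.re)]

/-- The right-hand side has the sign of Im w, so -cot is a Herglotz function. All control of the
secular function off the real axis comes from here. -/
theorem Complex.im_neg_cot (w : ℂ) :
    (-Complex.cot w).im = Real.sinh w.im * Real.cosh w.im / Complex.normSq (Complex.sin w) := by
  have h : Complex.sin w = (Real.sin w.re * Real.cosh w.im : ℝ)
      + (Real.cos w.re * Real.sinh w.im : ℝ) * Complex.I := by
    rw [Complex.sin_eq w]; push_cast; ring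
  have h' : Complex.cos w = (Real.cos w.re * Real.cosh w.im : ℝ)
      + (-(Real.sin w.re * Real.sinh w.im) : ℝ) * Complex.I := by
    rw [Complex.cos_eq w]; push_cast; ring
  have e1 : (Complex.sin w).re = Real.sin w.re * Real.cosh w.im := by rw [h]; simp [-Complex.ofReal_mul]
  have e2 : (Complex.sin w).im = Real.cos w.re * Real.sinh w.im := by rw [h]; simp [-Complex.ofReal_mul]
  have e3 : (Complex.cos w).re = Real.cos w.re * Real.cosh w.im := by
    rw [h']; simp [-Complex.ofReal_mul, -Complex.ofReal_neg]
  have e4 : (Complex.cos w).im = -(Real.sin w.re * Real.sinh w.im) := by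
    rw [h']; simp [-Complex.ofReal_mul, -Complex.ofReal_neg]
  rw [Complex.neg_im, Complex.cot, Complex.div_im, e1, e2, e3, e4]
  have h2 := Real.sin_sq_add_cos_sq w.re
  rw [← sub_div, ← neg_div]
  congr 1
  linear_combination (Real.sinh w.im * Real.cosh w.im) * h2

theorem Complex.hasDerivAt_cot {w : ℂ} (h : Complex.sin w ≠ 0) :
    HasDerivAt Complex.cot (-(1 / Complex.sin w ^ 2)) w := by
  have := (Complex.hasDerivAt_cos w).div (Complex.hasDerivAt_sin w) h
  convert! this using 1
  have h2 := Complex.sin_sq_add_cos_sq w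
  field_simp
  linear_combination h2

theorem Complex.cot_neg' (w : ℂ) : Complex.cot (-w) = -Complex.cot w := by
  simp [Complex.cot, div_neg]

/-- Compares the modulus of the derivative of a cotangent with its imaginary part, both being
fractions over |sin|². -/
theorem Real.le_sinh_mul_cosh {t : ℝ} (ht : 0 ≤ t) : t ≤ Real.sinh t * Real.cosh t := by
  have h1 := Real.self_le_sinh_iff.2 ht
  have h2 := Real.one_le_cosh t
  nlinarith

/-! ### Cotangent sums as odd Herglotz functions. -/

namespace CotSum

variable {ι : Type} (F : CotSum ι)

/-- The argument `lam j * z - tau j` of the `j`-th cotangent. -/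
def phase (j : ι) (z : ℂ) : ℂ := F.lam j * z - F.tau j

/-- The singularities of the cotangent sum. -/
def IsPole (z : ℂ) : Prop := ∃ j, Complex.sin (F.phase j z) = 0

theorem phase_im (j : ι) (z : ℂ) : (F.phase j z).im = F.lam j * z.im := by
  simp [phase]

theorem hasDerivAt_phase (j : ι) (z : ℂ) : HasDerivAt (F.phase j) (F.lam j) z := by
  have h := ((hasDerivAt_id z).const_mul (F.lam j : ℂ)).sub_const (F.tau j : ℂ)
  rw [mul_one] at h
  exact h

theorem sin_phase_ne_zero (j : ι) {z : ℂ} (hz : z.im ≠ 0) : Complex.sin (F.phase j z) ≠ 0 :=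
  Complex.sin_ne_zero_of_im_ne_zero (by
    rw [phase_im]; exact mul_ne_zero (F.lam_pos j).ne' hz)

theorem not_isPole_of_im_ne_zero {z : ℂ} (hz : z.im ≠ 0) : ¬F.IsPole z := by
  rintro ⟨j, hj⟩
  exact F.sin_phase_ne_zero j hz hj

theorem isPole_zero : F.IsPole 0 := by
  obtain ⟨j, hj⟩ := F.exists_tau
  exact ⟨j, by simp [phase, hj]⟩

theorem sin_phase_neg (j : ι) (z : ℂ) :
    Complex.sin (F.phase j (-z)) = -Complex.sin (F.phase j z) ∨
      Complex.sin (F.phase j (-z)) = Complex.sin (F.phase j z) := by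
  rcases F.tau_eq j with h | h
  · left; simp [phase, h]
  · right; simp [phase, h, Complex.sin_sub_pi_div_two]

theorem cot_phase_neg (j : ι) (z : ℂ) :
    Complex.cot (F.phase j (-z)) = -Complex.cot (F.phase j z) := by
  rcases F.tau_eq j with h | h
  · simp [phase, h, Complex.cot_neg']
  · simp [phase, h, Complex.cot, Complex.sin_sub_pi_div_two, Complex.cos_sub_pi_div_two, neg_div]

theorem isPole_neg (z : ℂ) : F.IsPole (-z) ↔ F.IsPole z := by
  refine exists_congr fun j => ?_
  rcases F.sin_phase_neg j z with h | h <;> simp [h]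

variable [Fintype ι]

/-- The meromorphic function `-∑ j, c j * cot (lam j * z - tau j)`. -/
noncomputable def eval (z : ℂ) : ℂ := -∑ j, (F.c j : ℂ) * Complex.cot (F.phase j z)

/-- The derivative of the cotangent sum away from its poles. -/
noncomputable def evalDeriv (z : ℂ) : ℂ :=
  ∑ j, (F.c j * F.lam j : ℂ) / Complex.sin (F.phase j z) ^ 2

theorem eval_neg (z : ℂ) : F.eval (-z) = -F.eval z := by
  simp [eval, cot_phase_neg, Finset.sum_neg_distrib]

theorem evalDeriv_neg (z : ℂ) : F.evalDeriv (-z) = F.evalDeriv z := by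
  refine Finset.sum_congr rfl fun j _ => ?_
  rcases F.sin_phase_neg j z with h | h <;> simp [h]

theorem hasDerivAt_eval {z : ℂ} (hz : ¬F.IsPole z) : HasDerivAt F.eval (F.evalDeriv z) z := by
  have h : ∀ j ∈ Finset.univ, HasDerivAt (fun z => (F.c j : ℂ) * Complex.cot (F.phase j z))
      ((F.c j : ℂ) * (-(1 / Complex.sin (F.phase j z) ^ 2) * F.lam j)) z := fun j _ =>
    ((Complex.hasDerivAt_cot fun h => hz ⟨j, h⟩).comp z (F.hasDerivAt_phase j z)).const_mul _
  convert! (HasDerivAt.fun_sum h).neg using 1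
  rw [evalDeriv, ← Finset.sum_neg_distrib]
  refine Finset.sum_congr rfl fun j _ => ?_
  ring

theorem isOpen_not_isPole : IsOpen {z | ¬F.IsPole z} := by
  have : {z | ¬F.IsPole z} = ⋂ j, {z | Complex.sin (F.phase j z) ≠ 0} := by
    ext z; simp [IsPole]
  rw [this]
  refine isOpen_iInter_of_finite fun j => isOpen_ne_fun ?_ continuous_const
  exact Complex.continuous_sin.comp
    (continuous_iff_continuousAt.2 fun z => (F.hasDerivAt_phase j z).continuousAt)

theorem eval_im (z : ℂ) : (F.eval z).im = ∑ j, F.c j *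
    (Real.sinh (F.lam j * z.im) * Real.cosh (F.lam j * z.im) /
      Complex.normSq (Complex.sin (F.phase j z))) := by
  rw [eval, ← Finset.sum_neg_distrib, Complex.im_sum]
  refine Finset.sum_congr rfl fun j _ => ?_
  rw [← mul_neg, Complex.im_ofReal_mul, Complex.im_neg_cot, phase_im]

/-- This is the Schwarz–Pick bound for a Herglotz function. Here it holds term by term: both sides
have the denominators |sin|², and the numerators compare by t ≤ sinh t cosh t with t = λ_j Im z. -/
theorem norm_evalDeriv_mul_im_le {z : ℂ} (hz : 0 < z.im) :
    ‖F.evalDeriv z‖ * z.im ≤ (F.eval z).im := by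
  rw [eval_im]
  calc ‖F.evalDeriv z‖ * z.im
      ≤ (∑ j, ‖(F.c j * F.lam j : ℂ) / Complex.sin (F.phase j z) ^ 2‖) * z.im := by
        gcongr; exact norm_sum_le _ _
    _ = ∑ j, F.c j * ((F.lam j * z.im) / Complex.normSq (Complex.sin (F.phase j z))) := by
        rw [Finset.sum_mul]
        refine Finset.sum_congr rfl fun j _ => ?_
        rw [Complex.normSq_eq_norm_sq, norm_div, norm_mul, norm_pow, Complex.norm_real,
          Complex.norm_real, Real.norm_of_nonneg (F.c_pos j).le,
          Real.norm_of_nonneg (F.lam_pos j).le]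
        ring
    _ ≤ _ := by
        refine Finset.sum_le_sum fun j _ => ?_
        have h1 := F.c_pos j
        have h2 := Real.le_sinh_mul_cosh (mul_pos (F.lam_pos j) hz).le
        have h3 := Complex.normSq_nonneg (Complex.sin (F.phase j z))
        gcongr

theorem eval_im_pos {z : ℂ} (hz : 0 < z.im) : 0 < (F.eval z).im := by
  rw [eval_im]
  obtain ⟨j₀, -⟩ := F.exists_tau
  refine Finset.sum_pos (fun j _ => ?_) ⟨j₀, Finset.mem_univ _⟩
  have h1 := F.c_pos j
  have h2 := Real.sinh_pos_iff.2 (mul_pos (F.lam_pos j) hz)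
  have h3 := Complex.normSq_pos.2 (F.sin_phase_ne_zero j hz.ne')
  have h4 := Real.cosh_pos (F.lam j * z.im)
  positivity

theorem eval_ne_zero {z : ℂ} (hz : z.im ≠ 0) : F.eval z ≠ 0 := by
  rcases hz.lt_or_gt with h | h
  · have := F.eval_im_pos (z := -z) (by simpa using h)
    rw [eval_neg] at this
    intro h0
    simp [h0] at this
  · intro h0
    have := F.eval_im_pos h
    simp [h0] at this

/-- The logarithmic derivative of the cotangent sum. -/
noncomputable def logD (z : ℂ) : ℂ := F.evalDeriv z / F.eval z

theorem logD_neg (z : ℂ) : F.logD (-z) = -F.logD z := by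
  rw [logD, evalDeriv_neg, eval_neg, div_neg, logD]

/-- Schwarz–Pick together with Im f ≤ |f|; oddness transfers the bound to the lower half-plane. It
holds uniformly, however close z comes to the zeros and poles, so no contours threading between them
are needed. -/
theorem norm_logD_le (z : ℂ) (hz : z.im ≠ 0) : ‖F.logD z‖ ≤ 1 / |z.im| := by
  wlog h : 0 < z.im generalizing z with H
  · have := H (-z) (by simpa using hz) (by
      simp only [Complex.neg_im]; rcases hz.lt_or_gt with h' | h' <;> [linarith; exact absurd h' h])
    simpa [logD_neg] using this
  · have h1 := F.norm_evalDeriv_mul_im_le h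
    have h2 := F.eval_im_pos h
    have h3 : (F.eval z).im ≤ ‖F.eval z‖ := (le_abs_self _).trans (Complex.abs_im_le_norm _)
    rw [abs_of_pos h, logD, norm_div, div_le_div_iff₀ (by linarith) h]
    linarith

end CotSum
-- Decay of the logarithmic derivative; zeros and poles on the real axis.
namespace CotSum
variable {ι : Type} (F : CotSum ι) [Fintype ι]

/-- For large Im z every cotangent is exponentially close to a constant, so f' is exponentially
small while Im f is not. The proof compares the two sums termwise, as in `norm_evalDeriv_mul_im_le`.
-/
theorem norm_logD_le_exp {z : ℂ} (hz : 0 < z.im) :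
    ‖F.logD z‖ ≤ ∑ j, 2 * Real.exp (-(F.lam j * z.im)) / z.im := by
  have hf := F.eval_im_pos hz
  have hfn : (F.eval z).im ≤ ‖F.eval z‖ := (le_abs_self _).trans (Complex.abs_im_le_norm _)
  set ε : ℝ := ∑ j, 2 * Real.exp (-(F.lam j * z.im)) / z.im with hε
  have hε0 : 0 ≤ ε := Finset.sum_nonneg fun j _ => by positivity
  rw [logD, norm_div, div_le_iff₀ (hf.trans_le hfn)]
  refine le_trans ?_ (mul_le_mul_of_nonneg_left hfn hε0)
  rw [eval_im, Finset.mul_sum]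
  refine (norm_sum_le _ _).trans (Finset.sum_le_sum fun j _ => ?_)
  have h1 := F.c_pos j
  have h2 := F.lam_pos j
  have h3 : 0 < F.lam j * z.im := mul_pos h2 hz
  have hj : 2 * Real.exp (-(F.lam j * z.im)) / z.im ≤ ε :=
    Finset.single_le_sum (f := fun j => 2 * Real.exp (-(F.lam j * z.im)) / z.im)
      (fun j _ => by positivity) (Finset.mem_univ j)
  have h4 := Real.self_le_sinh_iff.2 h3.le
  have h5 : Real.exp (F.lam j * z.im) / 2 ≤ Real.cosh (F.lam j * z.im) := by
    rw [Real.cosh_eq]; gcongr; linarith [Real.exp_pos (-(F.lam j * z.im))]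
  -- Only sinh t ≥ t and cosh t ≥ exp(t)/2 are used; the j-th summand of ε is what makes their
  -- product equal to λ_j.
  have h6 : F.lam j ≤ ε * (Real.sinh (F.lam j * z.im) * Real.cosh (F.lam j * z.im)) :=
    calc F.lam j = (2 * Real.exp (-(F.lam j * z.im)) / z.im) *
        ((F.lam j * z.im) * (Real.exp (F.lam j * z.im) / 2)) := by
          rw [Real.exp_neg]; field_simp
      _ ≤ _ := by gcongr
  have h7 := Complex.normSq_pos.2 (F.sin_phase_ne_zero j hz.ne')
  rw [norm_div, norm_mul, norm_pow, Complex.norm_real, Complex.norm_real,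
    Real.norm_of_nonneg h1.le, Real.norm_of_nonneg h2.le, ← Complex.normSq_eq_norm_sq]
  calc F.c j * F.lam j / Complex.normSq (Complex.sin (F.phase j z))
      ≤ F.c j * (ε * (Real.sinh (F.lam j * z.im) * Real.cosh (F.lam j * z.im))) /
        Complex.normSq (Complex.sin (F.phase j z)) := by gcongr
    _ = _ := by ring

/-- All terms of f' are positive at real points. Hence real zeros are simple, and f is increasing
between consecutive poles. -/
theorem evalDeriv_ofReal_pos {x : ℝ} (hx : ¬F.IsPole x) : 0 < (F.evalDeriv x).re := by
  have h : ∀ j, (F.c j * F.lam j : ℂ) / Complex.sin (F.phase j x) ^ 2 =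
      ((F.c j * F.lam j / Real.sin (F.lam j * x - F.tau j) ^ 2 : ℝ) : ℂ) := fun j => by
    simp [phase]
  rw [evalDeriv, Complex.re_sum]
  obtain ⟨j₀, -⟩ := F.exists_tau
  refine Finset.sum_pos (fun j _ => ?_) ⟨j₀, Finset.mem_univ _⟩
  rw [h, Complex.ofReal_re]
  have h1 := F.c_pos j
  have h2 := F.lam_pos j
  have h3 : Real.sin (F.lam j * x - F.tau j) ≠ 0 := fun h0 => hx ⟨j, by
    have : F.phase j x = ((F.lam j * x - F.tau j : ℝ) : ℂ) := by simp [phase]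
    rw [this, ← Complex.ofReal_sin, h0, Complex.ofReal_zero]⟩
  positivity

theorem eval_re_lt {x y : ℝ} (hxy : x < y) (h : ∀ t ∈ Set.Icc x y, ¬F.IsPole (t : ℂ)) :
    (F.eval x).re < (F.eval y).re := by
  have hd : ∀ t ∈ Set.Icc x y, HasDerivAt (fun t : ℝ => (F.eval t).re) (F.evalDeriv t).re t :=
    fun t ht => (F.hasDerivAt_eval (h t ht)).real_of_complex
  refine strictMonoOn_of_deriv_pos (convex_Icc x y)
    (fun t ht => (hd t ht).continuousAt.continuousWithinAt) (fun t ht => ?_)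
    (Set.left_mem_Icc.2 hxy.le) (Set.right_mem_Icc.2 hxy.le) hxy
  rw [interior_Icc] at ht
  have ht' := Set.Ioo_subset_Icc_self ht
  rw [(hd t ht').deriv]
  exact F.evalDeriv_ofReal_pos (h t ht')

open Classical in
/-- The order of vanishing of the cotangent sum at a real point. -/
noncomputable def ord (x : ℝ) : ℤ := if F.IsPole x then -1 else if F.eval x = 0 then 1 else 0

theorem ord_zero : F.ord 0 = -1 := by
  rw [ord, if_pos]; simpa using F.isPole_zero

theorem ord_neg (x : ℝ) : F.ord (-x) = F.ord x := by
  have h : F.IsPole ((-x : ℝ) : ℂ) ↔ F.IsPole x := by rw [Complex.ofReal_neg, isPole_neg]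
  by_cases hp : F.IsPole x
  · rw [ord, ord, if_pos hp, if_pos (h.2 hp)]
  · rw [ord, ord, if_neg hp, if_neg (mt h.1 hp), Complex.ofReal_neg, eval_neg]
    simp only [neg_eq_zero]

theorem abs_ord_le (x : ℝ) : |F.ord x| ≤ 1 := by
  unfold ord; split_ifs <;> simp

theorem analyticAt_eval {z : ℂ} (hz : ¬F.IsPole z) : AnalyticAt ℂ F.eval z :=
  (DifferentiableOn.analyticAt (s := {z | ¬F.IsPole z})
    (fun _ hw => (F.hasDerivAt_eval hw).differentiableAt.differentiableWithinAt)
    (F.isOpen_not_isPole.mem_nhds hz))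

theorem deriv_eval {z : ℂ} (hz : ¬F.IsPole z) : deriv F.eval z = F.evalDeriv z :=
  (F.hasDerivAt_eval hz).deriv

theorem eventually_logD_eq {z : ℂ} (hz : ¬F.IsPole z) : F.logD =ᶠ[𝓝 z] logDeriv F.eval := by
  filter_upwards [F.isOpen_not_isPole.mem_nhds hz] with w hw
  rw [logD, logDeriv_apply, F.deriv_eval hw]

theorem analyticAt_logD {z : ℂ} (hz : ¬F.IsPole z) (h0 : F.eval z ≠ 0) :
    AnalyticAt ℂ F.logD z :=
  ((F.analyticAt_eval hz).deriv.div (F.analyticAt_eval hz) h0).congr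
    (F.eventually_logD_eq hz).symm

omit [Fintype ι] in
theorem hasDerivAt_sin_phase (j : ι) (z : ℂ) : HasDerivAt (fun z => Complex.sin (F.phase j z))
    (Complex.cos (F.phase j z) * F.lam j) z :=
  (Complex.hasDerivAt_sin _).comp z (F.hasDerivAt_phase j z)

omit [Fintype ι] in
theorem cos_phase_ne_zero {j : ι} {z : ℂ} (h : Complex.sin (F.phase j z) = 0) :
    Complex.cos (F.phase j z) ≠ 0 := by
  intro h0
  have := Complex.sin_sq_add_cos_sq (F.phase j z)
  simp [h, h0] at this

theorem eventually_not_isPole (z : ℂ) : ∀ᶠ w in 𝓝[≠] z, ¬F.IsPole w := by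
  have : ∀ j, ∀ᶠ w in 𝓝[≠] z, Complex.sin (F.phase j w) ≠ 0 := fun j => by
    by_cases h : Complex.sin (F.phase j z) = 0
    · exact (F.hasDerivAt_sin_phase j z).eventually_ne
        (mul_ne_zero (F.cos_phase_ne_zero h) (by exact_mod_cast (F.lam_pos j).ne'))
    · exact ((F.hasDerivAt_sin_phase j z).continuousAt.eventually_ne h).filter_mono
        nhdsWithin_le_nhds
  filter_upwards [eventually_all.2 this] with w hw
  rintro ⟨j, hj⟩
  exact hw j hj

omit [Fintype ι] in
-- Regular and singular cotangents are put in the same form, with r the residue (zero at a regular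
-- point, 1/λ_j at a pole). Since no residue is negative, poles of several cotangents at one point
-- cannot cancel in the sum.
theorem exists_cot_phase_eq_div (j : ι) (z : ℂ) : ∃ (g : ℂ → ℂ) (r : ℝ), AnalyticAt ℂ g z ∧
    g z = r ∧ 0 ≤ r ∧ (Complex.sin (F.phase j z) = 0 → 0 < r) ∧
    ∀ᶠ w in 𝓝[≠] z, Complex.cot (F.phase j w) = (w - z)⁻¹ * g w := by
  have hcos : AnalyticAt ℂ (fun w => Complex.cos (F.phase j w)) z :=
    (DifferentiableOn.analyticAt (s := Set.univ) (fun w _ =>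
      ((Complex.hasDerivAt_cos _).comp w
        (F.hasDerivAt_phase j w)).differentiableAt.differentiableWithinAt) univ_mem)
  have hsin : DifferentiableOn ℂ (fun w => Complex.sin (F.phase j w)) Set.univ := fun w _ =>
      (F.hasDerivAt_sin_phase j w).differentiableAt.differentiableWithinAt
  by_cases h : Complex.sin (F.phase j z) = 0
  · set d := dslope (fun w => Complex.sin (F.phase j w)) z with hd
    have hda : AnalyticAt ℂ d z := DifferentiableOn.analyticAt
      ((Complex.differentiableOn_dslope univ_mem).2 hsin) univ_mem
    have hdz : d z = Complex.cos (F.phase j z) * F.lam j := by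
      rw [hd, dslope_same, (F.hasDerivAt_sin_phase j z).deriv]
    have hl : (F.lam j : ℂ) ≠ 0 := by exact_mod_cast (F.lam_pos j).ne'
    have hc := F.cos_phase_ne_zero h
    refine ⟨fun w => Complex.cos (F.phase j w) / d w, (F.lam j)⁻¹,
      hcos.div hda (by rw [hdz]; exact mul_ne_zero hc hl), ?_, (inv_pos.2 (F.lam_pos j)).le,
      fun _ => inv_pos.2 (F.lam_pos j), ?_⟩
    · simp only [hdz, Complex.ofReal_inv]; field_simp
    · filter_upwards [self_mem_nhdsWithin] with w hw
      rw [hd, dslope_of_ne _ hw, slope_def_field, h, sub_zero, Complex.cot]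
      have : w - z ≠ 0 := sub_ne_zero.2 hw
      field_simp
  · refine ⟨fun w => (w - z) * Complex.cot (F.phase j w), 0, ?_, by simp, le_rfl,
      fun h' => absurd h' h, ?_⟩
    · exact (analyticAt_id.sub analyticAt_const).mul
        (hcos.div (DifferentiableOn.analyticAt hsin univ_mem) h)
    · filter_upwards [self_mem_nhdsWithin] with w hw
      have : w - z ≠ 0 := sub_ne_zero.2 hw
      field_simp

/-- Justifies `ord`: at a pole the residues add up with one sign, and at a zero the derivative is
positive, so the order is never beyond ±1. -/
theorem exists_eval_eq_zpow_mul (x : ℝ) : ∃ G : ℂ → ℂ, AnalyticAt ℂ G x ∧ G x ≠ 0 ∧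
    ∀ᶠ z in 𝓝[≠] (x : ℂ), F.eval z = (z - x) ^ F.ord x * G z := by
  by_cases hp : F.IsPole x
  · choose g r hg hgr hr hpos heq using fun j => F.exists_cot_phase_eq_div j x
    refine ⟨fun z => -∑ j, (F.c j : ℂ) * g j z,
      (Finset.analyticAt_fun_sum _ fun j _ => analyticAt_const.mul (hg j)).neg, ?_, ?_⟩
    · have h1 : 0 < ∑ j, F.c j * r j := by
        obtain ⟨j, hj⟩ := hp
        exact Finset.sum_pos' (fun j _ => mul_nonneg (F.c_pos j).le (hr j))
          ⟨j, Finset.mem_univ _, mul_pos (F.c_pos j) (hpos j hj)⟩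
      simp only [hgr, neg_ne_zero]
      exact_mod_cast h1.ne'
    · filter_upwards [eventually_all.2 heq] with z hz
      rw [ord, if_pos hp, eval, zpow_neg_one, mul_neg, Finset.mul_sum]
      congr 1
      refine Finset.sum_congr rfl fun j _ => ?_
      rw [hz j]; ring
  · by_cases h0 : F.eval x = 0
    · refine ⟨dslope F.eval x, DifferentiableOn.analyticAt (s := {z | ¬F.IsPole z})
        ((Complex.differentiableOn_dslope (F.isOpen_not_isPole.mem_nhds hp)).2
        (fun w hw => (F.hasDerivAt_eval hw).differentiableAt.differentiableWithinAt))
        (F.isOpen_not_isPole.mem_nhds hp), ?_, ?_⟩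
      · rw [dslope_same, F.deriv_eval hp]
        intro h
        have := F.evalDeriv_ofReal_pos hp
        simp [h] at this
      · filter_upwards [self_mem_nhdsWithin] with z hz
        rw [ord, if_neg hp, if_pos h0, zpow_one, dslope_of_ne _ hz, slope_def_field, h0, sub_zero]
        have : z - x ≠ 0 := sub_ne_zero.2 hz
        field_simp
    · exact ⟨F.eval, F.analyticAt_eval hp, h0, by simp [ord, hp, h0]⟩

theorem exists_logD_eq_div_add (x : ℝ) : ∃ g : ℂ → ℂ, AnalyticAt ℂ g x ∧
    ∀ᶠ z in 𝓝[≠] (x : ℂ), F.logD z = F.ord x / (z - x) + g z := by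
  obtain ⟨G, hG, hG0, heq⟩ := F.exists_eval_eq_zpow_mul x
  refine ⟨logDeriv G, hG.deriv.div hG hG0, ?_⟩
  filter_upwards [eventually_eventually_nhdsWithin.2 heq, self_mem_nhdsWithin,
    F.eventually_not_isPole x, (hG.continuousAt.eventually_ne hG0).filter_mono nhdsWithin_le_nhds,
    hG.eventually_analyticAt.filter_mono nhdsWithin_le_nhds] with z hz hzx hp hz0 hza
  have hzx' : z - x ≠ 0 := sub_ne_zero.2 hzx
  have hz' : F.eval =ᶠ[𝓝 z] fun z => (z - x) ^ F.ord x * G z := by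
    rwa [nhdsWithin_eq_nhds.2 (isOpen_compl_singleton.mem_nhds hzx)] at hz
  have hd : DifferentiableAt ℂ (fun z : ℂ => z - x) z := by fun_prop
  rw [(F.eventually_logD_eq hp).eq_of_nhds, (logDeriv_congr_nhds hz').eq_of_nhds,
    logDeriv_mul (f := fun z : ℂ => (z - x) ^ F.ord x) (g := G) z (zpow_ne_zero _ hzx') hz0 (hd.zpow (Or.inl hzx')) hza.differentiableAt,
    logDeriv_fun_zpow hd]
  congr 1
  rw [logDeriv_apply, deriv_sub_const, deriv_id'']
  ring

end CotSum
-- Density of the zeros and poles.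
-- An injective labelling by natural numbers that grows at most linearly bounds q below by a
-- multiple of its label, so the series is compared with ∑ n^(-σ).
theorem summable_rpow_neg_of_injOn {A : Set ℝ} (hA : ∀ q ∈ A, 0 < q) {N : ℝ → ℕ}
    (hN : Set.InjOn N A) {C : ℝ} (hC0 : 0 < C) (hC : ∀ q ∈ A, (N q : ℝ) ≤ C * q + C)
    {σ : ℝ} (hσ : 1 < σ) : Summable (fun q : A => (q : ℝ) ^ (-σ)) := by
  have hinj : Function.Injective (fun q : A => N q) := hN.injective
  have hs : Summable (fun q : A => (N q : ℝ) ^ (-σ)) :=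
    (Real.summable_nat_rpow.2 (by linarith)).comp_injective hinj
  refine summable_of_isBigO hs (Asymptotics.IsBigO.of_bound ((2 * C)⁻¹ ^ (-σ)) ?_)
  have ht : Tendsto (fun q : A => N q) cofinite atTop :=
    Nat.cofinite_eq_atTop ▸ hinj.tendsto_cofinite
  -- Outside a finite set N q ≥ 2C, so the additive constant C is at most half of N q and q ≥ N q /
  -- (2C).
  filter_upwards [ht.eventually_ge_atTop (⌈2 * C⌉₊ + 1)] with q hq
  have h1 : 2 * C ≤ N q := (Nat.le_ceil _).trans (by exact_mod_cast (by omega : ⌈2 * C⌉₊ ≤ N q))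
  have h2 : (0 : ℝ) < N q := by linarith
  have h3 := hC q q.2
  have h4 : (2 * C)⁻¹ * N q ≤ q := by
    rw [inv_mul_le_iff₀ (by positivity)]; linarith
  rw [Real.norm_of_nonneg (Real.rpow_nonneg (hA q q.2).le _),
    Real.norm_of_nonneg (Real.rpow_nonneg h2.le _), ← Real.mul_rpow (by positivity) h2.le]
  exact Real.rpow_le_rpow_of_nonpos (by positivity) h4 (by linarith)

namespace CotSum
variable {ι : Type} (F : CotSum ι)

/-- The index of the half period of the `j`-th cotangent containing `q`. -/
noncomputable def branch (j : ι) (q : ℝ) : ℕ := ⌊(F.lam j * q - F.tau j) / Real.pi + 1⌋₊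

/-- This bound is the reason for the summand 1 in `branch`: the argument of the natural floor stays
positive, so truncation at 0 never merges two half periods. -/
theorem neg_half_le_phase_div (j : ι) {q : ℝ} (hq : 0 ≤ q) :
    -(1 / 2) ≤ (F.lam j * q - F.tau j) / Real.pi := by
  have h1 := mul_nonneg (F.lam_pos j).le hq
  have h2 := Real.pi_pos
  rw [le_div_iff₀ h2]
  rcases F.tau_eq j with h | h <;> rw [h] <;> linarith

theorem tau_nonneg (j : ι) : 0 ≤ F.tau j := by
  rcases F.tau_eq j with h | h <;> rw [h]
  linarith [Real.pi_pos]

theorem branch_le (j : ι) {q : ℝ} (hq : 0 ≤ q) :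
    (F.branch j q : ℝ) ≤ (F.lam j / Real.pi + 1) * q + (F.lam j / Real.pi + 1) := by
  have h1 := F.neg_half_le_phase_div j hq
  have h2 := F.tau_nonneg j
  have h3 := F.lam_pos j
  have h4 := Real.pi_pos
  refine (Nat.floor_le (by linarith)).trans ?_
  have h5 : (F.lam j * q - F.tau j) / Real.pi ≤ F.lam j / Real.pi * q := by
    rw [div_mul_eq_mul_div]; gcongr; linarith
  have h6 : 0 < F.lam j / Real.pi := by positivity
  nlinarith

theorem branch_mono (j : ι) {p q : ℝ} (hpq : p ≤ q) : F.branch j p ≤ F.branch j q := by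
  have h3 := F.lam_pos j
  have h4 := Real.pi_pos
  unfold branch
  gcongr

theorem exists_phase_eq {j : ι} {q : ℝ} (hq : 0 ≤ q) (h : Complex.sin (F.phase j q) = 0) :
    ∃ n : ℕ, (F.lam j * q - F.tau j) / Real.pi = n := by
  have h1 : F.phase j q = ((F.lam j * q - F.tau j : ℝ) : ℂ) := by simp [phase]
  rw [h1, ← Complex.ofReal_sin, Complex.ofReal_eq_zero, Real.sin_eq_zero_iff] at h
  obtain ⟨n, hn⟩ := h
  have h2 := F.neg_half_le_phase_div j hq
  rw [← hn, mul_div_cancel_right₀ _ Real.pi_ne_zero] at h2 ⊢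
  have h3 : 0 ≤ n := by
    by_contra h4
    have : (n : ℝ) ≤ -1 := by exact_mod_cast (by omega : n ≤ -1)
    linarith
  lift n to ℕ using h3
  exact ⟨n, rfl⟩

theorem branch_injOn_sin_zeros (j : ι) :
    Set.InjOn (F.branch j) {q : ℝ | 0 < q ∧ Complex.sin (F.phase j q) = 0} := by
  rintro p ⟨hp, hp0⟩ q ⟨hq, hq0⟩ h
  obtain ⟨m, hm⟩ := F.exists_phase_eq hp.le hp0
  obtain ⟨n, hn⟩ := F.exists_phase_eq hq.le hq0
  rw [branch, branch, hm, hn] at h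
  rw [Nat.floor_add_one (Nat.cast_nonneg m), Nat.floor_add_one (Nat.cast_nonneg n),
    Nat.floor_natCast, Nat.floor_natCast] at h
  have h1 : m = n := by omega
  rw [← h1, ← hm, div_left_inj' Real.pi_ne_zero] at hn
  have := F.lam_pos j
  have h2 : F.lam j * p = F.lam j * q := by linarith
  exact mul_left_cancel₀ this.ne' h2

/-- The floor jumps at the pole itself, which may therefore coincide with the right end q but not
with the left end p. -/
theorem branch_lt_of_sin_eq_zero (j : ι) {p t q : ℝ} (hp : 0 < p) (hpt : p < t) (htq : t ≤ q)
    (ht : Complex.sin (F.phase j t) = 0) : F.branch j p < F.branch j q := by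
  refine lt_of_lt_of_le ?_ (F.branch_mono j htq)
  obtain ⟨n, hn⟩ := F.exists_phase_eq (hp.trans hpt).le ht
  have h1 : F.branch j t = n + 1 := by rw [branch, hn]; exact_mod_cast Nat.floor_natCast (n + 1)
  rw [h1, branch, Nat.floor_lt (by linarith [F.neg_half_le_phase_div j hp.le])]
  have h2 : (F.lam j * p - F.tau j) / Real.pi < (F.lam j * t - F.tau j) / Real.pi := by
    have := F.lam_pos j
    have := Real.pi_pos
    gcongr
  push_cast
  linarith

variable [Fintype ι]

/-- Two zeros must be separated by a pole, because f increases on an interval free of poles. At that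
pole one index jumps and none decreases, so the total index tells zeros apart. -/
theorem sum_branch_injOn_zeros :
    Set.InjOn (fun q => ∑ j, F.branch j q) {q : ℝ | 0 < q ∧ ¬F.IsPole q ∧ F.eval q = 0} := by
  have key : ∀ p q : ℝ, 0 < p → p < q → ¬F.IsPole p → F.eval p = 0 → F.eval q = 0 →
      ∑ j, F.branch j p < ∑ j, F.branch j q := by
    intro p q hp hpq hpp hp0 hq0
    have h : ∃ t ∈ Set.Icc p q, F.IsPole (t : ℂ) := by
      by_contra! h
      have := F.eval_re_lt hpq h
      simp [hp0, hq0] at this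
    obtain ⟨t, ⟨ht1, ht2⟩, j, hj⟩ := h
    have ht1' : p < t := lt_of_le_of_ne ht1 fun h => hpp ⟨j, h ▸ hj⟩
    exact Finset.sum_lt_sum (fun i _ => F.branch_mono i hpq.le)
      ⟨j, Finset.mem_univ _, F.branch_lt_of_sin_eq_zero j hp ht1' ht2 hj⟩
  rintro p ⟨hp, hpp, hp0⟩ q ⟨hq, hqp, hq0⟩ h
  rcases lt_trichotomy p q with h1 | h1 | h1
  · exact absurd h (key p q hp h1 hpp hp0 hq0).ne
  · exact h1
  · exact absurd h (key q p hq h1 hqp hq0 hp0).ne'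

/-- The positive zeros and poles of the cotangent sum. -/
def crit : Set ℝ := {q | 0 < q ∧ F.ord q ≠ 0}

theorem summable_rpow_zeros {σ : ℝ} (hσ : 1 < σ) : Summable
    ({q : ℝ | 0 < q ∧ ¬F.IsPole q ∧ F.eval q = 0}.indicator fun q => q ^ (-σ)) := by
  rw [← summable_subtype_iff_indicator]
  have hC : ∀ j, 0 < F.lam j / Real.pi + 1 := fun j => by
    have := F.lam_pos j
    have := Real.pi_pos
    positivity
  refine summable_rpow_neg_of_injOn (fun q hq => hq.1) F.sum_branch_injOn_zeros
    (C := ∑ j, (F.lam j / Real.pi + 1)) ?_ (fun q hq => ?_) hσ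
  · obtain ⟨j₀, -⟩ := F.exists_tau
    exact Finset.sum_pos (fun j _ => hC j) ⟨j₀, Finset.mem_univ _⟩
  · rw [Finset.sum_mul, ← Finset.sum_add_distrib, Nat.cast_sum]
    exact Finset.sum_le_sum fun j _ => F.branch_le j hq.1.le

omit [Fintype ι] in
theorem summable_rpow_sin_zeros (j : ι) {σ : ℝ} (hσ : 1 < σ) : Summable
    ({q : ℝ | 0 < q ∧ Complex.sin (F.phase j q) = 0}.indicator fun q => q ^ (-σ)) := by
  rw [← summable_subtype_iff_indicator]
  have hC : 0 < F.lam j / Real.pi + 1 := by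
    have := F.lam_pos j
    have := Real.pi_pos
    positivity
  exact summable_rpow_neg_of_injOn (fun q hq => hq.1) (F.branch_injOn_sin_zeros j) hC
    (fun q hq => F.branch_le j hq.1.le) hσ

theorem summable_rpow_crit {σ : ℝ} (hσ : 1 < σ) :
    Summable (fun q : F.crit => (q : ℝ) ^ (-σ)) := by
  have h0 : ∀ (S : Set ℝ), (∀ q ∈ S, 0 < q) → ∀ q, 0 ≤ S.indicator (fun q : ℝ => q ^ (-σ)) q :=
    fun S hS q => Set.indicator_nonneg (fun q hq => Real.rpow_nonneg (hS q hq).le _) q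
  have key : Summable (F.crit.indicator fun q : ℝ => q ^ (-σ)) := by
    refine Summable.of_nonneg_of_le (h0 _ fun q hq => hq.1) (fun q => ?_)
      ((F.summable_rpow_zeros hσ).add
        (summable_sum fun j (_ : j ∈ Finset.univ) => F.summable_rpow_sin_zeros j hσ))
    have hZ0 := h0 {q : ℝ | 0 < q ∧ ¬F.IsPole q ∧ F.eval q = 0} (fun q hq => hq.1) q
    have hP0 := fun j => h0 {q : ℝ | 0 < q ∧ Complex.sin (F.phase j q) = 0} (fun q hq => hq.1) q
    by_cases hq : q ∈ F.crit
    · rw [Set.indicator_of_mem hq]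
      obtain ⟨hq0, hq1⟩ := hq
      by_cases hp : F.IsPole q
      · obtain ⟨j, hj⟩ := hp
        have hqj : q ∈ {q : ℝ | 0 < q ∧ Complex.sin (F.phase j q) = 0} := ⟨hq0, hj⟩
        have h1 := Finset.single_le_sum (fun j _ => hP0 j) (Finset.mem_univ j)
        rw [Set.indicator_of_mem hqj] at h1
        exact h1.trans (le_add_of_nonneg_left hZ0)
      · have h3 : F.eval q = 0 := by
          by_contra h4
          rw [ord, if_neg hp, if_neg h4] at hq1
          exact hq1 rfl
        have hqZ : q ∈ {q : ℝ | 0 < q ∧ ¬F.IsPole q ∧ F.eval q = 0} := ⟨hq0, hp, h3⟩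
        rw [Set.indicator_of_mem hqZ]
        exact le_add_of_nonneg_right (Finset.sum_nonneg fun j _ => hP0 j)
    · rw [Set.indicator_of_notMem hq]
      exact add_nonneg hZ0 (Finset.sum_nonneg fun j _ => hP0 j)
  exact summable_subtype_iff_indicator.2 key

theorem countable_crit : F.crit.Countable := by
  have h := (F.summable_rpow_crit (σ := 2) (by norm_num)).countable_support
  have h2 : Function.support (fun q : F.crit => (q : ℝ) ^ (-2 : ℝ)) = Set.univ := by
    ext q; simpa only [Function.mem_support, Set.mem_univ, iff_true] using
      (Real.rpow_pos_of_pos q.2.1 _).ne'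
  rw [h2] at h
  exact Set.countable_coe_iff.1 (Set.countable_univ_iff.1 h)

end CotSum
-- A Liouville theorem for functions singular along the real axis.
-- The value of h at a removable singularity may be an artefact of division by zero. Punctured
-- limits replace it, and agree with h wherever h is continuous.
theorem exists_entire_extension {h : ℂ → ℂ}
    (hh : ∀ z, ∃ g, AnalyticAt ℂ g z ∧ ∀ᶠ w in 𝓝[≠] z, h w = g w) :
    ∃ H : ℂ → ℂ, Differentiable ℂ H ∧ ∀ z, ContinuousAt h z → H z = h z := by
  have hlim : ∀ {z : ℂ} {g : ℂ → ℂ}, ContinuousAt g z → (∀ᶠ w in 𝓝[≠] z, h w = g w) →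
      limUnder (𝓝[≠] z) h = g z := fun {z g} hg hw =>
    ((hg.tendsto.mono_left nhdsWithin_le_nhds).congr' (hw.mono fun _ h => h.symm)).limUnder_eq
  refine ⟨fun z => limUnder (𝓝[≠] z) h, fun z => ?_, fun z hz =>
    hlim hz (Eventually.of_forall fun _ => rfl)⟩
  obtain ⟨g, hg, hw⟩ := hh z
  refine hg.differentiableAt.congr_of_eventuallyEq ?_
  have h1 : ∀ᶠ w in 𝓝[≠] z, limUnder (𝓝[≠] w) h = g w := by
    filter_upwards [eventually_eventually_nhdsWithin.2 hw, self_mem_nhdsWithin,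
      hg.eventually_analyticAt.filter_mono nhdsWithin_le_nhds] with w hw1 hw2 hw3
    rw [nhdsWithin_eq_nhds.2 (isOpen_compl_singleton.mem_nhds hw2)] at hw1
    exact hlim hw3.continuousAt (hw1.filter_mono nhdsWithin_le_nhds)
  rw [eventually_nhdsWithin_iff] at h1
  filter_upwards [h1] with w hw1
  by_cases hwz : w = z
  · rw [hwz]; exact hlim hg.continuousAt hw
  · exact hw1 hwz

/-- An entire function which grows at most linearly up to a simple blow-up at the real axis
is affine. -/
theorem eq_affine_of_norm_mul_im_le {H : ℂ → ℂ} (hH : Differentiable ℂ H) {K : ℝ}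
    (hK : ∀ z, ‖H z‖ * |z.im| ≤ K * (1 + ‖z‖ ^ 2)) (z : ℂ) : H z = H 0 + deriv H 0 * z := by
  have hK0 : 0 ≤ K := by simpa using hK 0
  have hb : ∀ R : ℝ, 1 ≤ R → ∀ w : ℂ, ‖w‖ ≤ R / 2 → ‖H w‖ ≤ 6 * K * R := by
    intro R hR w hw
    have hR0 : 0 < R := by linarith
    have hwR : w ∈ closure (Metric.ball (0 : ℂ) R) := by
      rw [closure_ball _ hR0.ne']; simp; linarith
    -- On |z| = R one has R² = z·conj z, so z² - R² = 2i z Im z. This factor cancels the blow-up at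
    -- the real axis, and the maximum principle carries the bound inside.
    have h1 := Complex.norm_le_of_forall_mem_frontier_norm_le (f := fun z => (z ^ 2 - R ^ 2) * H z)
      (U := Metric.ball (0 : ℂ) R) Metric.isBounded_ball
      (Differentiable.diffContOnCl (by fun_prop)) (C := 2 * R * (K * (1 + R ^ 2)))
      (fun z hz => by
        rw [frontier_ball _ hR0.ne', mem_sphere_zero_iff_norm] at hz
        have e : z ^ 2 - (R : ℂ) ^ 2 = z * (2 * z.im * Complex.I) := by
          have : (R : ℂ) ^ 2 = z * (starRingEnd ℂ) z := by
            rw [Complex.mul_conj, Complex.normSq_eq_norm_sq, hz]; push_cast; ring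
          have h2 := Complex.sub_conj z
          push_cast at h2
          rw [this, ← h2]; ring
        have := hK z
        rw [hz] at this
        rw [norm_mul, e, norm_mul, norm_mul, norm_mul, hz, Complex.norm_I, Complex.norm_real,
          Real.norm_eq_abs, Complex.norm_ofNat]
        nlinarith) hwR
    have h2 : 3 / 4 * R ^ 2 ≤ ‖w ^ 2 - (R : ℂ) ^ 2‖ := by
      have h3 := norm_sub_norm_le ((R : ℂ) ^ 2) (w ^ 2)
      rw [norm_sub_rev, norm_pow, norm_pow, Complex.norm_real, Real.norm_of_nonneg hR0.le] at h3
      have h4 : ‖w‖ ^ 2 ≤ (R / 2) ^ 2 := by gcongr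
      nlinarith
    rw [norm_mul] at h1
    have h5 : 3 / 4 * R ^ 2 * ‖H w‖ ≤ 2 * R * (K * (1 + R ^ 2)) :=
      (mul_le_mul_of_nonneg_right h2 (norm_nonneg _)).trans h1
    have h6 : 2 * R * (K * (1 + R ^ 2)) ≤ 4 * K * R * R ^ 2 := by
      have : 0 ≤ K * R * (R ^ 2 - 1) := mul_nonneg (mul_nonneg hK0 hR0.le) (by nlinarith)
      nlinarith
    have h7 : (3 / 4 * ‖H w‖) * R ^ 2 ≤ (4 * K * R) * R ^ 2 := by linarith
    have h8 := le_of_mul_le_mul_right h7 (by positivity)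
    nlinarith [mul_nonneg hK0 hR0.le]
  -- Cauchy's estimate on radius R/2 with |H| = O(R) there bounds the n-th derivative by a multiple
  -- of R^(1-n), hence of 1/R.
  have hd : ∀ n : ℕ, 2 ≤ n → iteratedDeriv n H 0 = 0 := by
    intro n hn
    have h1 : ∀ R : ℝ, 1 ≤ R → ‖iteratedDeriv n H 0‖ ≤ n.factorial * (6 * K) * 2 ^ n / R := by
      intro R hR
      have hR0 : 0 < R := by linarith
      refine (Complex.norm_iteratedDeriv_le_of_forall_mem_sphere_norm_le n
        (half_pos hR0) hH.diffContOnCl (C := 6 * K * R) fun w hw => hb R hR w ?_).trans ?_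
      · exact (mem_sphere_zero_iff_norm.1 hw).le
      · rw [div_pow, div_div_eq_mul_div, div_le_div_iff₀ (by positivity) hR0]
        have : R ^ 2 ≤ R ^ n := pow_le_pow_right₀ hR hn
        calc _ = n.factorial * (6 * K) * 2 ^ n * R ^ 2 := by ring
          _ ≤ _ := by gcongr
    have h2 : Tendsto (fun R : ℝ => n.factorial * (6 * K) * 2 ^ n / R) atTop (𝓝 0) :=
      tendsto_const_nhds.div_atTop tendsto_id
    have h3 := ge_of_tendsto h2 ((eventually_ge_atTop 1).mono h1)
    exact norm_le_zero_iff.1 h3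
  have ht := Complex.hasSum_taylorSeries_of_entire hH 0 z
  have h2 : HasSum (fun n : ℕ => (n.factorial : ℂ)⁻¹ • (z - 0) ^ n • iteratedDeriv n H 0)
      (∑ n ∈ Finset.range 2, (n.factorial : ℂ)⁻¹ • (z - 0) ^ n • iteratedDeriv n H 0) :=
    hasSum_sum_of_ne_finset_zero fun n hn => by
      rw [hd n (by simp at hn; omega)]; simp
  rw [ht.unique h2]
  simp [Finset.sum_range_succ, iteratedDeriv_one, mul_comm]

/-! ### Odd partial fraction series. -/

section OddSum

variable {κ : Type*} {q : κ → ℝ} {a : κ → ℂ}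

/-- The odd meromorphic function with residue `a k` at the points `± q k`. -/
noncomputable def oddPoleSum (q : κ → ℝ) (a : κ → ℂ) (z : ℂ) : ℂ :=
  ∑' k, a k * (2 * z / (z ^ 2 - q k ^ 2))

theorem norm_two_mul_div_le_of_le {q : ℝ} (hq : 0 < q) {z : ℂ} (hz : 2 * ‖z‖ ≤ q) :
    ‖2 * z / (z ^ 2 - q ^ 2)‖ ≤ 4 * ‖z‖ * q ^ (-2 : ℝ) := by
  have h3 := norm_sub_norm_le ((q : ℂ) ^ 2) (z ^ 2)
  rw [norm_sub_rev, norm_pow, norm_pow, Complex.norm_real, Real.norm_of_nonneg hq.le] at h3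
  have h5 : q ^ 2 / 2 ≤ ‖z ^ 2 - (q : ℂ) ^ 2‖ := by nlinarith [norm_nonneg z]
  rw [Real.rpow_neg hq.le, Real.rpow_two, norm_div, norm_mul, Complex.norm_ofNat,
    div_le_iff₀ (lt_of_lt_of_le (by positivity) h5)]
  calc 2 * ‖z‖ = 4 * ‖z‖ * (q ^ 2)⁻¹ * (q ^ 2 / 2) := by field_simp; ring
    _ ≤ _ := by gcongr

/-- In z² - q² = (z - q)(z + q) both factors are at least |Im z|, and the one whose real parts add
up, according to the sign of q Re z, is at least |z|. -/
theorem norm_mul_abs_im_le (q : ℝ) (z : ℂ) : ‖z‖ * |z.im| ≤ ‖z ^ 2 - (q : ℂ) ^ 2‖ := by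
  have e : z ^ 2 - (q : ℂ) ^ 2 = (z - q) * (z + q) := by ring
  have h1 : |z.im| ≤ ‖z - q‖ := by simpa using Complex.abs_im_le_norm (z - q)
  have h2 : |z.im| ≤ ‖z + q‖ := by simpa using Complex.abs_im_le_norm (z + q)
  rw [e, norm_mul]
  rcases le_total 0 (z.re * q) with h | h
  · have h3 : ‖z‖ ≤ ‖z + q‖ := by
      rw [Complex.norm_def, Complex.norm_def]
      refine Real.sqrt_le_sqrt ?_
      simp [Complex.normSq_apply]; nlinarith
    rw [mul_comm]; gcongr
  · have h3 : ‖z‖ ≤ ‖z - q‖ := by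
      rw [Complex.norm_def, Complex.norm_def]
      refine Real.sqrt_le_sqrt ?_
      simp [Complex.normSq_apply]; nlinarith
    gcongr

/-- One bound for both regimes: a term with q ≥ 2|z| is O(|z|/q²), and for q ≤ 2|z| the left side is
at most 2, hence at most 8|z|²/q². Summed over q it becomes the growth hypothesis of the Liouville
theorem. -/
theorem norm_two_mul_div_mul_abs_im_le {q : ℝ} (hq : 0 < q) (z : ℂ) :
    ‖2 * z / (z ^ 2 - q ^ 2)‖ * |z.im| ≤ 8 * ‖z‖ ^ 2 * q ^ (-2 : ℝ) := by
  rcases le_total (2 * ‖z‖) q with h | h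
  · have h1 := norm_two_mul_div_le_of_le hq h
    have h2 := Complex.abs_im_le_norm z
    have h3 : 0 < q ^ (-2 : ℝ) := Real.rpow_pos_of_pos hq _
    calc _ ≤ 4 * ‖z‖ * q ^ (-2 : ℝ) * ‖z‖ := by gcongr
      _ ≤ _ := by nlinarith [mul_nonneg (mul_nonneg (norm_nonneg z) (norm_nonneg z)) h3.le]
  · have h1 : ‖2 * z / (z ^ 2 - q ^ 2)‖ * |z.im| ≤ 2 := by
      rw [norm_div, norm_mul, Complex.norm_ofNat, div_mul_eq_mul_div, mul_assoc]
      refine div_le_of_le_mul₀ (norm_nonneg _) (by norm_num) ?_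
      have := norm_mul_abs_im_le q z
      gcongr
    refine h1.trans ?_
    rw [Real.rpow_neg hq.le, Real.rpow_two, ← div_eq_mul_inv, le_div_iff₀ (by positivity)]
    nlinarith

theorem oddPoleSum_neg (z : ℂ) : oddPoleSum q a (-z) = -oddPoleSum q a z := by
  rw [oddPoleSum, oddPoleSum, ← tsum_neg]
  refine tsum_congr fun k => ?_
  rw [neg_sq, mul_neg, neg_div, mul_neg]

theorem finite_lt_of_summable (hs : Summable fun k => q k ^ (-2 : ℝ)) (hq : ∀ k, 0 < q k)
    (R : ℝ) : {k | q k < R}.Finite := by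
  rcases le_or_gt R 0 with h | h
  · convert Set.finite_empty
    ext k; simpa using h.trans (hq k).le
  · have h1 := hs.tendsto_cofinite_zero.eventually_lt_const (Real.rpow_pos_of_pos h (-2))
    refine Set.Finite.subset h1 fun k hk hk' => ?_
    exact (Real.rpow_lt_rpow_of_neg (hq k) hk (by norm_num : (-2 : ℝ) < 0)).not_gt hk'

theorem summable_oddPoleSum (hs : Summable fun k => q k ^ (-2 : ℝ)) (hq : ∀ k, 0 < q k)
    (ha : ∀ k, ‖a k‖ ≤ 1) (z : ℂ) : Summable fun k => a k * (2 * z / (z ^ 2 - q k ^ 2)) := by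
  refine Summable.of_norm_bounded_eventually (hs.mul_left (4 * ‖z‖)) ?_
  filter_upwards [(finite_lt_of_summable hs hq (2 * ‖z‖)).compl_mem_cofinite] with k hk
  rw [norm_mul]
  have h1 := norm_two_mul_div_le_of_le (hq k) (not_lt.1 hk)
  have h2 := ha k
  calc _ ≤ 1 * (4 * ‖z‖ * q k ^ (-2 : ℝ)) := by gcongr
    _ = _ := one_mul _

theorem norm_oddPoleSum_mul_abs_im_le (hs : Summable fun k => q k ^ (-2 : ℝ)) (hq : ∀ k, 0 < q k)
    (ha : ∀ k, ‖a k‖ ≤ 1) (z : ℂ) :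
    ‖oddPoleSum q a z‖ * |z.im| ≤ 8 * ‖z‖ ^ 2 * ∑' k, q k ^ (-2 : ℝ) := by
  have h1 : ‖oddPoleSum q a z * z.im‖ ≤ 8 * ‖z‖ ^ 2 * ∑' k, q k ^ (-2 : ℝ) := by
    rw [oddPoleSum, ← tsum_mul_right, ← tsum_mul_left]
    refine tsum_of_norm_bounded (hs.mul_left (8 * ‖z‖ ^ 2)).hasSum fun k => ?_
    have h2 := norm_two_mul_div_mul_abs_im_le (hq k) z
    rw [norm_mul, norm_mul, Complex.norm_real, Real.norm_eq_abs, mul_assoc]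
    calc _ ≤ 1 * (8 * ‖z‖ ^ 2 * q k ^ (-2 : ℝ)) := by
          have := ha k
          gcongr
      _ = _ := one_mul _
  simpa using h1

theorem analyticAt_two_mul_div {q : ℝ} {z : ℂ} (h : z ^ 2 ≠ (q : ℂ) ^ 2) :
    AnalyticAt ℂ (fun z : ℂ => 2 * z / (z ^ 2 - q ^ 2)) z := by
  have : z ^ 2 - (q : ℂ) ^ 2 ≠ 0 := sub_ne_zero.2 h
  fun_prop (disch := assumption)

/-- Near z all but finitely many terms form a uniformly convergent series. The alternative a k = 0
allows a term to be switched off at its own pole, which is how `exists_oddPoleSum_eq_add` isolates a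
singular part. -/
theorem analyticAt_oddPoleSum (hs : Summable fun k => q k ^ (-2 : ℝ)) (hq : ∀ k, 0 < q k)
    (ha : ∀ k, ‖a k‖ ≤ 1) {z : ℂ} (hz : ∀ k, a k = 0 ∨ z ^ 2 ≠ (q k : ℂ) ^ 2) :
    AnalyticAt ℂ (oddPoleSum q a) z := by
  set R := ‖z‖ + 1 with hR
  have hfin := finite_lt_of_summable hs hq (2 * R)
  set s := hfin.toFinset with hsdef
  have he : oddPoleSum q a = fun w => ∑ k ∈ s, a k * (2 * w / (w ^ 2 - q k ^ 2)) +
      ∑' k : ((s : Set κ)ᶜ : Set κ), a k * (2 * w / (w ^ 2 - q k ^ 2)) := by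
    ext w
    exact ((summable_oddPoleSum hs hq ha w).sum_add_tsum_compl).symm
  rw [he]
  refine AnalyticAt.add (Finset.analyticAt_fun_sum _ fun k _ => ?_) ?_
  · rcases hz k with h | h
    · simp only [h, zero_mul]; exact analyticAt_const
    · exact analyticAt_const.mul (analyticAt_two_mul_div h)
  · have hball : Metric.ball (0 : ℂ) R ∈ 𝓝 z := Metric.isOpen_ball.mem_nhds (by simp [hR])
    refine DifferentiableOn.analyticAt ?_ hball
    have hk : ∀ k : ((s : Set κ)ᶜ : Set κ), 2 * R ≤ q k := fun k => by
      have := k.2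
      simp only [hsdef, Set.Finite.coe_toFinset, Set.mem_compl_iff, Set.mem_ofPred_eq, not_lt] at this
      exact this
    refine Complex.differentiableOn_tsum_of_summable_norm
      (u := fun k : ((s : Set κ)ᶜ : Set κ) => 4 * R * q k ^ (-2 : ℝ))
      ((hs.subtype _).mul_left _) (fun k w hw => ?_) Metric.isOpen_ball fun k w hw => ?_
    · have hw' : ‖w‖ < R := by simpa using hw
      have : w ^ 2 ≠ (q k : ℂ) ^ 2 := fun h => by
        have h1 := congrArg norm h
        rw [norm_pow, norm_pow, Complex.norm_real, Real.norm_of_nonneg (hq k).le] at h1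
        have := hk k
        nlinarith [norm_nonneg w]
      exact (analyticAt_const.mul (analyticAt_two_mul_div this)).differentiableAt.differentiableWithinAt
    · have hw' : ‖w‖ < R := by simpa using hw
      have h1 := norm_two_mul_div_le_of_le (hq k) (z := w) (by linarith [hk k])
      have h2 := ha k
      have h3 : 0 < q k ^ (-2 : ℝ) := Real.rpow_pos_of_pos (hq k) _
      rw [norm_mul]
      calc _ ≤ 1 * (4 * ‖w‖ * q k ^ (-2 : ℝ)) := by gcongr
        _ ≤ _ := by rw [one_mul]; gcongr

theorem exists_oddPoleSum_eq_add (hs : Summable fun k => q k ^ (-2 : ℝ)) (hq : ∀ k, 0 < q k)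
    (hinj : Function.Injective q) (ha : ∀ k, ‖a k‖ ≤ 1) {x : ℝ} {k : κ} (hk : |x| = q k) :
    ∃ g : ℂ → ℂ, AnalyticAt ℂ g x ∧
      ∀ᶠ z in 𝓝[≠] (x : ℂ), oddPoleSum q a z = a k / (z - x) + g z := by
  classical
  have hx2 : x ^ 2 = q k ^ 2 := by rw [← hk, sq_abs]
  have hx0 : x ≠ 0 := fun h => (hq k).ne' (by rw [← hk, h, abs_zero])
  have hxx : (x : ℂ) + x ≠ 0 := by
    rw [← two_mul]; exact mul_ne_zero two_ne_zero (by exact_mod_cast hx0)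
  have han : AnalyticAt ℂ (oddPoleSum q (fun i => if i = k then 0 else a i)) x := by
    refine analyticAt_oddPoleSum hs hq (fun i => ?_) fun i => ?_
    · split_ifs <;> simp [ha]
    · by_cases h : i = k
      · simp [h]
      · right
        intro h2
        have h3 : q k ^ 2 = q i ^ 2 := by rw [← hx2]; exact_mod_cast h2
        exact h (hinj ((sq_eq_sq₀ (hq i).le (hq k).le).1 h3.symm))
  refine ⟨fun z => a k / (z + x) + oddPoleSum q (fun i => if i = k then 0 else a i) z,
    (analyticAt_const.div (analyticAt_id.add analyticAt_const) hxx).add han, ?_⟩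
  have hne : ∀ᶠ z : ℂ in 𝓝[≠] (x : ℂ), z + x ≠ 0 :=
    ((by fun_prop : ContinuousAt (fun z : ℂ => z + x) (x : ℂ)).eventually_ne hxx).filter_mono
      nhdsWithin_le_nhds
  filter_upwards [hne, self_mem_nhdsWithin] with z hz1 hz2
  have hz3 : z - x ≠ 0 := sub_ne_zero.2 hz2
  rw [oddPoleSum, (summable_oddPoleSum hs hq ha z).tsum_eq_add_tsum_ite k, oddPoleSum]
  have e : (q k : ℂ) ^ 2 = (x : ℂ) ^ 2 := by exact_mod_cast hx2.symm
  have e2 : z ^ 2 - (x : ℂ) ^ 2 = (z - x) * (z + x) := by ring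
  rw [e, e2, ← add_assoc]
  congr 1
  · field_simp; ring
  · refine tsum_congr fun i => ?_
    split_ifs <;> simp

/-- At z = iy a term divided by z is -2a/(y² + q²), dominated by 2/q² for all y, so dominated
convergence applies. -/
theorem tendsto_oddPoleSum_div (hs : Summable fun k => q k ^ (-2 : ℝ)) (hq : ∀ k, 0 < q k)
    (ha : ∀ k, ‖a k‖ ≤ 1) : Tendsto (fun y : ℝ => oddPoleSum q a (Complex.I * y) / (Complex.I * y))
      atTop (𝓝 0) := by
  have h : Tendsto (fun y : ℝ => ∑' k, a k * ((-2 / (y ^ 2 + q k ^ 2) : ℝ) : ℂ)) atTop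
      (𝓝 (∑' _ : κ, (0 : ℂ))) := by
    refine tendsto_tsum_of_dominated_convergence (bound := fun k => 2 * q k ^ (-2 : ℝ))
      (hs.mul_left 2) (fun k => ?_) (Eventually.of_forall fun y k => ?_)
    · have h1 : Tendsto (fun y : ℝ => -2 / (y ^ 2 + q k ^ 2)) atTop (𝓝 0) :=
        tendsto_const_nhds.div_atTop
          (tendsto_atTop_add_const_right _ _ (tendsto_pow_atTop two_ne_zero))
      simpa using ((Complex.continuous_ofReal.tendsto 0).comp h1).const_mul (a k)
    · have h1 := hq k
      rw [norm_mul, Complex.norm_real, norm_div, norm_neg, Real.norm_ofNat,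
        Real.norm_of_nonneg (by positivity : 0 ≤ y ^ 2 + q k ^ 2),
        Real.rpow_neg h1.le, Real.rpow_two, ← div_eq_mul_inv]
      calc _ ≤ 1 * (2 / (y ^ 2 + q k ^ 2)) := by gcongr; exact ha k
        _ ≤ _ := by rw [one_mul]; gcongr; nlinarith
  rw [tsum_zero] at h
  refine h.congr' ?_
  filter_upwards [eventually_gt_atTop 0] with y hy
  rw [oddPoleSum, ← tsum_div_const]
  refine tsum_congr fun k => ?_
  have hy' : (y : ℂ) ≠ 0 := by exact_mod_cast hy.ne'
  have h1 : (y : ℂ) ^ 2 + (q k : ℂ) ^ 2 ≠ 0 := by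
    have := hq k
    exact_mod_cast (by positivity : y ^ 2 + q k ^ 2 ≠ 0)
  have e : (Complex.I * y) ^ 2 - (q k : ℂ) ^ 2 = -((y : ℂ) ^ 2 + (q k : ℂ) ^ 2) := by
    rw [mul_pow, Complex.I_sq]; ring
  have hI := Complex.I_ne_zero
  rw [e]
  push_cast
  field_simp

end OddSum
-- Partial fractions of the logarithmic derivative.
namespace CotSum
variable {ι : Type} (F : CotSum ι) [Fintype ι]

/-- The sum over the positive zeros and poles `q` of `± 2 z / (z ^ 2 - q ^ 2)`. -/
noncomputable def critSum (z : ℂ) : ℂ :=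
  oddPoleSum (fun q : F.crit => (q : ℝ)) (fun q => (F.ord q : ℂ)) z

theorem norm_ord_le (x : ℝ) : ‖(F.ord x : ℂ)‖ ≤ 1 := by
  rw [Complex.norm_intCast]; exact_mod_cast F.abs_ord_le x

theorem exists_critSum_eq_div_add {x : ℝ} (hx : x ≠ 0) : ∃ g : ℂ → ℂ, AnalyticAt ℂ g x ∧
    ∀ᶠ z in 𝓝[≠] (x : ℂ), F.critSum z = F.ord x / (z - x) + g z := by
  have hs := F.summable_rpow_crit (σ := 2) (by norm_num)
  have hord : F.ord |x| = F.ord x := by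
    rcases abs_choice x with h | h <;> rw [h]
    exact F.ord_neg x
  by_cases h : F.ord x = 0
  · refine ⟨F.critSum, analyticAt_oddPoleSum hs (fun q => q.2.1) (fun q => F.norm_ord_le q)
      fun q => Or.inr fun h2 => q.2.2 ?_, by simp [h]⟩
    have h3 : x ^ 2 = (q : ℝ) ^ 2 := by exact_mod_cast h2
    have h4 : |x| = q := by
      rw [← abs_of_pos q.2.1]; exact (sq_eq_sq_iff_abs_eq_abs _ _).1 h3
    rw [← h4, hord, h]
  · have hk : |x| ∈ F.crit := ⟨abs_pos.2 hx, by rwa [hord]⟩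
    have := exists_oddPoleSum_eq_add (a := fun q : F.crit => (F.ord q : ℂ)) hs
      (fun q : F.crit => q.2.1) Subtype.val_injective (fun q => F.norm_ord_le q)
      (k := ⟨|x|, hk⟩) (x := x) rfl
    simp only [hord] at this
    exact this

theorem analyticAt_critSum {z : ℂ} (hz : ∀ q : ℝ, q ≠ 0 → z ≠ q) : AnalyticAt ℂ F.critSum z := by
  refine analyticAt_oddPoleSum (F.summable_rpow_crit (σ := 2) (by norm_num)) (fun q => q.2.1)
    (fun q => F.norm_ord_le q) fun q => Or.inr fun h => ?_
  rcases sq_eq_sq_iff_eq_or_eq_neg.1 h with h | h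
  · exact hz q q.2.1.ne' h
  · exact hz (-q) (neg_ne_zero.2 q.2.1.ne') (by rw [h]; simp)

/-- The partial fraction expansion of the logarithmic derivative of a cotangent sum. -/
theorem logD_eq_critSum {z : ℂ} (hz : z.im ≠ 0) : F.logD z = -(1 / z) + F.critSum z := by
  have hs := F.summable_rpow_crit (σ := 2) (by norm_num)
  have hre : ∀ {w : ℂ}, w.im ≠ 0 → ∀ q : ℝ, w ≠ q := fun hw q h => hw (by rw [h]; simp)
  have han : ∀ w : ℂ, w.im ≠ 0 → AnalyticAt ℂ (fun z => F.logD z + 1 / z - F.critSum z) w := by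
    intro w hw
    refine ((F.analyticAt_logD (F.not_isPole_of_im_ne_zero hw) (F.eval_ne_zero hw)).add
      (analyticAt_const.div analyticAt_id ?_)).sub (F.analyticAt_critSum fun q _ => hre hw q)
    exact fun h => hw (by rw [show w = 0 from h]; simp)
  -- At real x ≠ 0 the residues ord x of the two functions cancel. At 0 the summand 1/z cancels the
  -- residue -1 of the logarithmic derivative, and the series is regular.
  obtain ⟨H, hH, hHeq⟩ := exists_entire_extension (h := fun z => F.logD z + 1 / z - F.critSum z) (by
    intro w
    by_cases hw : w.im = 0
    · obtain ⟨x, rfl⟩ : ∃ x : ℝ, w = x := ⟨w.re, by rw [← Complex.re_add_im w, hw]; simp⟩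
      obtain ⟨g, hg, hge⟩ := F.exists_logD_eq_div_add x
      by_cases hx : x = 0
      · subst hx
        refine ⟨fun z => g z - F.critSum z, hg.sub (F.analyticAt_critSum fun q hq h => hq ?_), ?_⟩
        · exact_mod_cast h.symm
        · filter_upwards [hge] with z hz
          rw [hz, F.ord_zero]; simp; ring
      · obtain ⟨g', hg', hge'⟩ := F.exists_critSum_eq_div_add hx
        refine ⟨fun z => g z + 1 / z - g' z, (hg.add (analyticAt_const.div analyticAt_id
          (by simpa using hx))).sub hg', ?_⟩
        filter_upwards [hge, hge'] with z hz hz'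
        rw [hz, hz']; ring
    · exact ⟨_, han w hw, Eventually.of_forall fun _ => rfl⟩)
  have hHeq' : ∀ w : ℂ, w.im ≠ 0 → H w = F.logD w + 1 / w - F.critSum w := fun w hw =>
    hHeq w (han w hw).continuousAt
  have hcs : ∀ w, F.critSum (-w) = -F.critSum w := fun w => oddPoleSum_neg w
  set T := ∑' q : F.crit, (q : ℝ) ^ (-2 : ℝ) with hT
  have hT0 : 0 ≤ T := tsum_nonneg fun q => Real.rpow_nonneg q.2.1.le _
  have hbd : ∀ w : ℂ, ‖H w‖ * |w.im| ≤ (2 + 8 * T) * (1 + ‖w‖ ^ 2) := by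
    intro w
    by_cases hw : w.im = 0
    · rw [hw]; simp; positivity
    · have h0 : 0 < |w.im| := abs_pos.2 hw
      have h1 := F.norm_logD_le w hw
      have h2 := norm_oddPoleSum_mul_abs_im_le hs (fun q => q.2.1) (fun q => F.norm_ord_le q) w
      rw [← hT] at h2
      change ‖F.critSum w‖ * _ ≤ _ at h2
      have h3 : ‖1 / w‖ * |w.im| ≤ 1 := by
        rw [norm_div, norm_one, div_mul_eq_mul_div, one_mul]
        exact div_le_one_of_le₀ (Complex.abs_im_le_norm w) (norm_nonneg _)
      have h4 : ‖F.logD w‖ * |w.im| ≤ 1 := by rwa [le_div_iff₀ h0] at h1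
      rw [hHeq' w hw]
      have h5 : ‖F.logD w + 1 / w - F.critSum w‖ ≤ ‖F.logD w‖ + ‖1 / w‖ + ‖F.critSum w‖ :=
        (norm_sub_le _ _).trans (by gcongr; exact norm_add_le _ _)
      have h6 := mul_le_mul_of_nonneg_right h5 h0.le
      nlinarith [sq_nonneg ‖w‖]
  have haff := eq_affine_of_norm_mul_im_le hH hbd
  have hI : ∀ y : ℝ, 0 < y → (Complex.I * y).im ≠ 0 := fun y hy => by simpa using hy.ne'
  -- All three functions are odd, so adding the values at i and -i leaves twice the constant term.
  have h00 : H 0 = 0 := by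
    have h1 := hHeq' (Complex.I * (1 : ℝ)) (hI 1 one_pos)
    have h2 := hHeq' (-(Complex.I * (1 : ℝ))) (by simp)
    rw [F.logD_neg, hcs, haff] at h2
    rw [haff] at h1
    have h3 : 2 * H 0 = 0 := by linear_combination h1 + h2
    simpa using h3
  -- The slope is the limit of H(iy)/(iy). The logarithmic derivative and 1/z are O(1/y) on the
  -- imaginary axis, and the series is o(y).
  have hd0 : deriv H 0 = 0 := by
    have h1 : Tendsto (fun y : ℝ => H (Complex.I * y) / (Complex.I * y)) atTop (𝓝 0) := by
      have h2 : Tendsto (fun y : ℝ => (F.logD (Complex.I * y) + 1 / (Complex.I * y)) /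
          (Complex.I * y)) atTop (𝓝 0) := by
        refine squeeze_zero_norm' (a := fun y : ℝ => 2 / y ^ 2) ?_
          (tendsto_const_nhds.div_atTop (tendsto_pow_atTop two_ne_zero))
        filter_upwards [eventually_gt_atTop 0] with y hy
        have h3 := F.norm_logD_le _ (hI y hy)
        simp only [Complex.mul_im, Complex.I_re, Complex.I_im, Complex.ofReal_re,
          Complex.ofReal_im, mul_zero, zero_add, one_mul, abs_of_pos hy] at h3
        have h4 : ‖1 / (Complex.I * y)‖ = 1 / y := by simp [abs_of_pos hy]
        have h5 : ‖Complex.I * y‖ = y := by simp [abs_of_pos hy]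
        rw [norm_div, h5, div_le_div_iff₀ hy (by positivity)]
        have h6 : ‖F.logD (Complex.I * y) + 1 / (Complex.I * y)‖ ≤ 1 / y + 1 / y :=
          (norm_add_le _ _).trans (by rw [h4]; gcongr)
        calc _ ≤ (1 / y + 1 / y) * y ^ 2 := by gcongr
          _ = 2 * y := by field_simp; ring
      have h7 := h2.sub (tendsto_oddPoleSum_div hs (fun q => q.2.1) (fun q => F.norm_ord_le q))
      rw [sub_zero] at h7
      refine h7.congr' ?_
      filter_upwards [eventually_gt_atTop 0] with y hy
      rw [hHeq' _ (hI y hy), sub_div (_ + _)]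
      rfl
    have h2 : Tendsto (fun y : ℝ => H (Complex.I * y) / (Complex.I * y)) atTop
        (𝓝 (deriv H 0)) := by
      refine tendsto_const_nhds.congr' ?_
      filter_upwards [eventually_gt_atTop 0] with y hy
      have hy' : (y : ℂ) ≠ 0 := by exact_mod_cast hy.ne'
      rw [haff, h00, zero_add, mul_div_assoc,
        div_self (mul_ne_zero Complex.I_ne_zero hy'), mul_one]
    exact tendsto_nhds_unique h2 h1
  have := hHeq' z hz
  rw [haff, h00, hd0] at this
  linear_combination -this

end CotSum
-- The Mellin transform of a simple pole in the slit plane.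
-- The bound is uniform for v near w, so it serves both convergence and differentiation under the
-- integral sign.
theorem exists_norm_ofReal_add_ge {w : ℂ} (hw : w ∈ Complex.slitPlane) :
    ∃ c > 0, ∀ v ∈ Metric.ball w c, ∀ t : ℝ, 0 ≤ t → c * (1 + t) ≤ ‖(t : ℂ) + v‖ := by
  obtain ⟨ε, hε, hε'⟩ : ∃ ε > 0, ∀ t : ℝ, 0 ≤ t → ε ≤ ‖(t : ℂ) + w‖ := by
    rcases Complex.mem_slitPlane_iff.1 hw with h | h
    · refine ⟨w.re, h, fun t ht => ?_⟩
      have := (le_abs_self _).trans (Complex.abs_re_le_norm ((t : ℂ) + w))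
      simp at this
      linarith
    · refine ⟨|w.im|, abs_pos.2 h, fun t ht => ?_⟩
      simpa using Complex.abs_im_le_norm ((t : ℂ) + w)
  have hM := norm_nonneg w
  set M := ‖w‖ with hMdef
  have hpos : 0 < 1 + M + ε := by positivity
  -- The bounds ε and t - M for |t + w|, weighted by 1 + M and ε, combine to |t + w| ≥ 2c(1 + t);
  -- half of this is given up in passing from w to v.
  refine ⟨ε / (1 + M + ε) / 2, by positivity, fun v hv t ht => ?_⟩
  have h1 : ε / (1 + M + ε) * (1 + t) ≤ ‖(t : ℂ) + w‖ := by
    rw [div_mul_eq_mul_div, div_le_iff₀ hpos]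
    have h2 := hε' t ht
    have h3 : t - M ≤ ‖(t : ℂ) + w‖ := by
      have := norm_sub_le ((t : ℂ) + w) w
      rw [add_sub_cancel_right, Complex.norm_real, Real.norm_of_nonneg ht] at this
      linarith
    nlinarith
  have h4 : ‖(t : ℂ) + w‖ ≤ ‖(t : ℂ) + v‖ + ‖v - w‖ := by
    have := norm_sub_le ((t : ℂ) + v) (v - w)
    rwa [show (t : ℂ) + v - (v - w) = t + w by ring] at this
  rw [mem_ball_iff_norm] at hv
  have h5 : 0 < ε / (1 + M + ε) := by positivity
  nlinarith

theorem ofReal_add_ne_zero {w : ℂ} (hw : w ∈ Complex.slitPlane) {t : ℝ} (ht : 0 ≤ t) :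
    (t : ℂ) + w ≠ 0 := by
  obtain ⟨c, hc, h⟩ := exists_norm_ofReal_add_ge hw
  have := h w (Metric.mem_ball_self hc) t ht
  intro h0
  rw [h0, norm_zero] at this
  nlinarith

theorem continuousOn_inv_add {w : ℂ} (hw : w ∈ Complex.slitPlane) :
    ContinuousOn (fun t : ℝ => ((t : ℂ) + w)⁻¹) (Set.Ioi 0) :=
  ContinuousOn.inv₀ (by fun_prop) fun _ ht => ofReal_add_ne_zero hw (Set.mem_Ioi.1 ht).le

theorem mellinConvergent_inv_add {w a : ℂ} (hw : w ∈ Complex.slitPlane) (ha : 0 < a.re)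
    (ha' : a.re < 1) : MellinConvergent (fun t : ℝ => ((t : ℂ) + w)⁻¹) a := by
  obtain ⟨c, hc, h⟩ := exists_norm_ofReal_add_ge hw
  have hb : ∀ t : ℝ, 0 ≤ t → ‖((t : ℂ) + w)⁻¹‖ ≤ c⁻¹ * (1 + t)⁻¹ := fun t ht => by
    rw [norm_inv, ← mul_inv]
    exact inv_anti₀ (by positivity) (h w (Metric.mem_ball_self hc) t ht)
  refine mellinConvergent_of_isBigO_rpow (a := 1) (b := 0)
    ((continuousOn_inv_add hw).locallyIntegrableOn measurableSet_Ioi) ?_ ha' ?_ ha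
  · refine Asymptotics.IsBigO.of_bound c⁻¹ ?_
    filter_upwards [eventually_gt_atTop 0] with t ht
    refine (hb t ht.le).trans ?_
    rw [Real.rpow_neg_one, Real.norm_of_nonneg (by positivity)]
    gcongr
    linarith
  · refine Asymptotics.IsBigO.of_bound c⁻¹ ?_
    filter_upwards [self_mem_nhdsWithin] with t ht
    have ht : 0 < t := ht
    refine (hb t ht.le).trans ?_
    rw [neg_zero, Real.rpow_zero, norm_one]
    gcongr
    exact inv_le_one_of_one_le₀ (by linarith)

/-- Holomorphy in w is what allows the formula for w > 0 to spread over the slit plane. -/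
theorem differentiableAt_mellin_inv_add {w a : ℂ} (hw : w ∈ Complex.slitPlane) (ha : 0 < a.re)
    (ha' : a.re < 1) :
    DifferentiableAt ℂ (fun w => mellin (fun t : ℝ => ((t : ℂ) + w)⁻¹) a) w := by
  obtain ⟨c, hc, h⟩ := exists_norm_ofReal_add_ge hw
  have hmem : Metric.ball w c ∩ Complex.slitPlane ∈ 𝓝 w :=
    inter_mem (Metric.ball_mem_nhds w hc) (Complex.isOpen_slitPlane.mem_nhds hw)
  have hcont : ∀ v ∈ Complex.slitPlane, ContinuousOn
      (fun t : ℝ => (t : ℂ) ^ (a - 1) • ((t : ℂ) + v)⁻¹) (Set.Ioi 0) := fun v hv =>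
    ContinuousOn.smul (fun t ht => ((Complex.continuousAt_ofReal_cpow_const t _
      (Or.inr (ne_of_gt ht))).continuousWithinAt)) (continuousOn_inv_add hv)
  have hcont' : ContinuousOn
      (fun t : ℝ => (t : ℂ) ^ (a - 1) * -(((t : ℂ) + w)⁻¹ ^ 2)) (Set.Ioi 0) :=
    ContinuousOn.mul (fun t ht => ((Complex.continuousAt_ofReal_cpow_const t _
      (Or.inr (ne_of_gt ht))).continuousWithinAt)) ((continuousOn_inv_add hw).pow 2).neg
  have hbd : Integrable (fun t : ℝ => ‖(t : ℂ) ^ (a - 1) • ((t : ℂ) + (1 : ℂ))⁻¹‖ * c⁻¹ ^ 2)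
      (volume.restrict (Set.Ioi 0)) :=
    (mellinConvergent_inv_add (w := 1) Complex.one_mem_slitPlane ha ha').norm.mul_const _
  refine (hasDerivAt_integral_of_dominated_loc_of_deriv_le
    (F := fun v (t : ℝ) => (t : ℂ) ^ (a - 1) • ((t : ℂ) + v)⁻¹)
    (F' := fun v (t : ℝ) => (t : ℂ) ^ (a - 1) * -(((t : ℂ) + v)⁻¹ ^ 2)) hmem ?_
    (mellinConvergent_inv_add hw ha ha') (hcont'.aestronglyMeasurable measurableSet_Ioi) ?_ hbd
    ?_).2.differentiableAt
  · filter_upwards [Complex.isOpen_slitPlane.mem_nhds hw] with v hv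
    exact (hcont v hv).aestronglyMeasurable measurableSet_Ioi
  · refine (ae_restrict_iff' measurableSet_Ioi).2 (ae_of_all _ fun t ht v hv => ?_)
    have ht : 0 < t := ht
    have h1 := h v hv.1 t ht.le
    have h2 : ‖(t : ℂ) + 1‖ = 1 + t := by
      rw [add_comm, ← Complex.ofReal_one, ← Complex.ofReal_add, Complex.norm_real,
        Real.norm_of_nonneg (by positivity)]
    have h3 : ‖((t : ℂ) + v)⁻¹‖ ≤ c⁻¹ * (1 + t)⁻¹ := by
      rw [norm_inv, ← mul_inv]
      exact inv_anti₀ (by positivity) h1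
    rw [norm_mul, norm_neg, norm_pow, norm_smul, norm_inv ((t : ℂ) + 1), h2, mul_assoc]
    gcongr
    calc ‖((t : ℂ) + v)⁻¹‖ ^ 2 ≤ (c⁻¹ * (1 + t)⁻¹) ^ 2 := by gcongr
      _ = (1 + t)⁻¹ * (1 + t)⁻¹ * c⁻¹ ^ 2 := by ring
      _ ≤ 1 * (1 + t)⁻¹ * c⁻¹ ^ 2 := by
        gcongr
        exact inv_le_one_of_one_le₀ (by linarith)
      _ = _ := by ring
  · refine (ae_restrict_iff' measurableSet_Ioi).2 (ae_of_all _ fun t ht v hv => ?_)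
    have hne := ofReal_add_ne_zero hv.2 (Set.mem_Ioi.1 ht).le
    have h1 : HasDerivAt (fun v : ℂ => ((t : ℂ) + v)⁻¹) (-(((t : ℂ) + v)⁻¹ ^ 2)) v := by
      have := ((hasDerivAt_id v).const_add (t : ℂ)).inv hne
      convert! this using 1
      simp [neg_div]
    simpa [smul_eq_mul] using h1.const_mul ((t : ℂ) ^ (a - 1))

/-- The substitution x = t/(1 + t) turns the Beta integral B(a, 1 - a) = Γ(a)Γ(1 - a) into this one,
and the reflection formula evaluates it. -/
theorem mellin_inv_add_one {a : ℂ} (ha : 0 < a.re) (ha' : a.re < 1) :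
    mellin (fun t : ℝ => ((t : ℂ) + 1)⁻¹) a = Real.pi / Complex.sin (Real.pi * a) := by
  rw [← Complex.Gamma_mul_Gamma_one_sub, Complex.Gamma_mul_Gamma_eq_betaIntegral ha (by simpa),
    add_sub_cancel, Complex.Gamma_one, one_mul, Complex.betaIntegral,
    intervalIntegral.integral_of_le zero_le_one, integral_Ioc_eq_integral_Ioo]
  have himg : (fun t : ℝ => t / (1 + t)) '' Set.Ioi 0 = Set.Ioo 0 1 := by
    ext x
    constructor
    · rintro ⟨t, ht, rfl⟩
      have ht : 0 < t := ht
      exact ⟨by positivity, by rw [div_lt_one (by positivity)]; linarith⟩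
    · rintro ⟨h0, h1⟩
      have h2 : 0 < 1 - x := by linarith
      refine ⟨x / (1 - x), Set.mem_Ioi.2 (by positivity), ?_⟩
      field_simp
      ring
  have hderiv : ∀ t ∈ Set.Ioi (0 : ℝ),
      HasDerivWithinAt (fun t : ℝ => t / (1 + t)) (1 / (1 + t) ^ 2) (Set.Ioi 0) t := by
    intro t ht
    have ht : 0 < t := ht
    have := (hasDerivAt_id t).div ((hasDerivAt_id t).const_add 1) (by simp; positivity)
    convert! this.hasDerivWithinAt using 1
    simp
  have hinj : Set.InjOn (fun t : ℝ => t / (1 + t)) (Set.Ioi 0) := by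
    intro s hs t ht hst
    have hs : 0 < s := hs
    have ht : 0 < t := ht
    simp only at hst
    rw [div_eq_div_iff (by positivity) (by positivity)] at hst
    linarith
  rw [← himg, integral_image_eq_integral_abs_deriv_smul measurableSet_Ioi hderiv hinj]
  refine setIntegral_congr_fun measurableSet_Ioi fun t ht => ?_
  have ht : 0 < t := ht
  have ht1 : 0 < 1 + t := by positivity
  have hc : ((1 + t : ℝ) : ℂ) ≠ 0 := by exact_mod_cast ht1.ne'
  have e1 : (1 : ℂ) - ((t / (1 + t) : ℝ) : ℂ) = (((1 + t)⁻¹ : ℝ) : ℂ) := by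
    push_cast at hc ⊢; field_simp; ring
  simp only
  rw [e1, abs_of_pos (by positivity), div_eq_mul_inv t, Complex.ofReal_mul,
    Complex.mul_cpow_ofReal_nonneg ht.le (by positivity), mul_assoc,
    ← Complex.cpow_add _ _ (by exact_mod_cast (inv_pos.2 ht1).ne'),
    show a - 1 + (1 - a - 1) = -1 by ring, Complex.cpow_neg_one, Complex.real_smul, smul_eq_mul]
  push_cast at hc ⊢
  rw [add_comm (t : ℂ) 1]
  field_simp

/-- For w > 0 scaling reduces to w = 1. Both sides are holomorphic on the connected slit plane and
agree on positive reals accumulating at 1. -/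
theorem mellin_inv_add {w a : ℂ} (hw : w ∈ Complex.slitPlane) (ha : 0 < a.re) (ha' : a.re < 1) :
    mellin (fun t : ℝ => ((t : ℂ) + w)⁻¹) a =
      Real.pi / Complex.sin (Real.pi * a) * w ^ (a - 1) := by
  have hL : AnalyticOnNhd ℂ (fun w => mellin (fun t : ℝ => ((t : ℂ) + w)⁻¹) a)
      Complex.slitPlane := DifferentiableOn.analyticOnNhd
    (fun v hv => (differentiableAt_mellin_inv_add hv ha ha').differentiableWithinAt)
    Complex.isOpen_slitPlane
  have hR : AnalyticOnNhd ℂ (fun w => Real.pi / Complex.sin (Real.pi * a) * w ^ (a - 1))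
      Complex.slitPlane := DifferentiableOn.analyticOnNhd
    (fun v hv => ((differentiableAt_id.cpow_const hv).const_mul _).differentiableWithinAt)
    Complex.isOpen_slitPlane
  refine hL.eqOn_of_preconnected_of_frequently_eq hR
    (Complex.starConvex_one_slitPlane.isPathConnected
      Complex.one_mem_slitPlane).isConnected.isPreconnected
    Complex.one_mem_slitPlane ?_ hw
  have ht : Tendsto (fun x : ℝ => (x : ℂ)) (𝓝[≠] 1) (𝓝[≠] 1) := by
    refine tendsto_nhdsWithin_of_tendsto_nhds_of_eventually_within _ ?_ ?_
    · exact (Complex.continuous_ofReal.tendsto' 1 1 (by simp)).mono_left nhdsWithin_le_nhds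
    · filter_upwards [self_mem_nhdsWithin] with x hx
      simpa using hx
  refine ht.frequently (Eventually.frequently ?_)
  filter_upwards [nhdsWithin_le_nhds (Ioi_mem_nhds (zero_lt_one' ℝ))] with x hx
  have hx : 0 < x := hx
  have hxc : (x : ℂ) ≠ 0 := by exact_mod_cast hx.ne'
  have e : (fun t : ℝ => ((t : ℂ) + x)⁻¹) =
      fun t : ℝ => (x : ℂ)⁻¹ • (((x⁻¹ * t : ℝ) : ℂ) + 1)⁻¹ := by
    ext t
    rw [smul_eq_mul, ← mul_inv]
    push_cast
    congr 1
    field_simp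
  rw [e, mellin_const_smul, mellin_comp_mul_left (fun t : ℝ => ((t : ℂ) + 1)⁻¹) a (inv_pos.2 hx),
    mellin_inv_add_one ha ha', Complex.cpow_sub _ _ hxc, Complex.cpow_one, Complex.ofReal_inv,
    Complex.inv_cpow, Complex.cpow_neg, inv_inv, smul_eq_mul, smul_eq_mul]
  · field_simp
  · rw [Complex.arg_ofReal_of_nonneg hx.le]; exact Real.pi_pos.ne
-- The Mellin transform of a pole pair along a ray.
/-- The pole pair `± q` of a logarithmic derivative, restricted to the ray at angle `α`. -/
noncomputable def rayTerm (α q u : ℝ) : ℂ :=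
  Complex.exp (α * Complex.I) * (2 * (Complex.exp (α * Complex.I) * u) /
    ((Complex.exp (α * Complex.I) * u) ^ 2 - q ^ 2))

theorem exp_mul_I_im {α : ℝ} (u : ℝ) : (Complex.exp (α * Complex.I) * u).im = Real.sin α * u := by
  rw [Complex.exp_mul_I]; simp [← Complex.ofReal_cos, ← Complex.ofReal_sin]

theorem norm_exp_mul_I_mul {α u : ℝ} (hu : 0 < u) : ‖Complex.exp (α * Complex.I) * u‖ = u := by
  rw [norm_mul, Complex.norm_exp_ofReal_mul_I, one_mul, Complex.norm_real,
    Real.norm_of_nonneg hu.le]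

theorem exp_pi_sub_mem_slitPlane {α : ℝ} (h0 : 0 < α) (h1 : α < Real.pi) :
    Complex.exp (((Real.pi - 2 * α : ℝ) : ℂ) * Complex.I) ∈ Complex.slitPlane := by
  rw [Complex.mem_slitPlane_iff_arg]
  refine ⟨?_, Complex.exp_ne_zero _⟩
  rw [Complex.arg_exp_mul_I, toIocMod_eq_self _ |>.2 ⟨by linarith, by linarith⟩]
  linarith

theorem log_exp_pi_sub {α : ℝ} (h0 : 0 < α) (h1 : α < Real.pi) :
    Complex.log (Complex.exp (((Real.pi - 2 * α : ℝ) : ℂ) * Complex.I)) =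
      ((Real.pi - 2 * α : ℝ) : ℂ) * Complex.I := by
  apply Complex.log_exp <;> simp <;> linarith

/-- With x = e^{iα} the term is 2u/(u² - x⁻²), and -x⁻² = e^{i(π-2α)}. For 0 < α < π the angle π -
2α lies in (-π, π), so after u ↦ u² the simple-pole formula applies with the principal branch. -/
theorem rayTerm_one {α u : ℝ} (h0 : 0 < α) (h1 : α < Real.pi) (hu : 0 < u) :
    rayTerm α 1 u = (2 : ℂ) • ((u : ℂ) ^ (1 : ℂ) •
      (((u ^ (2 : ℝ) : ℝ) : ℂ) + Complex.exp (((Real.pi - 2 * α : ℝ) : ℂ) * Complex.I))⁻¹) := by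
  have hne := ofReal_add_ne_zero (exp_pi_sub_mem_slitPlane h0 h1) (t := u ^ (2 : ℝ)) (by positivity)
  have he : Complex.exp (((Real.pi - 2 * α : ℝ) : ℂ) * Complex.I) =
      -(Complex.exp (α * Complex.I) ^ 2)⁻¹ := by
    rw [← Complex.exp_nat_mul, ← Complex.exp_neg, neg_eq_neg_one_mul (Complex.exp _),
      ← Complex.exp_pi_mul_I, ← Complex.exp_add]
    congr 1; push_cast; ring
  have hx := Complex.exp_ne_zero (α * Complex.I)
  rw [he] at hne ⊢
  rw [Real.rpow_two] at hne ⊢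
  rw [rayTerm, Complex.cpow_one, smul_eq_mul, smul_eq_mul]
  set x := Complex.exp (α * Complex.I)
  have hd : (x * u) ^ 2 - ((1 : ℝ) : ℂ) ^ 2 = x ^ 2 * (((u ^ 2 : ℝ) : ℂ) + -(x ^ 2)⁻¹) := by
    push_cast; field_simp; ring
  rw [hd]
  field_simp

theorem mellinConvergent_rayTerm_one {α : ℝ} (h0 : 0 < α) (h1 : α < Real.pi) {s : ℂ}
    (hs0 : 0 < s.re) (hs2 : s.re < 2) : MellinConvergent (rayTerm α 1) (1 - s) := by
  have hw := exp_pi_sub_mem_slitPlane h0 h1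
  have key := mellinConvergent_inv_add hw (a := (1 - s + 1) / (2 : ℝ)) (by simp; linarith)
    (by simp; linarith)
  rw [← MellinConvergent.comp_rpow two_ne_zero, ← MellinConvergent.cpow_smul] at key
  refine (integrableOn_congr_fun (fun u hu => ?_) measurableSet_Ioi).2 (key.const_smul (2 : ℂ))
  simp only [rayTerm_one h0 h1 hu]

theorem mellin_rayTerm_one {α : ℝ} (h0 : 0 < α) (h1 : α < Real.pi) {s : ℂ}
    (hs0 : 0 < s.re) (hs2 : s.re < 2) : mellin (rayTerm α 1) (1 - s) =
      Real.pi / Complex.sin (Real.pi * s / 2) *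
        Complex.exp (-(s / 2) * ((Real.pi - 2 * α) * Complex.I)) := by
  have hw := exp_pi_sub_mem_slitPlane h0 h1
  have key := mellin_inv_add hw (a := (1 - s + 1) / (2 : ℝ)) (by simp; linarith)
    (by simp; linarith)
  have e1 : mellin (rayTerm α 1) (1 - s) = mellin (fun u : ℝ => (2 : ℂ) • ((u : ℂ) ^ (1 : ℂ) •
      (((u ^ (2 : ℝ) : ℝ) : ℂ) + Complex.exp (((Real.pi - 2 * α : ℝ) : ℂ) * Complex.I))⁻¹))
      (1 - s) := setIntegral_congr_fun measurableSet_Ioi fun u hu => by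
    simp only [rayTerm_one h0 h1 hu]
  rw [e1, mellin_const_smul, mellin_cpow_smul, mellin_comp_rpow (fun u : ℝ =>
    ((u : ℂ) + Complex.exp (((Real.pi - 2 * α : ℝ) : ℂ) * Complex.I))⁻¹), key,
    Complex.cpow_def_of_ne_zero (Complex.exp_ne_zero _), log_exp_pi_sub h0 h1]
  have e2 : Complex.sin (Real.pi * ((1 - s + 1) / (2 : ℝ))) = Complex.sin (Real.pi * s / 2) := by
    rw [← Complex.sin_pi_sub]; congr 1; push_cast; ring
  rw [e2, abs_of_pos two_pos, Complex.real_smul, smul_eq_mul, ← mul_assoc]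
  push_cast
  rw [mul_inv_cancel₀ two_ne_zero, one_mul]
  congr 2
  ring

/-- `rayTerm` is homogeneous of degree -1 in (q, u). Every pole pair thus reduces to q = 1, and
after integration the factor q⁻¹ is cancelled by the Jacobian, leaving q^(-s). -/
theorem cpow_smul_rayTerm {α q u : ℝ} (hq : 0 < q) (hu : 0 < u) (s : ℂ) :
    (u : ℂ) ^ (1 - s - 1) • rayTerm α q u = ((q : ℂ) ^ (-s) * (q : ℂ)⁻¹) *
      ((((q⁻¹ * u : ℝ) : ℂ)) ^ (1 - s - 1) • rayTerm α 1 (q⁻¹ * u)) := by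
  have hqc : (q : ℂ) ≠ 0 := by exact_mod_cast hq.ne'
  have e1 : rayTerm α q u = (q : ℂ)⁻¹ * rayTerm α 1 (q⁻¹ * u) := by
    rw [rayTerm, rayTerm]
    set x := Complex.exp (α * Complex.I)
    have e2 : (x * u) ^ 2 - (q : ℂ) ^ 2 =
        (q : ℂ) ^ 2 * ((x * ((q⁻¹ * u : ℝ) : ℂ)) ^ 2 - ((1 : ℝ) : ℂ) ^ 2) := by
      push_cast; field_simp
    have e3 : 2 * (x * (u : ℂ)) = (q : ℂ) * (2 * (x * ((q⁻¹ * u : ℝ) : ℂ))) := by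
      push_cast; field_simp
    rw [e2, e3, sq, mul_assoc (q : ℂ) q, mul_div_mul_left _ _ hqc, div_mul_eq_div_div_swap]
    field_simp
  have e4 : (u : ℂ) = (q : ℂ) * ((q⁻¹ * u : ℝ) : ℂ) := by push_cast; field_simp
  have e5 : (1 : ℂ) - s - 1 = -s := by ring
  rw [e1, e5]
  conv_lhs => rw [e4, Complex.mul_cpow_ofReal_nonneg hq.le (by positivity)]
  simp only [smul_eq_mul]
  ring

theorem mellinConvergent_rayTerm {α q : ℝ} (h0 : 0 < α) (h1 : α < Real.pi) (hq : 0 < q) {s : ℂ}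
    (hs0 : 0 < s.re) (hs2 : s.re < 2) : MellinConvergent (rayTerm α q) (1 - s) := by
  have key := mellinConvergent_rayTerm_one h0 h1 hs0 hs2
  have k2 := (integrableOn_Ioi_comp_mul_left_iff
    (fun u : ℝ => (u : ℂ) ^ (1 - s - 1) • rayTerm α 1 u) 0 (inv_pos.2 hq)).2 (by rw [mul_zero]; exact key)
  exact (integrableOn_congr_fun (fun u hu => cpow_smul_rayTerm hq hu s) measurableSet_Ioi).2
    (k2.const_mul _)

theorem mellin_rayTerm {α q : ℝ} (h0 : 0 < α) (h1 : α < Real.pi) (hq : 0 < q) {s : ℂ}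
    (hs0 : 0 < s.re) (hs2 : s.re < 2) : mellin (rayTerm α q) (1 - s) =
      (q : ℂ) ^ (-s) * (Real.pi / Complex.sin (Real.pi * s / 2) *
        Complex.exp (-(s / 2) * ((Real.pi - 2 * α) * Complex.I))) := by
  have hqc : (q : ℂ) ≠ 0 := by exact_mod_cast hq.ne'
  rw [← mellin_rayTerm_one h0 h1 hs0 hs2, mellin,
    setIntegral_congr_fun measurableSet_Ioi (fun u hu => cpow_smul_rayTerm hq hu s),
    integral_const_mul, integral_comp_mul_left_Ioi
      (fun u : ℝ => (u : ℂ) ^ (1 - s - 1) • rayTerm α 1 u) 0 (inv_pos.2 hq), mellin, mul_zero,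
    inv_inv, Complex.real_smul]
  field_simp

/-- The scaling applied to absolute values: the norms are proportional to q^(-Re s), hence summable
exactly under the density estimate for Re s > 1. -/
theorem integral_norm_rayTerm {α q : ℝ} (hq : 0 < q) (s : ℂ) :
    ∫ u in Set.Ioi (0 : ℝ), ‖(u : ℂ) ^ (1 - s - 1) • rayTerm α q u‖ =
      q ^ (-s.re) * ∫ u in Set.Ioi (0 : ℝ), ‖(u : ℂ) ^ (1 - s - 1) • rayTerm α 1 u‖ := by
  have e : ∀ u ∈ Set.Ioi (0 : ℝ), ‖(u : ℂ) ^ (1 - s - 1) • rayTerm α q u‖ =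
      (q ^ (-s.re) * q⁻¹) * ‖((q⁻¹ * u : ℝ) : ℂ) ^ (1 - s - 1) • rayTerm α 1 (q⁻¹ * u)‖ :=
    fun u hu => by
      rw [cpow_smul_rayTerm hq hu s, norm_mul, norm_mul, Complex.norm_cpow_eq_rpow_re_of_pos hq,
        norm_inv, Complex.norm_real, Real.norm_of_nonneg hq.le, Complex.neg_re]
  rw [setIntegral_congr_fun measurableSet_Ioi e, integral_const_mul, integral_comp_mul_left_Ioi
      (fun u : ℝ => ‖(u : ℂ) ^ (1 - s - 1) • rayTerm α 1 u‖) 0 (inv_pos.2 hq), mul_zero,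
    inv_inv, smul_eq_mul]
  field_simp

/-! ### The Mellin transform of the logarithmic derivative along a ray. -/

namespace CotSum
variable {ι : Type} (F : CotSum ι) [Fintype ι]

/-- The logarithmic derivative of `u ↦ z * F.eval z`, `z = u e^{iα}`. -/
noncomputable def near (α u : ℝ) : ℂ :=
  Complex.exp (α * Complex.I) * F.critSum (Complex.exp (α * Complex.I) * u)

/-- The logarithmic derivative of `u ↦ F.eval (u e^{iα})`. -/
noncomputable def far (α u : ℝ) : ℂ :=
  Complex.exp (α * Complex.I) * F.logD (Complex.exp (α * Complex.I) * u)

theorem im_ray_ne_zero {α u : ℝ} (h0 : 0 < α) (h1 : α < Real.pi) (hu : 0 < u) :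
    (Complex.exp (α * Complex.I) * u).im ≠ 0 := by
  rw [exp_mul_I_im]
  exact (mul_pos (Real.sin_pos_of_pos_of_lt_pi h0 h1) hu).ne'

theorem near_eq_far_add {α u : ℝ} (h0 : 0 < α) (h1 : α < Real.pi) (hu : 0 < u) :
    F.near α u = F.far α u + (u : ℂ)⁻¹ := by
  have huc : (u : ℂ) ≠ 0 := by exact_mod_cast hu.ne'
  have hx := Complex.exp_ne_zero (α * Complex.I)
  rw [near, far, F.logD_eq_critSum (im_ray_ne_zero h0 h1 hu)]
  field_simp
  ring

theorem continuousOn_far {α : ℝ} (h0 : 0 < α) (h1 : α < Real.pi) :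
    ContinuousOn (F.far α) (Set.Ioi 0) := by
  intro u hu
  have him := im_ray_ne_zero h0 h1 hu
  have h2 := (F.analyticAt_logD (F.not_isPole_of_im_ne_zero him) (F.eval_ne_zero him)).continuousAt
  refine ContinuousAt.continuousWithinAt (continuousAt_const.mul ?_)
  exact ContinuousAt.comp (f := fun u : ℝ => Complex.exp (α * Complex.I) * u) h2 (by fun_prop)

theorem continuousOn_near {α : ℝ} (h0 : 0 < α) (h1 : α < Real.pi) :
    ContinuousOn (F.near α) (Set.Ioi 0) := by
  refine ContinuousOn.congr (f := fun u : ℝ => F.far α u + (u : ℂ)⁻¹)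
    ((F.continuousOn_far h0 h1).add (ContinuousOn.inv₀ (by fun_prop) fun u hu => ?_))
    fun u hu => F.near_eq_far_add h0 h1 hu
  exact_mod_cast (Set.mem_Ioi.1 hu).ne'

theorem exists_norm_near_le {α : ℝ} (h0 : 0 < α) (h1 : α < Real.pi) :
    ∃ C, 0 ≤ C ∧ ∀ u, 0 < u → ‖F.near α u‖ ≤ C * u := by
  have hs := F.summable_rpow_crit (σ := 2) (by norm_num)
  have hT : 0 ≤ ∑' q : F.crit, (q : ℝ) ^ (-2 : ℝ) := tsum_nonneg fun q => Real.rpow_nonneg q.2.1.le _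
  have hsin := Real.sin_pos_of_pos_of_lt_pi h0 h1
  refine ⟨8 * (∑' q : F.crit, (q : ℝ) ^ (-2 : ℝ)) / Real.sin α, by positivity, fun u hu => ?_⟩
  have h2 := norm_oddPoleSum_mul_abs_im_le hs (fun q => q.2.1) (fun q => F.norm_ord_le q)
    (Complex.exp (α * Complex.I) * u)
  rw [exp_mul_I_im, abs_of_pos (by positivity), norm_exp_mul_I_mul hu] at h2
  rw [near, norm_mul, Complex.norm_exp_ofReal_mul_I, one_mul, div_mul_eq_mul_div, le_div_iff₀ hsin]
  refine le_of_mul_le_mul_right ?_ hu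
  rw [mul_assoc]
  refine h2.trans (le_of_eq (by ring))

theorem norm_far_le {α : ℝ} (h0 : 0 < α) (h1 : α < Real.pi) {u : ℝ} (hu : 1 ≤ u) :
    ‖F.far α u‖ ≤ ∑ j, 2 / Real.sin α * Real.exp (-(F.lam j * Real.sin α) * u) := by
  have hsin := Real.sin_pos_of_pos_of_lt_pi h0 h1
  have hu0 : 0 < u := by linarith
  have h2 := F.norm_logD_le_exp (z := Complex.exp (α * Complex.I) * u)
    (by rw [exp_mul_I_im]; positivity)
  rw [far, norm_mul, Complex.norm_exp_ofReal_mul_I, one_mul]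
  refine h2.trans (Finset.sum_le_sum fun j _ => ?_)
  rw [exp_mul_I_im, div_mul_eq_mul_div, ← mul_assoc, ← neg_mul]
  gcongr
  nlinarith

theorem integrableOn_near {α : ℝ} (h0 : 0 < α) (h1 : α < Real.pi) :
    IntegrableOn (F.near α) (Set.Ioc 0 1) := by
  obtain ⟨C, hC0, hC⟩ := F.exists_norm_near_le h0 h1
  refine IntegrableOn.of_bound (by simp)
    (((F.continuousOn_near h0 h1).mono Set.Ioc_subset_Ioi_self).aestronglyMeasurable
      measurableSet_Ioc) C ?_
  refine (ae_restrict_iff' measurableSet_Ioc).2 (ae_of_all _ fun u hu => ?_)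
  exact (hC u hu.1).trans (by nlinarith [hu.2])

theorem integrableOn_far {α : ℝ} (h0 : 0 < α) (h1 : α < Real.pi) :
    IntegrableOn (F.far α) (Set.Ioi 1) := by
  have hsin := Real.sin_pos_of_pos_of_lt_pi h0 h1
  have hb : IntegrableOn (fun u : ℝ =>
      ∑ j, 2 / Real.sin α * Real.exp (-(F.lam j * Real.sin α) * u)) (Set.Ioi 1) :=
    integrable_finsetSum _ fun j _ =>
      (exp_neg_integrableOn_Ioi 1 (mul_pos (F.lam_pos j) hsin)).const_mul _
  refine hb.mono' (((F.continuousOn_far h0 h1).mono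
    (Set.Ioi_subset_Ioi zero_le_one)).aestronglyMeasurable measurableSet_Ioi) ?_
  exact (ae_restrict_iff' measurableSet_Ioi).2 (ae_of_all _ fun u hu =>
    F.norm_far_le h0 h1 (le_of_lt hu))

/-- Removing the pole at the origin leaves an odd function, so the decay is of first order; this is
what makes the integral over (0, 1] converge up to Re s < 2. -/
theorem near_isBigO_zero {α : ℝ} (h0 : 0 < α) (h1 : α < Real.pi) :
    ((Set.Ioc 0 1).indicator (F.near α)) =O[𝓝[>] 0] (fun u : ℝ => u ^ (-(-1 : ℝ))) := by
  obtain ⟨C, hC0, hC⟩ := F.exists_norm_near_le h0 h1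
  refine Asymptotics.IsBigO.of_bound C ?_
  filter_upwards [self_mem_nhdsWithin] with u hu
  have hu : 0 < u := hu
  rw [neg_neg, Real.rpow_one, Real.norm_of_nonneg hu.le]
  exact (norm_indicator_le_norm_self _ _).trans (hC u hu)

theorem near_isBigO_top (α a : ℝ) :
    ((Set.Ioc 0 1).indicator (F.near α)) =O[atTop] (fun u : ℝ => u ^ a) := by
  refine (Asymptotics.isBigO_zero _ _).congr' ?_ EventuallyEq.rfl
  filter_upwards [eventually_gt_atTop 1] with u hu
  rw [Set.indicator_of_notMem fun h => absurd h.2 hu.not_ge]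

theorem far_isBigO_zero (α a : ℝ) :
    ((Set.Ioi 1).indicator (F.far α)) =O[𝓝[>] 0] (fun u : ℝ => u ^ a) := by
  refine (Asymptotics.isBigO_zero _ _).congr' ?_ EventuallyEq.rfl
  filter_upwards [nhdsWithin_le_nhds (Iio_mem_nhds zero_lt_one)] with u hu
  have hu : u ∉ Set.Ioi 1 := fun h => lt_asymm (Set.mem_Ioi.1 h) hu
  rw [Set.indicator_of_notMem hu]

theorem far_isBigO_top {α : ℝ} (h0 : 0 < α) (h1 : α < Real.pi) (a : ℝ) :
    ((Set.Ioi 1).indicator (F.far α)) =O[atTop] (fun u : ℝ => u ^ a) := by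
  have hsin := Real.sin_pos_of_pos_of_lt_pi h0 h1
  have hb : (fun u : ℝ => ∑ j, 2 / Real.sin α * Real.exp (-(F.lam j * Real.sin α) * u))
      =O[atTop] (fun u : ℝ => u ^ a) := Asymptotics.IsBigO.fun_sum fun j _ =>
    (isLittleO_exp_neg_mul_rpow_atTop (mul_pos (F.lam_pos j) hsin) a).isBigO.const_mul_left _
  refine Asymptotics.IsBigO.trans (Asymptotics.IsBigO.of_bound 1 ?_) hb
  filter_upwards [eventually_ge_atTop 1] with u hu
  rw [one_mul]
  exact ((norm_indicator_le_norm_self _ _).trans (F.norm_far_le h0 h1 hu)).trans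
    (le_abs_self _)

theorem locallyIntegrableOn_indicator_near {α : ℝ} (h0 : 0 < α) (h1 : α < Real.pi) :
    LocallyIntegrableOn ((Set.Ioc 0 1).indicator (F.near α)) (Set.Ioi 0) :=
  (((F.integrableOn_near h0 h1).integrable_indicator
    measurableSet_Ioc).locallyIntegrable).locallyIntegrableOn _

theorem locallyIntegrableOn_indicator_far {α : ℝ} (h0 : 0 < α) (h1 : α < Real.pi) :
    LocallyIntegrableOn ((Set.Ioi 1).indicator (F.far α)) (Set.Ioi 0) :=
  (((F.integrableOn_far h0 h1).integrable_indicator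
    measurableSet_Ioi).locallyIntegrable).locallyIntegrableOn _

/-- The integral of `u ^ (-s)` against the logarithmic derivative over `(0, 1]`. -/
noncomputable def nearIntegral (α : ℝ) (s : ℂ) : ℂ :=
  ∫ u in Set.Ioc (0 : ℝ) 1, (u : ℂ) ^ (-s) * F.near α u

/-- The integral of `u ^ (-s)` against the logarithmic derivative over `(1, ∞)`. -/
noncomputable def farIntegral (α : ℝ) (s : ℂ) : ℂ :=
  ∫ u in Set.Ioi (1 : ℝ), (u : ℂ) ^ (-s) * F.far α u

theorem _root_.mellin_indicator {S : Set ℝ} (hS : MeasurableSet S) (hS0 : S ⊆ Set.Ioi 0)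
    (f : ℝ → ℂ) (s : ℂ) :
    mellin (S.indicator f) (1 - s) = ∫ u in S, (u : ℂ) ^ (-s) * f u := by
  have e : (fun t : ℝ => (t : ℂ) ^ (1 - s - 1) • S.indicator f t) =
      S.indicator fun u : ℝ => (u : ℂ) ^ (-s) * f u := by
    ext t
    by_cases h : t ∈ S
    · simp only [Set.indicator_of_mem h, smul_eq_mul]; congr 2; ring
    · simp only [Set.indicator_of_notMem h, smul_zero]
  rw [mellin, e, setIntegral_indicator hS, Set.inter_eq_self_of_subset_right hS0]

theorem _root_.integrableOn_of_mellinConvergent_indicator {S : Set ℝ} (hS : MeasurableSet S)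
    (hS0 : S ⊆ Set.Ioi 0) {f : ℝ → ℂ} {s : ℂ} (h : MellinConvergent (S.indicator f) (1 - s)) :
    IntegrableOn (fun u : ℝ => (u : ℂ) ^ (-s) * f u) S := by
  refine (integrableOn_congr_fun (fun t ht => ?_) hS).2 (h.mono_set hS0)
  simp only [Set.indicator_of_mem ht, smul_eq_mul]; congr 2; ring

theorem integrableOn_cpow_mul_near {α : ℝ} (h0 : 0 < α) (h1 : α < Real.pi) {s : ℂ}
    (hs : s.re < 2) : IntegrableOn (fun u : ℝ => (u : ℂ) ^ (-s) * F.near α u) (Set.Ioc 0 1) :=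
  integrableOn_of_mellinConvergent_indicator measurableSet_Ioc Set.Ioc_subset_Ioi_self
    (mellinConvergent_of_isBigO_rpow (F.locallyIntegrableOn_indicator_near h0 h1)
      (F.near_isBigO_top α _) (lt_add_one _) (F.near_isBigO_zero h0 h1) (by simp; linarith))

theorem integrableOn_cpow_mul_far {α : ℝ} (h0 : 0 < α) (h1 : α < Real.pi) (s : ℂ) :
    IntegrableOn (fun u : ℝ => (u : ℂ) ^ (-s) * F.far α u) (Set.Ioi 1) :=
  integrableOn_of_mellinConvergent_indicator measurableSet_Ioi (Set.Ioi_subset_Ioi zero_le_one)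
    (mellinConvergent_of_isBigO_rpow (F.locallyIntegrableOn_indicator_far h0 h1)
      (F.far_isBigO_top h0 h1 _) (lt_add_one _) (F.far_isBigO_zero α _) (sub_one_lt _))

theorem differentiableAt_nearIntegral {α : ℝ} (h0 : 0 < α) (h1 : α < Real.pi) {s : ℂ}
    (hs : s.re < 2) : DifferentiableAt ℂ (F.nearIntegral α) s := by
  have h := mellin_differentiableAt_of_isBigO_rpow (s := 1 - s)
    (F.locallyIntegrableOn_indicator_near h0 h1)
    (F.near_isBigO_top α _) (lt_add_one _) (F.near_isBigO_zero h0 h1) (by simp; linarith)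
  have e : F.nearIntegral α = fun s => mellin ((Set.Ioc 0 1).indicator (F.near α)) (1 - s) := by
    ext s; rw [mellin_indicator measurableSet_Ioc Set.Ioc_subset_Ioi_self]; rfl
  rw [e]
  exact DifferentiableAt.comp (f := fun s : ℂ => 1 - s) s h (by fun_prop)

theorem differentiableAt_farIntegral {α : ℝ} (h0 : 0 < α) (h1 : α < Real.pi) (s : ℂ) :
    DifferentiableAt ℂ (F.farIntegral α) s := by
  have h := mellin_differentiableAt_of_isBigO_rpow (s := 1 - s)
    (F.locallyIntegrableOn_indicator_far h0 h1)
    (F.far_isBigO_top h0 h1 _) (lt_add_one _) (F.far_isBigO_zero α _) (sub_one_lt _)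
  have e : F.farIntegral α = fun s => mellin ((Set.Ioi 1).indicator (F.far α)) (1 - s) := by
    ext s; rw [mellin_indicator measurableSet_Ioi (Set.Ioi_subset_Ioi zero_le_one)]; rfl
  rw [e]
  exact DifferentiableAt.comp (f := fun s : ℂ => 1 - s) s h (by fun_prop)

/-- The Dirichlet series over the positive zeros and poles, as a Mellin transform. -/
theorem hasSum_ord_mul_cpow {α : ℝ} (h0 : 0 < α) (h1 : α < Real.pi) {s : ℂ}
    (hs1 : 1 < s.re) (hs2 : s.re < 2) :
    HasSum (fun q : F.crit => (F.ord q : ℂ) * ((q : ℝ) : ℂ) ^ (-s) *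
      (Real.pi / Complex.sin (Real.pi * s / 2) *
        Complex.exp (-(s / 2) * ((Real.pi - 2 * α) * Complex.I))))
      (F.nearIntegral α s + F.farIntegral α s + 1 / s) := by
  have hs0 : 0 < s.re := by linarith
  have : Countable F.crit := F.countable_crit.to_subtype
  set Φ : F.crit → ℝ → ℂ := fun q u => (F.ord q : ℂ) * ((u : ℂ) ^ (1 - s - 1) • rayTerm α q u)
    with hΦ
  -- Sum and integral may be interchanged only in the strip: Re s > 1 makes the L¹ norms summable,
  -- and Re s < 2 makes each term integrable at 0.
  have key := hasSum_integral_of_summable_integral_norm (F := Φ)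
    (μ := volume.restrict (Set.Ioi 0))
    (fun q => (mellinConvergent_rayTerm h0 h1 q.2.1 hs0 hs2).const_mul _) (by
      refine Summable.of_nonneg_of_le (fun q => integral_nonneg fun u => norm_nonneg _)
        (fun q => ?_) ((F.summable_rpow_crit hs1).mul_right
          (∫ u in Set.Ioi (0 : ℝ), ‖(u : ℂ) ^ (1 - s - 1) • rayTerm α 1 u‖))
      rw [← integral_norm_rayTerm q.2.1]
      simp only [hΦ, norm_mul (F.ord _ : ℂ)]
      rw [integral_const_mul]
      exact mul_le_of_le_one_left (integral_nonneg fun u => norm_nonneg _) (F.norm_ord_le q))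
  convert! key using 1
  · ext q
    simp only [hΦ]
    rw [integral_const_mul, mul_assoc, ← mellin_rayTerm h0 h1 q.2.1 hs0 hs2]
    rfl
  · have e1 : ∀ u ∈ Set.Ioi (0 : ℝ), ∑' q, Φ q u = (u : ℂ) ^ (-s) * F.near α u := by
      intro u hu
      rw [near, critSum, oddPoleSum, ← tsum_mul_left, ← tsum_mul_left]
      refine tsum_congr fun q => ?_
      simp only [hΦ, rayTerm, smul_eq_mul]
      rw [show (1 : ℂ) - s - 1 = -s by ring]
      ring
    -- Beyond 1 the two logarithmic derivatives differ by 1/u, and the integral of u^(-s-1) over (1,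
    -- ∞) is the summand 1/s.
    have e2 : ∀ u ∈ Set.Ioi (1 : ℝ), (u : ℂ) ^ (-s) * F.near α u =
        (u : ℂ) ^ (-s) * F.far α u + (u : ℂ) ^ (-s - 1) := by
      intro u hu
      have hu0 : 0 < u := zero_lt_one.trans hu
      have huc : (u : ℂ) ≠ 0 := by exact_mod_cast hu0.ne'
      rw [F.near_eq_far_add h0 h1 hu0, mul_add, Complex.cpow_sub _ _ huc, Complex.cpow_one,
        div_eq_mul_inv]
    have hre : (-s - 1).re < -1 := by simp; linarith
    have hint : IntegrableOn (fun u : ℝ => (u : ℂ) ^ (-s - 1)) (Set.Ioi 1) :=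
      integrableOn_Ioi_cpow_of_lt hre zero_lt_one
    have hfar := F.integrableOn_cpow_mul_far h0 h1 s
    rw [setIntegral_congr_fun measurableSet_Ioi e1, ← Set.Ioc_union_Ioi_eq_Ioi zero_le_one,
      setIntegral_union (Set.Ioc_disjoint_Ioi le_rfl) measurableSet_Ioi
        (F.integrableOn_cpow_mul_near h0 h1 hs2)
        ((integrableOn_congr_fun e2 measurableSet_Ioi).2 (hfar.add hint)),
      setIntegral_congr_fun measurableSet_Ioi e2, integral_add hfar hint,
      integral_Ioi_cpow_of_lt hre zero_lt_one, ← add_assoc]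
    congr 1
    simp

end CotSum
-- The Dirac equation on one bond.
/-- The spinor with prescribed upper and lower pair. -/
noncomputable def ofPairs : (Fin 2 → ℂ) × (Fin 2 → ℂ) →ₗ[ℂ] Spinor where
  toFun d := !₂[d.1 0, d.1 1, d.2 1, -d.2 0]
  map_add' d e := by ext i; fin_cases i <;> simp [add_comm]
  map_smul' c d := by ext i; fin_cases i <;> simp

theorem upperPair_ofPairs (d : (Fin 2 → ℂ) × (Fin 2 → ℂ)) : upperPair (ofPairs d) = d.1 := by
  ext i; fin_cases i <;> simp [upperPair, ofPairs]

theorem lowerPair_ofPairs (d : (Fin 2 → ℂ) × (Fin 2 → ℂ)) : lowerPair (ofPairs d) = d.2 := by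
  ext i; fin_cases i <;> simp [lowerPair, ofPairs]

theorem ofPairs_upperPair_lowerPair (φ : Spinor) : ofPairs (upperPair φ, lowerPair φ) = φ := by
  ext i; fin_cases i <;> simp [upperPair, lowerPair, ofPairs]

/-- In the coordinates (v, w) the matrix -iα acts as (v, w) ↦ (w, -v). The eigenvalue equation
becomes w' = k v, v' = -k w, which is why `diracSol` is a rotation by kx. -/
theorem negIAlpha_ofPairs (d : (Fin 2 → ℂ) × (Fin 2 → ℂ)) :
    negIAlpha (ofPairs d) = ofPairs (d.2, -d.1) := by
  ext i
  fin_cases i <;>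
    simp [negIAlpha, ofPairs, diracAlpha, Matrix.toEuclideanLin, Matrix.toLpLin_apply,
      ← mul_assoc] <;> ring_nf <;> simp

theorem negIAlpha_negIAlpha (φ : Spinor) : negIAlpha (negIAlpha φ) = -φ := by
  rw [← ofPairs_upperPair_lowerPair φ, negIAlpha_ofPairs, negIAlpha_ofPairs]
  exact map_neg ofPairs _

/-- The solution of the Dirac equation at energy `k` with initial data `d`. -/
noncomputable def diracSol (k x : ℝ) : (Fin 2 → ℂ) × (Fin 2 → ℂ) →ₗ[ℂ] Spinor where
  toFun d := ofPairs ((Real.cos (k * x) : ℂ) • d.1 - (Real.sin (k * x) : ℂ) • d.2,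
    (Real.sin (k * x) : ℂ) • d.1 + (Real.cos (k * x) : ℂ) • d.2)
  map_add' d e := by
    rw [← map_add]
    congr 1
    ext i <;> simp <;> ring
  map_smul' c d := by
    rw [RingHom.id_apply, ← map_smul]
    congr 1
    ext i <;> simp <;> ring

theorem diracSol_zero (k : ℝ) (d : (Fin 2 → ℂ) × (Fin 2 → ℂ)) : diracSol k 0 d = ofPairs d := by
  simp [diracSol]

theorem diracSol_eq (k x : ℝ) (d : (Fin 2 → ℂ) × (Fin 2 → ℂ)) : diracSol k x d =
    Real.cos (k * x) • ofPairs d + Real.sin (k * x) • ofPairs (-d.2, d.1) := by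
  have h : ∀ (r : ℝ) (φ : Spinor), r • φ = (r : ℂ) • φ := fun r φ => (Complex.coe_smul r φ).symm
  rw [h, h, ← map_smul, ← map_smul, ← map_add, diracSol]
  simp only [LinearMap.coe_mk, AddHom.coe_mk]
  congr 1
  ext i <;> simp <;> ring

theorem hasDerivAt_diracSol (k x : ℝ) (d : (Fin 2 → ℂ) × (Fin 2 → ℂ)) :
    HasDerivAt (fun x => diracSol k x d) (-((k : ℂ) • negIAlpha (diracSol k x d))) x := by
  have hk : HasDerivAt (fun x : ℝ => k * x) k x := by
    simpa using (hasDerivAt_id x).const_mul k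
  have h := (hk.cos.smul_const (ofPairs d)).add (hk.sin.smul_const (ofPairs (-d.2, d.1)))
  have e : (fun x => diracSol k x d) = (fun x => Real.cos (k * x) • ofPairs d) +
      fun x => Real.sin (k * x) • ofPairs (-d.2, d.1) := by
    ext1 x; exact diracSol_eq k x d
  rw [e]
  convert! h using 1
  have h2 : ∀ (r : ℝ) (φ : Spinor), r • φ = (r : ℂ) • φ := fun r φ => (Complex.coe_smul r φ).symm
  rw [h2, h2, ← map_smul ofPairs, ← map_smul ofPairs, ← map_add, diracSol]
  simp only [LinearMap.coe_mk, AddHom.coe_mk, negIAlpha_ofPairs]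
  rw [← map_smul ofPairs, ← map_neg]
  congr 1
  ext i <;> simp <;> ring

theorem continuous_diracSol (k : ℝ) (d : (Fin 2 → ℂ) × (Fin 2 → ℂ)) :
    Continuous fun x => diracSol k x d :=
  continuous_iff_continuousAt.2 fun x => (hasDerivAt_diracSol k x d).continuousAt

theorem continuous_negIAlpha : Continuous negIAlpha := LinearMap.continuous_of_finiteDimensional _

theorem continuous_memLp_bond {f : ℝ → Spinor} (hf : Continuous f) (ℓ : ℝ) :
    MemLp f 2 (bondMeasure ℓ) := by
  obtain ⟨C, hC⟩ := (isCompact_Icc (a := (0 : ℝ)) (b := ℓ)).exists_bound_of_continuousOn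
    hf.continuousOn
  exact MemLp.of_bound hf.aestronglyMeasurable C
    ((ae_restrict_iff' measurableSet_Icc).2 (ae_of_all _ hC))

theorem hasH1Deriv_diracSol (ℓ k : ℝ) (d : (Fin 2 → ℂ) × (Fin 2 → ℂ)) :
    HasH1Deriv ℓ (fun x => diracSol k x d) (fun x => -((k : ℂ) • negIAlpha (diracSol k x d))) := by
  have hc : Continuous fun x => -((k : ℂ) • negIAlpha (diracSol k x d)) :=
    ((continuous_negIAlpha.comp (continuous_diracSol k d)).const_smul (k : ℂ)).neg
  refine ⟨continuous_memLp_bond hc ℓ, fun x _ => ?_⟩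
  rw [intervalIntegral.integral_eq_sub_of_hasDerivAt (fun t _ => hasDerivAt_diracSol k t d)
    (hc.intervalIntegrable _ _)]
  abel

/-- An H¹ solution satisfies the equation only almost everywhere. As a primitive of a continuous
function of itself it is a classical solution, and uniqueness for linear systems applies. -/
theorem eqOn_diracSol_of_hasH1Deriv {ℓ k : ℝ} (hℓ : 0 < ℓ) {f g : ℝ → Spinor}
    (h : HasH1Deriv ℓ f g) (hg : ∀ᵐ x ∂bondMeasure ℓ, negIAlpha (g x) = (k : ℂ) • f x) :
    ∀ x ∈ Set.Icc 0 ℓ, f x = diracSol k x (upperPair (f 0), lowerPair (f 0)) := by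
  set A : Spinor →L[ℂ] Spinor := LinearMap.toContinuousLinearMap (-((k : ℂ) • negIAlpha)) with hA
  have hAapp : ∀ φ, A φ = -((k : ℂ) • negIAlpha φ) := fun φ => rfl
  have hgA : ∀ᵐ x ∂bondMeasure ℓ, g x = A (f x) := by
    filter_upwards [hg] with x hx
    rw [hAapp, ← map_smul, ← hx, negIAlpha_negIAlpha, neg_neg]
  have hint : IntervalIntegrable g volume 0 ℓ := h.intervalIntegrable ⟨hℓ.le, le_rfl⟩
  have hcont : ContinuousOn f (Set.Icc 0 ℓ) := by
    have h1 := intervalIntegral.continuousOn_primitive_interval' hint Set.left_mem_uIcc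
    rw [Set.uIcc_of_le hℓ.le] at h1
    exact (continuousOn_const.add h1).congr h.2
  -- Extending f by its end values makes A ∘ p continuous on the whole line, so its primitive is
  -- differentiable everywhere, the end points included.
  set p : ℝ → Spinor := fun x => f (Set.projIcc 0 ℓ hℓ.le x) with hp
  have hpc : Continuous p :=
    (continuousOn_iff_continuous_domRestrict.1 hcont).comp continuous_projIcc
  have hpf : ∀ x ∈ Set.Icc 0 ℓ, p x = f x := fun x hx => by
    rw [hp]; simp only; rw [Set.projIcc_of_mem hℓ.le hx]
  set F : ℝ → Spinor := fun x => f 0 + ∫ t in (0 : ℝ)..x, A (p t) with hF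
  have hFf : ∀ x ∈ Set.Icc 0 ℓ, F x = f x := by
    intro x hx
    rw [h.2 x hx, hF]
    simp only
    congr 1
    refine intervalIntegral.integral_congr_ae ?_
    rw [ae_restrict_iff' measurableSet_Icc] at hgA
    filter_upwards [hgA] with t ht htx
    rw [Set.uIoc_of_le hx.1] at htx
    have htI : t ∈ Set.Icc 0 ℓ := ⟨htx.1.le, htx.2.trans hx.2⟩
    rw [ht htI, hpf t htI]
  have hFd : ∀ x, HasDerivAt F (A (p x)) x := fun x =>
    (intervalIntegral.integral_hasDerivAt_right ((A.continuous.comp hpc).intervalIntegrable _ _)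
      (A.continuous.comp hpc).stronglyMeasurable.stronglyMeasurableAtFilter
      (A.continuous.comp hpc).continuousAt).const_add _
  have key := ODE_solution_unique_of_mem_Icc_right (v := fun _ φ => A φ) (s := fun _ => Set.univ)
    (K := ‖A‖₊) (a := 0) (b := ℓ) (f := F)
    (g := fun x => diracSol k x (upperPair (f 0), lowerPair (f 0)))
    (fun _ _ => A.lipschitz.lipschitzOnWith) (fun x _ => (hFd x).continuousAt.continuousWithinAt)
    (fun x hx => by
      have hx' := Set.Ico_subset_Icc_self hx
      have := (hFd x).hasDerivWithinAt (s := Set.Ici x)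
      rwa [hpf x hx', ← hFf x hx'] at this)
    (fun _ _ => Set.mem_univ _) (continuous_diracSol k _).continuousOn
    (fun x _ => (hasDerivAt_diracSol k x _).hasDerivWithinAt) (fun _ _ => Set.mem_univ _)
    (by rw [diracSol_zero, ofPairs_upperPair_lowerPair]; exact hFf 0 ⟨le_rfl, hℓ.le⟩)
  intro x hx
  rw [← hFf x hx]
  exact key hx

/-! ### Eigenfunctions of the rose and their initial data. -/

section Rose

variable {B : ℕ} (L : Fin B → ℝ) (uo ut : Fin B → SU2) (k : ℝ)

/-- The vector of solutions on all bonds with given initial data. -/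
noncomputable def roseSol : (Fin B → (Fin 2 → ℂ) × (Fin 2 → ℂ)) →ₗ[ℂ] SpinorSpace L where
  toFun d := WithLp.toLp 2 fun b =>
    (continuous_memLp_bond (continuous_diracSol k (d b)) (L b)).toLp
  map_add' d e := by
    rw [← WithLp.toLp_add]
    congr 1
    ext1 b
    change MemLp.toLp _ _ = MemLp.toLp _ _ + MemLp.toLp _ _
    rw [← MemLp.toLp_add]
    congr 1
    ext1 x
    simp
  map_smul' c d := by
    rw [RingHom.id_apply, ← WithLp.toLp_smul]
    congr 1
    ext1 b
    refine Eq.trans ?_ (MemLp.toLp_const_smul c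
      (continuous_memLp_bond (continuous_diracSol k (d b)) (L b)))
    congr 1
    ext1 x
    simp

theorem roseSol_ae_eq (d : Fin B → (Fin 2 → ℂ) × (Fin 2 → ℂ)) (b : Fin B) :
    roseSol L k d b =ᵐ[bondMeasure (L b)] fun x => diracSol k x (d b) :=
  MemLp.coeFn_toLp (continuous_memLp_bond (continuous_diracSol k (d b)) (L b))

variable {L}

/-- The vertex conditions use point values. These are determined by the L² class because continuous
functions that agree almost everywhere on a nondegenerate interval agree up to its end points. -/
theorem ae_eq_roseSol_imp (hL : ∀ b, 0 < L b) {d : Fin B → (Fin 2 → ℂ) × (Fin 2 → ℂ)}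
    {f : Fin B → ℝ → Spinor} (hc : ∀ b, ContinuousOn (f b) (Set.Icc 0 (L b)))
    (h : ∀ b, roseSol L k d b =ᵐ[bondMeasure (L b)] f b) (b : Fin B) :
    ∀ x ∈ Set.Icc 0 (L b), f b x = diracSol k x (d b) := fun _ hx =>
  Measure.eqOn_Icc_of_ae_eq volume (hL b).ne ((h b).symm.trans (roseSol_ae_eq L k d b))
    (hc b) (continuous_diracSol k (d b)).continuousOn hx

theorem roseSol_injective (hL : ∀ b, 0 < L b) : Function.Injective (roseSol L k) := by
  rw [← LinearMap.ker_eq_bot, LinearMap.ker_eq_bot']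
  intro d hd
  ext1 b
  have h := ae_eq_roseSol_imp k hL (d := d) (f := fun _ _ => 0) (fun b => continuousOn_const)
    (fun b => by
      rw [hd]
      exact Lp.coeFn_zero _ _ _) b 0 ⟨le_rfl, (hL b).le⟩
  rw [diracSol_zero] at h
  have h1 := congrArg upperPair h
  have h2 := congrArg lowerPair h
  rw [upperPair_ofPairs, map_zero] at h1
  rw [lowerPair_ofPairs, map_zero] at h2
  exact Prod.ext h1.symm h2.symm

theorem HasH1Deriv.continuousOn {ℓ : ℝ} (hℓ : 0 ≤ ℓ) {f g : ℝ → Spinor} (h : HasH1Deriv ℓ f g) :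
    ContinuousOn f (Set.Icc 0 ℓ) := by
  have h1 := intervalIntegral.continuousOn_primitive_interval'
    (h.intervalIntegrable ⟨hℓ, le_rfl⟩) Set.left_mem_uIcc
  rw [Set.uIcc_of_le hℓ] at h1
  exact (continuousOn_const.add h1).congr h.2

theorem mem_roseEigenspace_iff (ψ : SpinorSpace L) : ψ ∈ roseEigenspace L uo ut k ↔
    IsRoseDiracPair L uo ut ψ ((k : ℂ) • ψ) := Iff.rfl

theorem roseSol_mem_iff (hL : ∀ b, 0 < L b) (d : Fin B → (Fin 2 → ℂ) × (Fin 2 → ℂ)) :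
    roseSol L k d ∈ roseEigenspace L uo ut k ↔
      RoseVertexConditions L uo ut fun b x => diracSol k x (d b) := by
  rw [mem_roseEigenspace_iff]
  constructor
  · rintro ⟨f, g, h1, h2, h3, -⟩
    have h := ae_eq_roseSol_imp k hL (fun b => (h2 b).continuousOn (hL b).le) h1
    have h0 : ∀ b, f b 0 = diracSol k 0 (d b) := fun b => h b 0 ⟨le_rfl, (hL b).le⟩
    have hl : ∀ b, f b (L b) = diracSol k (L b) (d b) := fun b => h b _ ⟨(hL b).le, le_rfl⟩
    simpa only [RoseVertexConditions, h0, hl] using h3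
  · intro h
    refine ⟨_, _, roseSol_ae_eq L k d, fun b => hasH1Deriv_diracSol (L b) k (d b), h, fun b => ?_⟩
    filter_upwards [roseSol_ae_eq L k d b, Lp.coeFn_smul (k : ℂ) (roseSol L k d b)] with x hx hx'
    rw [map_neg, map_smul, negIAlpha_negIAlpha, smul_neg, neg_neg, ← hx]
    exact hx'

theorem roseEigenspace_le_range (hL : ∀ b, 0 < L b) :
    roseEigenspace L uo ut k ≤ LinearMap.range (roseSol L k) := by
  intro ψ hψ
  rw [mem_roseEigenspace_iff] at hψ
  obtain ⟨f, g, h1, h2, -, h4⟩ := hψ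
  refine ⟨fun b => (upperPair (f b 0), lowerPair (f b 0)), ?_⟩
  ext1 b
  refine Lp.ext ?_
  have h := eqOn_diracSol_of_hasH1Deriv (k := k) (hL b) (h2 b) (by
    filter_upwards [h4 b, h1 b, Lp.coeFn_smul (k : ℂ) (ψ b)] with x hx hx' hx''
    rw [← hx, ← hx']
    exact hx'')
  refine (roseSol_ae_eq L k _ b).trans (EventuallyEq.trans ?_ (h1 b).symm)
  exact (ae_restrict_iff' measurableSet_Icc).2 (ae_of_all _ fun x hx => (h x hx).symm)

/-- The initial data of the eigenfunctions. -/
noncomputable def roseData : Submodule ℂ (Fin B → (Fin 2 → ℂ) × (Fin 2 → ℂ)) :=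
  (roseEigenspace L uo ut k).comap (roseSol L k)

theorem map_roseData (hL : ∀ b, 0 < L b) :
    (roseData (L := L) uo ut k).map (roseSol L k) = roseEigenspace L uo ut k := by
  rw [roseData, Submodule.map_comap_eq, inf_eq_right]
  exact roseEigenspace_le_range uo ut k hL

theorem finiteDimensional_roseEigenspace (hL : ∀ b, 0 < L b) :
    FiniteDimensional ℂ (roseEigenspace L uo ut k) := by
  rw [← map_roseData uo ut k hL]
  infer_instance

theorem finrank_roseEigenspace (hL : ∀ b, 0 < L b) :
    Module.finrank ℂ (roseEigenspace L uo ut k) =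
      Module.finrank ℂ (roseData (L := L) uo ut k) := by
  rw [← map_roseData uo ut k hL]
  exact (Submodule.equivMapOfInjective _ (roseSol_injective k hL) _).finrank_eq.symm

theorem mem_roseData_iff (hL : ∀ b, 0 < L b) (d : Fin B → (Fin 2 → ℂ) × (Fin 2 → ℂ)) :
    d ∈ roseData (L := L) uo ut k ↔
      (∃ ξ : Fin 2 → ℂ, ∀ b, (uo b).1.mulVec (d b).1 = ξ ∧
        (ut b).1.mulVec ((Real.cos (k * L b) : ℂ) • (d b).1 - (Real.sin (k * L b) : ℂ) • (d b).2)
          = ξ) ∧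
      ∑ b, (uo b).1.mulVec (d b).2 - ∑ b, (ut b).1.mulVec
        ((Real.sin (k * L b) : ℂ) • (d b).1 + (Real.cos (k * L b) : ℂ) • (d b).2) = 0 := by
  rw [roseData, Submodule.mem_comap, roseSol_mem_iff uo ut k hL, RoseVertexConditions]
  simp only [diracSol_zero, upperPair_ofPairs, lowerPair_ofPairs]
  simp only [diracSol, LinearMap.coe_mk, AddHom.coe_mk, upperPair_ofPairs, lowerPair_ofPairs]

end Rose
-- Multiplicities from linear algebra in SU(2).
theorem SU2.star_mul_self (U : SU2) : star U.1 * U.1 = 1 :=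
  (Matrix.mem_specialUnitaryGroup_iff.1 U.2).1.1

theorem SU2.mul_star_self (U : SU2) : U.1 * star U.1 = 1 :=
  (Matrix.mem_specialUnitaryGroup_iff.1 U.2).1.2

/-- The adjoint of a matrix in SU(2) is its adjugate. This is why only the trace of the holonomy,
that is cos θ_b, enters the secular equation. -/
theorem SU2.add_star (U : SU2) : U.1 + star U.1 = U.1.trace • (1 : Matrix (Fin 2) (Fin 2) ℂ) := by
  have h1 : star U.1 = U.1.adjugate := by
    have h2 := Matrix.mul_adjugate U.1
    rw [(Matrix.mem_specialUnitaryGroup_iff.1 U.2).2, one_smul] at h2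
    calc star U.1 = star U.1 * (U.1 * U.1.adjugate) := by rw [h2, mul_one]
      _ = U.1.adjugate := by rw [← mul_assoc, U.star_mul_self, one_mul]
  rw [h1, Matrix.adjugate_fin_two]
  ext i j
  fin_cases i <;> fin_cases j <;> simp [Matrix.trace_fin_two, add_comm]

open scoped ComplexOrder in
-- Here c is 1 or -1, and (U - c)(U - c)* is a scalar matrix that vanishes when the trace is
-- extremal.
theorem SU2.eq_smul_one_of_trace_eq {U : SU2} {c : ℂ} (hc : c * c = 1) (hr : star c = c)
    (h : U.1.trace = 2 * c) : U.1 = c • (1 : Matrix (Fin 2) (Fin 2) ℂ) := by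
  have h1 := U.add_star
  rw [h] at h1
  have h2 : (U.1 - c • 1) * star (U.1 - c • (1 : Matrix (Fin 2) (Fin 2) ℂ)) = 0 := by
    rw [star_sub, star_smul, star_one, hr, sub_mul, mul_sub, mul_sub, U.mul_star_self]
    simp only [smul_mul_assoc, mul_smul_comm, one_mul, mul_one, smul_smul, hc, one_smul]
    have h3 : star U.1 = (2 * c) • (1 : Matrix (Fin 2) (Fin 2) ℂ) - U.1 := by rw [← h1]; abel
    rw [h3, smul_sub, smul_smul, show c * (2 * c) = 2 by linear_combination 2 * hc]
    rw [two_smul]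
    abel
  rw [Matrix.star_eq_conjTranspose, Matrix.self_mul_conjTranspose_eq_zero] at h2
  exact sub_eq_zero.1 h2

/-- Exhibits an inverse of U - c when the trace is not 2c. Together with
`SU2.eq_smul_one_of_trace_eq` this gives the dichotomy of the multiplicity count: U - c is either
invertible or zero. -/
theorem SU2.sub_mul_star_sub {U : SU2} {c : ℂ} (hc : c * c = 1) :
    (U.1 - c • 1) * (star U.1 - c • (1 : Matrix (Fin 2) (Fin 2) ℂ)) =
      (2 - c * U.1.trace) • (1 : Matrix (Fin 2) (Fin 2) ℂ) := by
  have h1 := U.add_star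
  have h3 : star U.1 = U.1.trace • (1 : Matrix (Fin 2) (Fin 2) ℂ) - U.1 := by rw [← h1]; abel
  rw [sub_mul, mul_sub, mul_sub, U.mul_star_self]
  simp only [smul_mul_assoc, mul_smul_comm, one_mul, mul_one, smul_smul, hc, one_smul]
  rw [h3, smul_sub, smul_smul, sub_smul, two_smul]
  abel

/-- The zero space of a surjective family of matrices. -/
theorem finrank_ker_sum_mulVec {S : Type*} [Fintype S] (M : S → Matrix (Fin 2) (Fin 2) ℂ) {s : S}
    {N : Matrix (Fin 2) (Fin 2) ℂ} (hN : M s * N = 1) :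
    Module.finrank ℂ (LinearMap.ker (∑ i, (M i).mulVecLin ∘ₗ LinearMap.proj i :
      (S → Fin 2 → ℂ) →ₗ[ℂ] (Fin 2 → ℂ))) = 2 * Fintype.card S - 2 := by
  classical
  set σ := (∑ i, (M i).mulVecLin ∘ₗ LinearMap.proj i : (S → Fin 2 → ℂ) →ₗ[ℂ] (Fin 2 → ℂ)) with hσ
  have hsurj : LinearMap.range σ = ⊤ := by
    rw [LinearMap.range_eq_top]
    intro y
    refine ⟨Pi.single s (N.mulVec y), ?_⟩
    rw [hσ, LinearMap.sum_apply, Finset.sum_eq_single s]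
    · rw [LinearMap.comp_apply, LinearMap.proj_apply, Pi.single_eq_same, Matrix.mulVecLin_apply,
        Matrix.mulVec_mulVec, hN, Matrix.one_mulVec]
    · intro i _ hi
      simp [Pi.single_eq_of_ne hi]
    · simp
  have h := LinearMap.finrank_range_add_finrank_ker σ
  rw [hsurj, finrank_top] at h
  simp only [Module.finrank_pi_fintype, Module.finrank_self, Finset.sum_const, Finset.card_univ,
    Fintype.card_fin, smul_eq_mul] at h
  omega

section Rose

variable {B : ℕ} {L : Fin B → ℝ} (uo ut : Fin B → SU2) (k : ℝ)

variable (L) in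
/-- The bonds on which `k` is a Dirichlet eigenvalue. -/
abbrev ResonantBond : Type := {b : Fin B // Real.sin (k * L b) = 0}

variable (L) in
/-- Initial data from the vertex value and the free lower pairs on resonant bonds. -/
noncomputable def roseParam :
    (Fin 2 → ℂ) × (ResonantBond L k → Fin 2 → ℂ) →ₗ[ℂ] (Fin B → (Fin 2 → ℂ) × (Fin 2 → ℂ)) :=
  LinearMap.pi fun b => LinearMap.prod
    ((star (uo b).1).mulVecLin ∘ₗ LinearMap.fst ℂ _ _)
    (if h : Real.sin (k * L b) = 0 then
      (star (ut b).1).mulVecLin ∘ₗ LinearMap.proj (⟨b, h⟩ : ResonantBond L k) ∘ₗ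
        LinearMap.snd ℂ _ _
    else ((Real.sin (k * L b) : ℂ)⁻¹ • ((Real.cos (k * L b) : ℂ) • (star (uo b).1).mulVecLin -
      (star (ut b).1).mulVecLin)) ∘ₗ LinearMap.fst ℂ _ _)

theorem roseParam_fst (p : (Fin 2 → ℂ) × (ResonantBond L k → Fin 2 → ℂ)) (b : Fin B) :
    (roseParam L uo ut k p b).1 = (star (uo b).1).mulVec p.1 := rfl

theorem roseParam_snd_of_sin_eq_zero (p : (Fin 2 → ℂ) × (ResonantBond L k → Fin 2 → ℂ))
    (b : ResonantBond L k) : (roseParam L uo ut k p b).2 = (star (ut b).1).mulVec (p.2 b) := by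
  simp [roseParam, b.2]

theorem roseParam_snd_of_sin_ne_zero (p : (Fin 2 → ℂ) × (ResonantBond L k → Fin 2 → ℂ))
    {b : Fin B} (h : Real.sin (k * L b) ≠ 0) :
    (roseParam L uo ut k p b).2 = (Real.sin (k * L b) : ℂ)⁻¹ •
      ((Real.cos (k * L b) : ℂ) • (star (uo b).1).mulVec p.1 - (star (ut b).1).mulVec p.1) := by
  simp only [roseParam, LinearMap.pi_apply, LinearMap.prod_apply, dif_neg h]
  rfl

theorem SU2.mulVec_star_mulVec (U : SU2) (x : Fin 2 → ℂ) : U.1.mulVec ((star U.1).mulVec x) = x := by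
  rw [Matrix.mulVec_mulVec, U.mul_star_self, Matrix.one_mulVec]

theorem SU2.star_mulVec_mulVec (U : SU2) (x : Fin 2 → ℂ) : (star U.1).mulVec (U.1.mulVec x) = x := by
  rw [Matrix.mulVec_mulVec, U.star_mul_self, Matrix.one_mulVec]

theorem roseParam_injective (b₀ : Fin B) : Function.Injective (roseParam L uo ut k) := by
  rw [← LinearMap.ker_eq_bot, LinearMap.ker_eq_bot']
  intro p hp
  have h1 : p.1 = 0 := by
    have h := roseParam_fst uo ut k p b₀
    rw [hp] at h
    rw [← (uo b₀).mulVec_star_mulVec p.1, ← h]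
    simp
  refine Prod.ext h1 (funext fun b => ?_)
  have h := roseParam_snd_of_sin_eq_zero uo ut k p b
  rw [hp] at h
  rw [← (ut b).mulVec_star_mulVec (p.2 b), ← h]
  simp

/-- If sin kL_b ≠ 0, the values of v at both ends determine w at the start of the bond. If sin kL_b
= 0, the value of v at the far end does not involve w, which stays a free parameter. -/
theorem roseData_le_range (hL : ∀ b, 0 < L b) :
    roseData (L := L) uo ut k ≤ LinearMap.range (roseParam L uo ut k) := by
  intro d hd
  obtain ⟨⟨ξ, hξ⟩, -⟩ := (mem_roseData_iff uo ut k hL d).1 hd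
  -- The free parameter is w transported by u_t; its current is then (U - cos kL_b) applied to it,
  -- with U the holonomy.
  refine ⟨(ξ, fun b => (ut b).1.mulVec (d b).2), ?_⟩
  ext1 b
  have h1 : (star (uo b).1).mulVec ξ = (d b).1 := by
    rw [← (hξ b).1, SU2.star_mulVec_mulVec]
  refine Prod.ext (by rw [roseParam_fst, h1]) ?_
  by_cases h : Real.sin (k * L b) = 0
  · rw [roseParam_snd_of_sin_eq_zero uo ut k _ ⟨b, h⟩, SU2.star_mulVec_mulVec]
  · have hs : (Real.sin (k * L b) : ℂ) ≠ 0 := by exact_mod_cast h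
    rw [roseParam_snd_of_sin_ne_zero uo ut k _ h]
    simp only [h1]
    have h2 : (star (ut b).1).mulVec ξ =
        (Real.cos (k * L b) : ℂ) • (d b).1 - (Real.sin (k * L b) : ℂ) • (d b).2 := by
      rw [← (hξ b).2, SU2.star_mulVec_mulVec]
    rw [h2, sub_sub_cancel, inv_smul_smul₀ hs]

/-- The holonomy of a bond. -/
abbrev bondHolonomy (b : Fin B) : SU2 := uo b * (ut b)⁻¹

theorem bondHolonomy_val (b : Fin B) : (bondHolonomy uo ut b).1 = (uo b).1 * star (ut b).1 := rfl

theorem star_bondHolonomy_val (b : Fin B) :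
    star (bondHolonomy uo ut b).1 = (ut b).1 * star (uo b).1 := by
  rw [bondHolonomy_val, star_mul, star_star]

theorem ofReal_cos_sq_of_sin_eq_zero {x : ℝ} (h : Real.sin x = 0) :
    (Real.cos x : ℂ) * (Real.cos x : ℂ) = 1 := by
  have := Real.sin_sq_add_cos_sq x
  rw [h] at this
  exact_mod_cast (by nlinarith : Real.cos x * Real.cos x = 1)

/-- The contribution of a bond to the current condition at the vertex. -/
theorem roseParam_current {γ : Fin B → ℝ}
    (hγ : ∀ b, (bondHolonomy uo ut b).1.trace = 2 * (γ b : ℂ))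
    (p : (Fin 2 → ℂ) × (ResonantBond L k → Fin 2 → ℂ)) (b : Fin B) :
    (uo b).1.mulVec (roseParam L uo ut k p b).2 - (ut b).1.mulVec
        ((Real.sin (k * L b) : ℂ) • (roseParam L uo ut k p b).1 +
          (Real.cos (k * L b) : ℂ) • (roseParam L uo ut k p b).2) =
      (-2 * (((γ b - Real.cos (k * L b)) / Real.sin (k * L b) : ℝ) : ℂ)) • p.1 +
      if h : Real.sin (k * L b) = 0 then
        ((bondHolonomy uo ut b).1 - (Real.cos (k * L b) : ℂ) • 1).mulVec (p.2 ⟨b, h⟩) else 0 := by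
  by_cases h : Real.sin (k * L b) = 0
  · rw [roseParam_snd_of_sin_eq_zero uo ut k p ⟨b, h⟩, dif_pos h, h]
    -- On a resonant bond the quotient has denominator 0 and is read as 0, so the same scalar
    -- expression covers every bond.
    simp only [div_zero, Complex.ofReal_zero, mul_zero, zero_smul, zero_add]
    rw [Matrix.mulVec_smul, SU2.mulVec_star_mulVec, Matrix.mulVec_mulVec, Matrix.sub_mulVec,
      Matrix.smul_mulVec, Matrix.one_mulVec, bondHolonomy_val]
  · have hs : (Real.sin (k * L b) : ℂ) ≠ 0 := by exact_mod_cast h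
    rw [dif_neg h, add_zero, roseParam_snd_of_sin_ne_zero uo ut k p h, roseParam_fst]
    -- A nonresonant bond contributes (2 cos kL_b - (U + U*))/sin kL_b applied to the vertex value,
    -- and U + U* is scalar.
    have hadd := (bondHolonomy uo ut b).add_star
    rw [hγ, star_bondHolonomy_val, bondHolonomy_val] at hadd
    have hadd' := congrArg (fun M => Matrix.mulVec M p.1) hadd
    simp only [Matrix.add_mulVec, Matrix.smul_mulVec, Matrix.one_mulVec] at hadd'
    have hsc : (Real.sin (k * L b) : ℂ) * Real.sin (k * L b) +
        (Real.cos (k * L b) : ℂ) * Real.cos (k * L b) = 1 := by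
      have := Real.sin_sq_add_cos_sq (k * L b)
      exact_mod_cast (by nlinarith : Real.sin (k * L b) * Real.sin (k * L b) +
        Real.cos (k * L b) * Real.cos (k * L b) = 1)
    simp only [Matrix.mulVec_add, Matrix.mulVec_sub, Matrix.mulVec_smul, Matrix.mulVec_mulVec,
      SU2.mul_star_self, Matrix.one_mulVec]
    set x := ((uo b).1 * star (ut b).1).mulVec p.1
    set y := ((ut b).1 * star (uo b).1).mulVec p.1
    set s : ℂ := (Real.sin (k * L b) : ℂ) with hsdef
    set c : ℂ := (Real.cos (k * L b) : ℂ) with hcdef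
    have hx : x = (2 * (γ b : ℂ)) • p.1 - y := by rw [← hadd']; abel
    rw [hx]
    ext i
    simp only [Pi.sub_apply, Pi.add_apply, Pi.smul_apply, smul_eq_mul, Complex.ofReal_div,
      Complex.ofReal_sub, ← hsdef, ← hcdef]
    field_simp
    linear_combination (-(y i)) * hsc

/-- On nonresonant bonds continuity is built into the parametrisation. On a resonant bond cos kL_b =
±1 is its own inverse, and continuity says that the vertex value is an eigenvector of the holonomy
for it. -/
theorem roseParam_mem_iff (hL : ∀ b, 0 < L b) {γ : Fin B → ℝ}
    (hγ : ∀ b, (bondHolonomy uo ut b).1.trace = 2 * (γ b : ℂ))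
    (p : (Fin 2 → ℂ) × (ResonantBond L k → Fin 2 → ℂ)) :
    roseParam L uo ut k p ∈ roseData (L := L) uo ut k ↔
      (∀ b : ResonantBond L k,
        ((bondHolonomy uo ut b).1 - (Real.cos (k * L b) : ℂ) • 1).mulVec p.1 = 0) ∧
      (-2 * ((∑ b, (γ b - Real.cos (k * L b)) / Real.sin (k * L b) : ℝ) : ℂ)) • p.1 +
        ∑ b : ResonantBond L k,
          ((bondHolonomy uo ut b).1 - (Real.cos (k * L b) : ℂ) • 1).mulVec (p.2 b) = 0 := by
  rw [mem_roseData_iff uo ut k hL, ← Finset.sum_sub_distrib]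
  simp only [roseParam_current uo ut k hγ p, Finset.sum_add_distrib, ← Finset.sum_smul]
  refine and_congr ?_ ?_
  · have key : ∀ b, (ut b).1.mulVec ((Real.cos (k * L b) : ℂ) • (roseParam L uo ut k p b).1 -
        (Real.sin (k * L b) : ℂ) • (roseParam L uo ut k p b).2) = p.1 ↔
        ∀ h : Real.sin (k * L b) = 0,
          ((bondHolonomy uo ut b).1 - (Real.cos (k * L b) : ℂ) • 1).mulVec p.1 = 0 := by
      intro b
      rw [roseParam_fst]
      by_cases h : Real.sin (k * L b) = 0
      · have hc := ofReal_cos_sq_of_sin_eq_zero h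
        simp only [h, Complex.ofReal_zero, zero_smul, sub_zero, forall_const, Matrix.mulVec_smul,
          Matrix.sub_mulVec, Matrix.smul_mulVec, Matrix.one_mulVec, sub_eq_zero]
        rw [Matrix.mulVec_mulVec, ← star_bondHolonomy_val]
        constructor
        · intro h2
          have h3 := congrArg (fun x => (Real.cos (k * L b) : ℂ) •
            (bondHolonomy uo ut b).1.mulVec x) h2
          simp only [Matrix.mulVec_smul, smul_smul, hc, one_smul, SU2.mulVec_star_mulVec] at h3
          calc (bondHolonomy uo ut b).1.mulVec p.1
              = (Real.cos (k * L b) : ℂ) • (Real.cos (k * L b) : ℂ) •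
                (bondHolonomy uo ut b).1.mulVec p.1 := by rw [smul_smul, hc, one_smul]
            _ = _ := by rw [← h3]
        · intro h2
          have h3 := congrArg (fun x => (star (bondHolonomy uo ut b).1).mulVec x) h2
          simp only [Matrix.mulVec_smul, SU2.star_mulVec_mulVec] at h3
          exact h3.symm
      · have hs : (Real.sin (k * L b) : ℂ) ≠ 0 := by exact_mod_cast h
        simp only [h, IsEmpty.forall_iff, iff_true]
        rw [roseParam_snd_of_sin_ne_zero uo ut k p h, smul_inv_smul₀ hs, sub_sub_cancel,
          SU2.mulVec_star_mulVec]
    constructor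
    · rintro ⟨ξ, hξ⟩ b
      have h1 : p.1 = ξ := by rw [← (hξ b).1, roseParam_fst, SU2.mulVec_star_mulVec]
      exact (key b).1 (h1 ▸ (hξ b).2) b.2
    · intro h
      exact ⟨p.1, fun b => ⟨by rw [roseParam_fst, SU2.mulVec_star_mulVec],
        (key b).2 fun hb => h ⟨b, hb⟩⟩⟩
  · rw [← Finset.mul_sum, ← Complex.ofReal_sum]
    have : (∑ b, if h : Real.sin (k * L b) = 0 then ((bondHolonomy uo ut b).1 -
        (Real.cos (k * L b) : ℂ) • 1).mulVec (p.2 ⟨b, h⟩) else 0) = ∑ b : ResonantBond L k,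
          ((bondHolonomy uo ut b).1 - (Real.cos (k * L b) : ℂ) • 1).mulVec (p.2 b) := by
      rw [Finset.sum_dite, Finset.sum_const_zero, add_zero]
      refine Finset.sum_bij (fun x _ => ⟨x.1, (Finset.mem_filter.1 x.2).2⟩) (fun _ _ => Finset.mem_univ _)
        ?_ ?_ ?_
      · intro a _ b _ hab
        exact Subtype.ext (congrArg (fun z : ResonantBond L k => (z : Fin B)) hab)
      · intro b _
        exact ⟨⟨b, by simpa using b.2⟩, Finset.mem_attach _ _, rfl⟩
      · intro _ _; rfl
    rw [this]

open Classical in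
/-- The multiplicity of the energy `k`. -/
theorem finrank_roseEigenspace_eq (hL : ∀ b, 0 < L b) (b₀ : Fin B) {γ : Fin B → ℝ}
    (hγ : ∀ b, (bondHolonomy uo ut b).1.trace = 2 * (γ b : ℂ)) :
    (Module.finrank ℂ (roseEigenspace L uo ut k) : ℤ) = 2 * (Fintype.card (ResonantBond L k) +
      if ∃ b, Real.sin (k * L b) = 0 ∧ γ b ≠ Real.cos (k * L b) then -1
      else if ∑ b, (γ b - Real.cos (k * L b)) / Real.sin (k * L b) = 0 then 1 else 0) := by
  set W := (roseData (L := L) uo ut k).comap (roseParam L uo ut k) with hW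
  have hmem : ∀ p, p ∈ W ↔ _ := fun p => roseParam_mem_iff uo ut k hL hγ p
  have h1 : Module.finrank ℂ (roseEigenspace L uo ut k) = Module.finrank ℂ W := by
    rw [finrank_roseEigenspace uo ut k hL]
    have h2 : W.map (roseParam L uo ut k) = roseData (L := L) uo ut k := by
      rw [hW, Submodule.map_comap_eq, inf_eq_right]
      exact roseData_le_range uo ut k hL
    rw [← h2]
    exact (Submodule.equivMapOfInjective _ (roseParam_injective uo ut k b₀) _).finrank_eq.symm
  rw [h1]
  have hinr : ∀ K : Submodule ℂ (ResonantBond L k → Fin 2 → ℂ), Module.finrank ℂ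
      (K.map (LinearMap.inr ℂ (Fin 2 → ℂ) (ResonantBond L k → Fin 2 → ℂ))) = Module.finrank ℂ K :=
    fun K => (Submodule.equivMapOfInjective _ LinearMap.inr_injective _).finrank_eq.symm
  have hcard : Module.finrank ℂ (ResonantBond L k → Fin 2 → ℂ) =
      2 * Fintype.card (ResonantBond L k) := by
    simp [Module.finrank_pi_fintype, mul_comm]
  by_cases hP : ∃ b, Real.sin (k * L b) = 0 ∧ γ b ≠ Real.cos (k * L b)
  · rw [if_pos hP]
    -- Here U - cos kL_b is invertible for some resonant bond. This forces the vertex value to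
    -- vanish, and the current condition becomes a surjection from the free parameters onto ℂ²,
    -- which costs two dimensions.
    obtain ⟨b, hb, hne⟩ := hP
    have hc := ofReal_cos_sq_of_sin_eq_zero hb
    set c : ℂ := (Real.cos (k * L b) : ℂ) with hcdef
    have hmul := SU2.sub_mul_star_sub (U := bondHolonomy uo ut b) hc
    rw [hγ b] at hmul
    have hr : 2 - c * (2 * (γ b : ℂ)) ≠ 0 := by
      intro h0
      have h2 : (γ b : ℂ) = c := by
        linear_combination (-(c / 2)) * h0 - (γ b : ℂ) * hc
      exact hne (Complex.ofReal_injective h2)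
    set r := 2 - c * (2 * (γ b : ℂ)) with hrdef
    have hN : ((bondHolonomy uo ut b).1 - c • 1) *
        (r⁻¹ • (star (bondHolonomy uo ut b).1 - c • 1)) = 1 := by
      rw [mul_smul_comm, hmul, smul_smul, inv_mul_cancel₀ hr, one_smul]
    have hN' := mul_eq_one_comm.1 hN
    set M : ResonantBond L k → Matrix (Fin 2) (Fin 2) ℂ := fun b =>
      (bondHolonomy uo ut b).1 - (Real.cos (k * L b) : ℂ) • 1 with hM
    have hker := finrank_ker_sum_mulVec M (s := ⟨b, hb⟩) hN
    have hWeq : W = (LinearMap.ker (∑ i, (M i).mulVecLin ∘ₗ LinearMap.proj i :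
        (ResonantBond L k → Fin 2 → ℂ) →ₗ[ℂ] (Fin 2 → ℂ))).map (LinearMap.inr ℂ _ _) := by
      ext p
      rw [hmem, Submodule.mem_map]
      constructor
      · rintro ⟨h2, h3⟩
        have h4 : p.1 = 0 := by
          have h5 : (r⁻¹ • (star (bondHolonomy uo ut b).1 - c • 1)).mulVec
              (((bondHolonomy uo ut b).1 - c • 1).mulVec p.1) = _ :=
            congrArg _ (h2 ⟨b, hb⟩)
          rwa [Matrix.mulVec_mulVec, hN', Matrix.one_mulVec, Matrix.mulVec_zero] at h5
        refine ⟨p.2, ?_, Prod.ext (by simp [h4]) rfl⟩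
        rw [h4, smul_zero, zero_add] at h3
        rw [LinearMap.mem_ker, LinearMap.sum_apply]
        exact h3
      · rintro ⟨ω, hω, rfl⟩
        rw [LinearMap.mem_ker, LinearMap.sum_apply] at hω
        refine ⟨fun b => Matrix.mulVec_zero _, ?_⟩
        rw [LinearMap.inr_apply, smul_zero, zero_add]
        exact hω
    rw [hWeq, hinr, hker]
    -- With a resonant bond present, the subtraction of 2 in the natural numbers is not truncated.
    have : 1 ≤ Fintype.card (ResonantBond L k) := Fintype.card_pos_iff.2 ⟨⟨b, hb⟩⟩
    omega
  · rw [if_neg hP]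
    -- Now the holonomy equals cos kL_b on every resonant bond. The free parameters are
    -- unconstrained, and the vertex value is free or zero according to whether the secular sum
    -- vanishes.
    have hM0 : ∀ b : ResonantBond L k,
        (bondHolonomy uo ut b).1 - (Real.cos (k * L b) : ℂ) • 1 = 0 := by
      intro b
      rw [sub_eq_zero]
      refine SU2.eq_smul_one_of_trace_eq (ofReal_cos_sq_of_sin_eq_zero b.2) (by simp [-Complex.ofReal_cos]) ?_
      rw [hγ]
      by_contra hne
      exact hP ⟨b, b.2, fun h => hne (by rw [h])⟩
    have hmem' : ∀ p, p ∈ W ↔ (-2 * ((∑ b, (γ b - Real.cos (k * L b)) / Real.sin (k * L b) : ℝ) : ℂ))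
        • p.1 = 0 := by
      intro p
      rw [hmem]
      simp only [hM0, Matrix.zero_mulVec, Finset.sum_const_zero, add_zero, implies_true, true_and]
    by_cases hG : ∑ b, (γ b - Real.cos (k * L b)) / Real.sin (k * L b) = 0
    · have hWeq : W = ⊤ := by
        rw [eq_top_iff]
        intro p _
        rw [hmem', hG]; simp
      rw [if_pos hG, hWeq, finrank_top, Module.finrank_prod, hcard]
      simp; ring
    · have hWeq : W = (⊤ : Submodule ℂ (ResonantBond L k → Fin 2 → ℂ)).map
          (LinearMap.inr ℂ _ _) := by
        ext p
        have hG' : -2 * ((∑ b, (γ b - Real.cos (k * L b)) / Real.sin (k * L b) : ℝ) : ℂ) ≠ 0 :=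
          mul_ne_zero (by norm_num) (by exact_mod_cast hG)
        rw [hmem', smul_eq_zero_iff_right hG', Submodule.mem_map]
        constructor
        · intro h
          exact ⟨p.2, Submodule.mem_top, Prod.ext (by simp [h]) rfl⟩
        · rintro ⟨ω, -, rfl⟩
          rfl
      rw [if_neg hG, hWeq, hinr, finrank_top, hcard]
      simp

end Rose
-- The secular function as a cotangent sum.
section Bridge

variable {B : ℕ} {L : Fin B → ℝ} {γ : Fin B → ℝ}

/-- The weights of the cotangents (`true`) and tangents (`false`) of the half lengths in the
secular function. -/
noncomputable def secularWeight (γ : Fin B → ℝ) (j : Fin B × Bool) : ℝ :=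
  if j.2 then (1 - γ j.1) / 2 else (1 + γ j.1) / 2

/-- The secular function of the rose as a cotangent sum. -/
noncomputable def roseCot (hL : ∀ b, 0 < L b) (hγ : ∃ b, γ b < 1) :
    CotSum {j : Fin B × Bool // 0 < secularWeight γ j} where
  c j := secularWeight γ j
  lam j := L j.1.1 / 2
  tau j := if j.1.2 then 0 else Real.pi / 2
  c_pos j := j.2
  lam_pos j := half_pos (hL _)
  tau_eq j := by by_cases h : j.1.2 <;> simp [h]
  exists_tau := by
    obtain ⟨b, hb⟩ := hγ
    exact ⟨⟨(b, true), by simp [secularWeight, hb]⟩, by simp⟩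

variable (hL : ∀ b, 0 < L b) (hγ : ∃ b, γ b < 1)

theorem roseCot_isPole_iff (h1 : ∀ b, |γ b| ≤ 1) (z : ℂ) : (roseCot hL hγ).IsPole z ↔
    ∃ b, (Complex.sin (L b / 2 * z) = 0 ∧ γ b ≠ 1) ∨ (Complex.cos (L b / 2 * z) = 0 ∧ γ b ≠ -1) := by
  constructor
  · rintro ⟨⟨⟨b, t⟩, hj⟩, h⟩
    refine ⟨b, ?_⟩
    cases t
    · right
      simp [secularWeight] at hj
      simp [roseCot, CotSum.phase, Complex.sin_sub_pi_div_two] at h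
      exact ⟨h, by linarith⟩
    · left
      simp [secularWeight] at hj
      simp [roseCot, CotSum.phase] at h
      exact ⟨h, by linarith⟩
  · rintro ⟨b, ⟨h, hb⟩ | ⟨h, hb⟩⟩
    · have hlt : γ b < 1 := lt_of_le_of_ne (abs_le.1 (h1 b)).2 hb
      exact ⟨⟨(b, true), by simp [secularWeight, hlt]⟩, by simpa [roseCot, CotSum.phase] using h⟩
    · have hlt : -1 < γ b := lt_of_le_of_ne (abs_le.1 (h1 b)).1 (Ne.symm hb)
      exact ⟨⟨(b, false), by simp [secularWeight]; linarith⟩,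
        by simpa [roseCot, CotSum.phase, Complex.sin_sub_pi_div_two] using h⟩

/-- sin kL_b = 0 means that the sine or the cosine of kL_b/2 vanishes, with cos kL_b = 1 or -1
respectively. The exception γ_b = cos kL_b is exactly the case where the weight of the singular term
is zero. -/
theorem roseCot_isPole_ofReal_iff (h1 : ∀ b, |γ b| ≤ 1) (k : ℝ) : (roseCot hL hγ).IsPole (k : ℂ) ↔
    ∃ b, Real.sin (k * L b) = 0 ∧ γ b ≠ Real.cos (k * L b) := by
  rw [roseCot_isPole_iff hL hγ h1]
  refine exists_congr fun b => ?_
  set x := L b / 2 * k with hx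
  have e1 : (L b : ℂ) / 2 * k = (x : ℂ) := by push_cast [hx]; ring
  have e2 : k * L b = 2 * x := by rw [hx]; ring
  rw [e1, e2, ← Complex.ofReal_sin, ← Complex.ofReal_cos, Complex.ofReal_eq_zero,
    Complex.ofReal_eq_zero, Real.sin_two_mul]
  have hsq := Real.sin_sq_add_cos_sq x
  constructor
  · rintro (⟨h, hb⟩ | ⟨h, hb⟩)
    · rw [Real.cos_two_mul]
      exact ⟨by rw [h]; ring, fun h2 => hb (by rw [h2]; rw [h] at hsq; linarith)⟩
    · rw [Real.cos_two_mul]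
      exact ⟨by rw [h]; ring, fun h2 => hb (by rw [h2, h]; ring)⟩
  · rintro ⟨h, hb⟩
    rw [Real.cos_two_mul] at hb
    have h3 : Real.sin x * Real.cos x = 0 := by linarith
    rcases mul_eq_zero.1 h3 with h3 | h3
    · exact Or.inl ⟨h3, fun h2 => hb (by rw [h2]; rw [h3] at hsq; linarith)⟩
    · exact Or.inr ⟨h3, fun h2 => hb (by rw [h2, h3]; ring)⟩

theorem half_angle_term {γ : ℝ} {x : ℂ} (hs : Complex.sin x = 0 → γ = 1)
    (hc : Complex.cos x = 0 → γ = -1) :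
    (((1 + γ) / 2 : ℝ) : ℂ) * (Complex.sin x / Complex.cos x) -
      (((1 - γ) / 2 : ℝ) : ℂ) * (Complex.cos x / Complex.sin x) =
      ((γ : ℂ) - Complex.cos (2 * x)) / Complex.sin (2 * x) := by
  rw [Complex.sin_two_mul]
  by_cases h1 : Complex.sin x = 0
  · rw [h1, hs h1]; simp
  · by_cases h2 : Complex.cos x = 0
    · rw [h2, hc h2]; simp
    · have hsq := Complex.sin_sq_add_cos_sq x
      rw [Complex.cos_two_mul]
      push_cast
      field_simp
      linear_combination (γ + 1) * hsq

theorem roseCot_eval (h1 : ∀ b, |γ b| ≤ 1) {z : ℂ} (hz : ¬(roseCot hL hγ).IsPole z) :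
    (roseCot hL hγ).eval z = ∑ b, ((γ b : ℂ) - Complex.cos (L b * z)) / Complex.sin (L b * z) := by
  have hw : ∀ j, 0 ≤ secularWeight γ j := by
    rintro ⟨b, t⟩
    have := abs_le.1 (h1 b)
    cases t <;> simp [secularWeight] <;> linarith
  have e1 : (roseCot hL hγ).eval z = ∑ j : Fin B × Bool, -((secularWeight γ j : ℂ) *
      Complex.cot ((L j.1 / 2 : ℝ) * z - ((if j.2 then 0 else Real.pi / 2 : ℝ) : ℂ))) := by
    rw [CotSum.eval, ← Finset.sum_neg_distrib]
    refine Eq.trans ?_ (Finset.sum_subset (Finset.subset_univ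
      (Finset.univ.filter fun j => 0 < secularWeight γ j)) fun j _ hj => ?_)
    · rw [← Finset.sum_subtype_of_mem (s := Finset.univ.filter fun j => 0 < secularWeight γ j)
        (p := fun j => 0 < secularWeight γ j) _ (fun j hj => (Finset.mem_filter.1 hj).2)]
      refine Finset.sum_congr ?_ fun j _ => rfl
      ext j
      simpa using j.2
    · have : secularWeight γ j = 0 := le_antisymm (not_lt.1 fun h => hj (by simpa using h)) (hw j)
      simp [this]
  rw [e1, Fintype.sum_prod_type]
  refine Finset.sum_congr rfl fun b _ => ?_
  rw [roseCot_isPole_iff hL hγ h1] at hz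
  push Not at hz
  have key := half_angle_term (γ := γ b) (x := (L b / 2 : ℂ) * z) (hz b).1 (hz b).2
  rw [show (2 : ℂ) * (L b / 2 * z) = L b * z by ring] at key
  rw [← key, Fintype.sum_bool]
  simp [secularWeight, Complex.cot, Complex.sin_sub_pi_div_two, Complex.cos_sub_pi_div_two,
    div_neg]
  ring

-- The link between spectrum and function theory: the case distinction in the multiplicity is
-- precisely pole, zero or neither of the secular function. Sums over eigenvalues become sums over
-- its divisor plus one Riemann zeta series per bond.
open Classical in
theorem finrank_roseEigenspace_eq_ord (uo ut : Fin B → SU2) (h1 : ∀ b, |γ b| ≤ 1)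
    (htr : ∀ b, (bondHolonomy uo ut b).1.trace = 2 * (γ b : ℂ)) (k : ℝ) :
    (Module.finrank ℂ (roseEigenspace L uo ut k) : ℤ) =
      2 * ((∑ b, if Real.sin (k * L b) = 0 then 1 else 0) + (roseCot hL hγ).ord k) := by
  obtain ⟨b₀, -⟩ := id hγ
  rw [finrank_roseEigenspace_eq uo ut k hL b₀ htr, CotSum.ord]
  simp only [roseCot_isPole_ofReal_iff hL hγ h1]
  congr 2
  · rw [Fintype.card_subtype, Finset.card_filter]
    push_cast
    rfl
  · by_cases hP : ∃ b, Real.sin (k * L b) = 0 ∧ γ b ≠ Real.cos (k * L b)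
    · rw [if_pos hP, if_pos hP]
    · rw [if_neg hP, if_neg hP, roseCot_eval hL hγ h1
        (by rwa [roseCot_isPole_ofReal_iff hL hγ h1])]
      have e : ∑ b, ((γ b : ℂ) - Complex.cos (L b * k)) / Complex.sin (L b * k) =
          ((∑ b, (γ b - Real.cos (k * L b)) / Real.sin (k * L b) : ℝ) : ℂ) := by
        push_cast
        refine Finset.sum_congr rfl fun b _ => ?_
        rw [mul_comm (k : ℂ)]
      rw [e]
      simp only [Complex.ofReal_eq_zero]

include hL hγ in
theorem finrank_roseEigenspace_neg (uo ut : Fin B → SU2) (h1 : ∀ b, |γ b| ≤ 1)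
    (htr : ∀ b, (bondHolonomy uo ut b).1.trace = 2 * (γ b : ℂ)) (k : ℝ) :
    Module.finrank ℂ (roseEigenspace L uo ut (-k)) = Module.finrank ℂ (roseEigenspace L uo ut k) := by
  have h2 := finrank_roseEigenspace_eq_ord hL hγ uo ut h1 htr k
  have h3 := finrank_roseEigenspace_eq_ord hL hγ uo ut h1 htr (-k)
  simp only [neg_mul, Real.sin_neg, neg_eq_zero, CotSum.ord_neg] at h3
  exact_mod_cast h3.trans h2.symm

theorem fHat_eq_eval {θ : Fin B → ℝ} (hγ : ∃ b, Real.cos (θ b) < 1) {α u : ℝ}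
    (hα : Real.sin α ≠ 0) (hu : u ≠ 0) :
    fHat L θ α u = (roseCot hL hγ).eval (Complex.exp (α * Complex.I) * u) := by
  have him : (Complex.exp (α * Complex.I) * u).im ≠ 0 := by
    rw [exp_mul_I_im]; exact mul_ne_zero hα hu
  rw [roseCot_eval hL hγ (fun b => Real.abs_cos_le_one _)
    ((roseCot hL hγ).not_isPole_of_im_ne_zero him), fHat]
  simp only [mul_assoc]

theorem hasDerivAt_eval_ray {ι : Type} [Fintype ι] (F : CotSum ι) {α u : ℝ}
    (hα : Real.sin α ≠ 0) (hu : u ≠ 0) :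
    HasDerivAt (fun x : ℝ => F.eval (Complex.exp (α * Complex.I) * x))
      (Complex.exp (α * Complex.I) * F.evalDeriv (Complex.exp (α * Complex.I) * u)) u := by
  have him : (Complex.exp (α * Complex.I) * u).im ≠ 0 := by
    rw [exp_mul_I_im]; exact mul_ne_zero hα hu
  have h1 : HasDerivAt (fun w : ℂ => Complex.exp (α * Complex.I) * w)
      (Complex.exp (α * Complex.I)) u := by
    simpa using (hasDerivAt_id (u : ℂ)).const_mul (Complex.exp (α * Complex.I))
  have h2 := (F.hasDerivAt_eval (F.not_isPole_of_im_ne_zero him)).comp (u : ℂ) h1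
  rw [mul_comm (Complex.exp _) (F.evalDeriv _)]
  exact h2.comp_ofReal

variable {θ : Fin B → ℝ} (hθ : ∃ b, Real.cos (θ b) < 1) {α u : ℝ}

theorem fHat_eventuallyEq (hα : Real.sin α ≠ 0) (hu : u ≠ 0) :
    fHat L θ α =ᶠ[𝓝 u] fun x => (roseCot hL hθ).eval (Complex.exp (α * Complex.I) * x) := by
  filter_upwards [isOpen_ne.mem_nhds hu] with x hx
  exact fHat_eq_eval hL hθ hα hx

include hL hθ in
theorem differentiableAt_fHat (hα : Real.sin α ≠ 0) (hu : u ≠ 0) :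
    DifferentiableAt ℝ (fHat L θ α) u :=
  (hasDerivAt_eval_ray (roseCot hL hθ) hα hu).differentiableAt.congr_of_eventuallyEq
    (fHat_eventuallyEq hL hθ hα hu)

include hL hθ in
theorem fHat_ne_zero (hα : Real.sin α ≠ 0) (hu : u ≠ 0) : fHat L θ α u ≠ 0 := by
  rw [fHat_eq_eval hL hθ hα hu]
  exact (roseCot hL hθ).eval_ne_zero (by rw [exp_mul_I_im]; exact mul_ne_zero hα hu)

theorem logDeriv_fHat (hα : Real.sin α ≠ 0) (hu : u ≠ 0) :
    logDeriv (fHat L θ α) u = (roseCot hL hθ).far α u := by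
  rw [(logDeriv_congr_nhds (fHat_eventuallyEq hL hθ hα hu)).eq_of_nhds, logDeriv_apply,
    (hasDerivAt_eval_ray (roseCot hL hθ) hα hu).deriv, CotSum.far, CotSum.logD, mul_div_assoc]

theorem logDeriv_mul_fHat (hα : Real.sin α ≠ 0) (hu : u ≠ 0) :
    logDeriv (fun x : ℝ => (x : ℂ) * Complex.exp (α * Complex.I) * fHat L θ α x) u =
      (roseCot hL hθ).far α u + (u : ℂ)⁻¹ := by
  have huc : (u : ℂ) ≠ 0 := by exact_mod_cast hu
  have hd : HasDerivAt (fun x : ℝ => (x : ℂ)) 1 u := Complex.ofRealCLM.hasDerivAt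
  rw [logDeriv_mul (f := fun x : ℝ => (x : ℂ) * Complex.exp (α * Complex.I)) u
    (mul_ne_zero huc (Complex.exp_ne_zero _)) (fHat_ne_zero hL hθ hα hu)
    (hd.mul_const _).differentiableAt (differentiableAt_fHat hL hθ hα hu),
    logDeriv_fHat hL hθ hα hu, logDeriv_mul_const _ _ (Complex.exp_ne_zero _), logDeriv_apply,
    hd.deriv, one_div, add_comm]

/-- The ray at angle `α + π` gives the same logarithmic derivative by oddness. -/
theorem CotSum.far_add_pi {ι : Type} [Fintype ι] (F : CotSum ι) (α u : ℝ) :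
    F.far (α + Real.pi) u = F.far α u := by
  have e : Complex.exp (((α + Real.pi : ℝ) : ℂ) * Complex.I) = -Complex.exp (α * Complex.I) := by
    rw [Complex.ofReal_add, add_mul, Complex.exp_add, Complex.exp_pi_mul_I, mul_neg_one]
  rw [CotSum.far, CotSum.far, e, neg_mul (Complex.exp _) (u : ℂ), CotSum.logD_neg, neg_mul_neg]

end Bridge
-- Dirichlet series over the zeros, the poles and the bond resonances.
namespace CotSum

variable {ι : Type} [Fintype ι] (F : CotSum ι)

/-- The Dirichlet series of the positive zeros (weight `1`) and poles (weight `-1`). -/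
noncomputable def ordSeries (s : ℂ) : ℂ :=
  ∑' q : F.crit, (F.ord q : ℂ) * ((q : ℝ) : ℂ) ^ (-s)

theorem norm_ord_mul_cpow_le (q : F.crit) (s : ℂ) :
    ‖(F.ord q : ℂ) * ((q : ℝ) : ℂ) ^ (-s)‖ ≤ (q : ℝ) ^ (-s.re) := by
  rw [norm_mul, Complex.norm_cpow_eq_rpow_re_of_pos q.2.1, Complex.neg_re]
  exact mul_le_of_le_one_left (Real.rpow_nonneg q.2.1.le _) (F.norm_ord_le q)

theorem hasSum_ordSeries {s : ℂ} (hs : 1 < s.re) :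
    HasSum (fun q : F.crit => (F.ord q : ℂ) * ((q : ℝ) : ℂ) ^ (-s)) (F.ordSeries s) :=
  (Summable.of_norm_bounded (F.summable_rpow_crit hs) fun q => F.norm_ord_mul_cpow_le q s).hasSum

theorem differentiableAt_ordSeries {s : ℂ} (hs : 1 < s.re) :
    DifferentiableAt ℂ F.ordSeries s := by
  set σ := (1 + s.re) / 2 with hσ
  have h1 : 1 < σ := by linarith
  have hU : IsOpen {w : ℂ | σ < w.re ∧ w.re < s.re + 1} :=
    (isOpen_lt continuous_const Complex.continuous_re).inter
      (isOpen_lt Complex.continuous_re continuous_const)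
  -- Some q may be smaller than 1, where the power is largest at the right edge of the strip, so the
  -- majorant uses both edges.
  refine (Complex.differentiableOn_tsum_of_summable_norm
    ((F.summable_rpow_crit h1).add (F.summable_rpow_crit (σ := s.re + 1) (by linarith)))
    (fun q => ?_) hU fun q w hw => ?_).differentiableAt (hU.mem_nhds ⟨by linarith, by linarith⟩)
  · intro w _
    have hq : ((q : ℝ) : ℂ) ≠ 0 := by exact_mod_cast q.2.1.ne'
    exact ((differentiableAt_id.neg.const_cpow (Or.inl hq)).const_mul _).differentiableWithinAt
  · refine (F.norm_ord_mul_cpow_le q w).trans ?_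
    have hq : 0 < (q : ℝ) := q.2.1
    rcases le_total 1 (q : ℝ) with h | h
    · exact (Real.rpow_le_rpow_of_exponent_le h (by linarith [hw.1])).trans
        (le_add_of_nonneg_right (Real.rpow_nonneg hq.le _))
    · exact (Real.rpow_le_rpow_of_exponent_ge hq h (by linarith [hw.2])).trans
        (le_add_of_nonneg_left (Real.rpow_nonneg hq.le _))

theorem ordSeries_mul_eq {α : ℝ} (h0 : 0 < α) (h1 : α < Real.pi) {s : ℂ}
    (hs1 : 1 < s.re) (hs2 : s.re < 2) :
    F.ordSeries s * (Real.pi / Complex.sin (Real.pi * s / 2) *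
        Complex.exp (-(s / 2) * ((Real.pi - 2 * α) * Complex.I))) =
      F.nearIntegral α s + F.farIntegral α s + 1 / s := by
  have h := F.hasSum_ord_mul_cpow h0 h1 hs1 hs2
  generalize (Real.pi / Complex.sin (Real.pi * s / 2) *
    Complex.exp (-(s / 2) * ((Real.pi - 2 * α) * Complex.I)) : ℂ) = c at h ⊢
  rw [← h.tsum_eq, tsum_mul_right]
  rfl

theorem hasSum_indicator_ord {s : ℂ} (hs : 1 < s.re) :
    HasSum ((Set.Ioi (0 : ℝ)).indicator fun q => (F.ord q : ℂ) * (q : ℂ) ^ (-s))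
      (F.ordSeries s) := by
  have h := (hasSum_subtype_iff_indicator (s := F.crit)
    (f := fun q : ℝ => (F.ord q : ℂ) * (q : ℂ) ^ (-s))).1 (F.hasSum_ordSeries hs)
  convert h using 1
  funext q
  by_cases h0 : 0 < q <;> by_cases h1 : F.ord q = 0 <;> simp [crit, h0, h1]

end CotSum

theorem hasSum_indicator_sin_zeros {l : ℝ} (hl : 0 < l) {s : ℂ} (hs : 1 < s.re) :
    HasSum ((Set.Ioi (0 : ℝ)).indicator fun q =>
      (if Real.sin (q * l) = 0 then 1 else 0 : ℂ) * (q : ℂ) ^ (-s))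
      (((Real.pi / l : ℝ) : ℂ) ^ (-s) * riemannZeta s) := by
  have hp : 0 < Real.pi / l := div_pos Real.pi_pos hl
  have hinj : Function.Injective fun n : ℕ => (Real.pi / l) * ((n : ℝ) + 1) := fun m n h => by
    have := mul_left_cancel₀ hp.ne' h
    exact_mod_cast add_right_cancel this
  rw [← hinj.hasSum_iff]
  · have h1 : Summable fun n : ℕ => 1 / ((n : ℂ) + 1) ^ s := by
      have := (summable_nat_add_iff 1).2 (Complex.summable_one_div_nat_cpow.2 hs)
      simpa using this
    have h2 := h1.hasSum.mul_left (((Real.pi / l : ℝ) : ℂ) ^ (-s))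
    rw [← zeta_eq_tsum_one_div_nat_add_one_cpow hs] at h2
    refine (congrArg (fun f : ℕ → ℂ => HasSum f _) (funext fun n => ?_)).mpr h2
    have hn : (0 : ℝ) < n + 1 := by positivity
    have e : Real.pi / l * ((n : ℝ) + 1) * l = ((n + 1 : ℕ) : ℝ) * Real.pi := by
      push_cast; field_simp
    have hpos : Real.pi / l * ((n : ℝ) + 1) ∈ Set.Ioi (0 : ℝ) := mul_pos hp hn
    simp only [Function.comp_apply]
    rw [Set.indicator_of_mem hpos, e, Real.sin_nat_mul_pi, if_pos rfl, one_mul,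
      Complex.ofReal_mul, Complex.mul_cpow_ofReal_nonneg hp.le hn.le, Complex.cpow_neg _ s,
      Complex.cpow_neg (((n : ℝ) + 1 : ℝ) : ℂ) s]
    push_cast
    rw [one_div]
  · intro q hq
    by_cases h0 : 0 < q
    · rw [Set.indicator_of_mem (show q ∈ Set.Ioi (0 : ℝ) from h0), if_neg, zero_mul]
      intro h
      obtain ⟨n, hn⟩ := Real.sin_eq_zero_iff.1 h
      have hn0 : 0 < n := by
        have : (0 : ℝ) < n * Real.pi := by rw [hn]; positivity
        exact_mod_cast pos_of_mul_pos_left this Real.pi_pos.le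
      obtain ⟨m, rfl⟩ : ∃ m : ℕ, n = m + 1 := ⟨(n - 1).toNat, by omega⟩
      refine hq ⟨m, ?_⟩
      push_cast at hn
      simp only
      field_simp
      linarith
    · exact Set.indicator_of_notMem h0 _

/-! ### The branch of the power and the prefactor. -/

section Branch

variable {α : ℝ}

/-- The sign `κ` for which the branch with cut at angle `α` has `(-1) ^ (-s) = e ^ (κ i π s)`. -/
noncomputable def cutSign (α : ℝ) : ℂ := if α < Real.pi then 1 else -1

/-- The representative in `(0, π)` of the cut angle modulo `π`. -/
noncomputable def cutAngle (α : ℝ) : ℝ := if α < Real.pi then α else α - Real.pi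

theorem powCut_of_pos (h0 : 0 < α) (h2 : α < 2 * Real.pi) {x : ℝ} (hx : 0 < x) (s : ℂ) :
    powCut α x s = (x : ℂ) ^ s := by
  have hxc : (x : ℂ) ≠ 0 := by exact_mod_cast hx.ne'
  have e : -(((α - Real.pi : ℝ) : ℂ) * Complex.I) = ((Real.pi - α : ℝ) : ℂ) * Complex.I := by
    push_cast; ring
  rw [powCut, logCut, Complex.log_ofReal_mul hx (Complex.exp_ne_zero _), e, Complex.log_exp
    (by simp; linarith) (by simp; linarith), Complex.cpow_def_of_ne_zero hxc,
    Complex.ofReal_log hx.le]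
  push_cast
  ring_nf

/-- The argument of a negative number in (α - 2π, α] is -π for α < π and π for α > π, which explains
`cutSign`. -/
theorem powCut_of_neg (hα : (0 < α ∧ α < Real.pi) ∨ (Real.pi < α ∧ α < 2 * Real.pi))
    {x : ℝ} (hx : 0 < x) (s : ℂ) :
    powCut α ((-x : ℝ) : ℂ) (-s) =
      Complex.exp (cutSign α * (Complex.I * Real.pi * s)) * (x : ℂ) ^ (-s) := by
  have hxc : (x : ℂ) ≠ 0 := by exact_mod_cast hx.ne'
  have hp := Real.pi_pos
  rw [powCut, logCut, Complex.cpow_def_of_ne_zero hxc, ← Complex.exp_add, cutSign]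
  rcases hα with ⟨h0, h1⟩ | ⟨h0, h1⟩
  · have e : ((-x : ℝ) : ℂ) * Complex.exp (-(((α - Real.pi : ℝ) : ℂ) * Complex.I)) =
        (x : ℂ) * Complex.exp (((-α : ℝ) : ℂ) * Complex.I) := by
      rw [show -(((α - Real.pi : ℝ) : ℂ) * Complex.I) =
        ((-α : ℝ) : ℂ) * Complex.I + Real.pi * Complex.I by push_cast; ring, Complex.exp_add,
        Complex.exp_pi_mul_I]
      push_cast; ring
    rw [e, Complex.log_ofReal_mul hx (Complex.exp_ne_zero _), Complex.log_exp
      (by simp; linarith) (by simp; linarith), Complex.ofReal_log hx.le, if_pos h1]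
    push_cast
    ring_nf
  · have e : ((-x : ℝ) : ℂ) * Complex.exp (-(((α - Real.pi : ℝ) : ℂ) * Complex.I)) =
        (x : ℂ) * Complex.exp (((2 * Real.pi - α : ℝ) : ℂ) * Complex.I) := by
      rw [show ((2 * Real.pi - α : ℝ) : ℂ) * Complex.I =
        -(((α - Real.pi : ℝ) : ℂ) * Complex.I) + Real.pi * Complex.I by push_cast; ring,
        Complex.exp_add, Complex.exp_pi_mul_I]
      push_cast; ring
    rw [e, Complex.log_ofReal_mul hx (Complex.exp_ne_zero _), Complex.log_exp
      (by simp; linarith) (by simp; linarith), Complex.ofReal_log hx.le, if_neg h0.le.not_gt]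
    push_cast
    ring_nf

theorem cutAngle_pos (hα : (0 < α ∧ α < Real.pi) ∨ (Real.pi < α ∧ α < 2 * Real.pi)) :
    0 < cutAngle α := by
  unfold cutAngle; split_ifs with h
  · rcases hα with h1 | h1 <;> linarith
  · rcases hα with h1 | h1 <;> linarith

theorem cutAngle_lt_pi (hα : (0 < α ∧ α < Real.pi) ∨ (Real.pi < α ∧ α < 2 * Real.pi)) :
    cutAngle α < Real.pi := by
  unfold cutAngle; split_ifs with h
  · exact h
  · rcases hα with h1 | h1 <;> linarith

theorem sin_ne_zero_of_cut (hα : (0 < α ∧ α < Real.pi) ∨ (Real.pi < α ∧ α < 2 * Real.pi)) :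
    Real.sin α ≠ 0 := by
  rcases hα with ⟨h0, h1⟩ | ⟨h0, h1⟩
  · exact (Real.sin_pos_of_pos_of_lt_pi h0 h1).ne'
  · have := Real.sin_pos_of_pos_of_lt_pi (x := α - Real.pi) (by linarith) (by linarith)
    rw [Real.sin_sub_pi] at this
    linarith

theorem CotSum.far_cutAngle {ι : Type} [Fintype ι] (F : CotSum ι) (u : ℝ) :
    F.far (cutAngle α) u = F.far α u := by
  unfold cutAngle; split_ifs with h
  · rfl
  · rw [← F.far_add_pi (α - Real.pi), sub_add_cancel]

/-- The prefactors of the contour integral combine to `2 (1 + (-1) ^ (-s))`. -/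
theorem cut_prefactor {s : ℂ} (hs : Complex.sin (Real.pi * s / 2) ≠ 0) :
    Complex.exp (Complex.I * (Real.pi - α) * s) * (2 * Complex.sin (Real.pi * s) / Real.pi) *
      (Real.pi / Complex.sin (Real.pi * s / 2) *
        Complex.exp (-(s / 2) * ((Real.pi - 2 * cutAngle α) * Complex.I))) =
      2 * (Complex.exp (cutSign α * (Complex.I * Real.pi * s)) + 1) := by
  have hp : (Real.pi : ℂ) ≠ 0 := by exact_mod_cast Real.pi_ne_zero
  have e1 : Complex.sin (Real.pi * s) =
      2 * Complex.sin (Real.pi * s / 2) * Complex.cos (Real.pi * s / 2) := by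
    rw [← Complex.sin_two_mul]; ring_nf
  -- The angle α drops out, leaving half the phase of (-1)^(-s); the factor 2 cos(πs/2) coming from
  -- sin πs completes it to the full phase plus 1.
  have e2 : Complex.exp (Complex.I * (Real.pi - α) * s) *
      Complex.exp (-(s / 2) * ((Real.pi - 2 * cutAngle α) * Complex.I)) =
      Complex.exp (cutSign α * (Real.pi * s / 2 * Complex.I)) := by
    rw [← Complex.exp_add]
    congr 1
    unfold cutAngle cutSign
    split_ifs <;> push_cast <;> ring
  have e3 : 2 * Complex.cos (Real.pi * s / 2) *
      Complex.exp (cutSign α * (Real.pi * s / 2 * Complex.I)) =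
      Complex.exp (cutSign α * (Complex.I * Real.pi * s)) + 1 := by
    rw [Complex.two_cos, add_mul, ← Complex.exp_add, ← Complex.exp_add, ← Complex.exp_zero]
    unfold cutSign
    split_ifs
    · congr 2 <;> ring
    · rw [add_comm]
      congr 2 <;> ring
  rw [← e3, ← e2, e1]
  field_simp

end Branch
-- Analytic continuation and the zeta function.
theorem exists_differentiable_glue {a b : ℝ} (hab : a < b) {f g : ℂ → ℂ}
    (hf : ∀ s : ℂ, s.re < b → DifferentiableAt ℂ f s)
    (hg : ∀ s : ℂ, a < s.re → DifferentiableAt ℂ g s)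
    (hfg : ∀ s : ℂ, a < s.re → s.re < b → f s = g s) :
    ∃ h : ℂ → ℂ, Differentiable ℂ h ∧ (∀ s : ℂ, s.re < b → h s = f s) ∧
      ∀ s : ℂ, a < s.re → h s = g s := by
  set h : ℂ → ℂ := fun s => if s.re < b then f s else g s with hh
  have hl : ∀ s : ℂ, s.re < b → h s = f s := fun s hs => if_pos hs
  have hr : ∀ s : ℂ, a < s.re → h s = g s := fun s hs => by
    by_cases h1 : s.re < b
    · rw [hl s h1, hfg s hs h1]
    · exact if_neg h1
  refine ⟨h, fun s => ?_, hl, hr⟩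
  rcases lt_or_ge s.re b with h1 | h1
  · refine (hf s h1).congr_of_eventuallyEq ?_
    filter_upwards [(isOpen_lt Complex.continuous_re continuous_const).mem_nhds h1] with w hw
    exact hl w hw
  · refine (hg s (hab.trans_le h1)).congr_of_eventuallyEq ?_
    filter_upwards [(isOpen_lt continuous_const Complex.continuous_re).mem_nhds
      (hab.trans_le h1)] with w hw
    exact hr w hw

theorem IsRoseZeta.eq {B : ℕ} {L : Fin B → ℝ} {uo ut : Fin B → SU2} {α : ℝ} {ζ ζ' : ℂ → ℂ}
    (h : IsRoseZeta L uo ut α ζ) (h' : IsRoseZeta L uo ut α ζ') : ζ = ζ' := by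
  refine AnalyticOnNhd.eq_of_eventuallyEq (𝕜 := ℂ) (z₀ := 2)
    (fun z _ => h.1.analyticAt z) (fun z _ => h'.1.analyticAt z) ?_
  have h2 : {s : ℂ | 1 < s.re} ∈ 𝓝 (2 : ℂ) :=
    (isOpen_lt continuous_const Complex.continuous_re).mem_nhds (by simp)
  filter_upwards [h2] with s hs
  exact (h.2 s hs).unique (h'.2 s hs)

section Zeta

variable {B : ℕ} {L θ : Fin B → ℝ} (hL : ∀ b, 0 < L b) (hθ : ∃ b, Real.cos (θ b) < 1) {α : ℝ}

theorem hasSum_pos_eigenvalues (uo ut : Fin B → SU2)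
    (htr : ∀ b, (bondHolonomy uo ut b).1.trace = 2 * (Real.cos (θ b) : ℂ))
    {s : ℂ} (hs : 1 < s.re) :
    HasSum ((Set.Ioi (0 : ℝ)).indicator fun q =>
      (Module.finrank ℂ (roseEigenspace L uo ut q) : ℂ) * (q : ℂ) ^ (-s))
      (2 * (riemannZeta s * ∑ b, ((Real.pi / L b : ℝ) : ℂ) ^ (-s) +
        (roseCot hL hθ).ordSeries s)) := by
  have h1 := hasSum_sum (s := Finset.univ) fun b _ => hasSum_indicator_sin_zeros (hL b) hs
  have h2 := (h1.add ((roseCot hL hθ).hasSum_indicator_ord hs)).mul_left 2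
  rw [← Finset.sum_mul, mul_comm _ (riemannZeta s)] at h2
  refine (congrArg (fun f : ℝ → ℂ => HasSum f _) (funext fun q => ?_)).mpr h2
  by_cases hq : q ∈ Set.Ioi (0 : ℝ)
  · have h3 := finrank_roseEigenspace_eq_ord hL hθ uo ut (fun b => Real.abs_cos_le_one _) htr q
    have h4 : (Module.finrank ℂ (roseEigenspace L uo ut q) : ℂ) =
        2 * ((∑ b, if Real.sin (q * L b) = 0 then 1 else 0) + ((roseCot hL hθ).ord q : ℂ)) := by
      rw [← Int.cast_natCast, h3]
      push_cast
      rfl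
    simp only [Set.indicator_of_mem hq, h4, ← Finset.sum_mul]
    ring
  · simp only [Set.indicator_of_notMem hq, Finset.sum_const_zero, add_zero, mul_zero]

/-- The spectral Dirichlet series of the rose, split into the zeta functions of the bonds and
the zeros and poles of the secular function. -/
noncomputable def roseDirichlet (α : ℝ) (s : ℂ) : ℂ :=
  2 * (Complex.exp (cutSign α * (Complex.I * Real.pi * s)) + 1) *
    (riemannZeta s * ∑ b, ((Real.pi / L b : ℝ) : ℂ) ^ (-s) + (roseCot hL hθ).ordSeries s)

/-- The spectrum is symmetric with multiplicities, so the negative half is the positive series times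
(-1)^(-s). -/
theorem hasSum_eigenvalues (uo ut : Fin B → SU2)
    (htr : ∀ b, (bondHolonomy uo ut b).1.trace = 2 * (Real.cos (θ b) : ℂ))
    (hα : (0 < α ∧ α < Real.pi) ∨ (Real.pi < α ∧ α < 2 * Real.pi)) {s : ℂ} (hs : 1 < s.re) :
    HasSum (fun k : {k : ℝ // k ≠ 0} =>
      (Module.finrank ℂ (roseEigenspace L uo ut k) : ℂ) * powCut α ((k : ℝ) : ℂ) (-s))
      (roseDirichlet hL hθ α s) := by
  have h1 := hasSum_pos_eigenvalues hL hθ uo ut htr hs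
  have h2 := ((Equiv.neg ℝ).hasSum_iff.2 h1).mul_left
    (Complex.exp (cutSign α * (Complex.I * Real.pi * s)))
  have h3 := h1.add h2
  have h4 := hasSum_subtype_iff_indicator (s := {k : ℝ | k ≠ 0}) (a := roseDirichlet hL hθ α s)
    (f := fun k : ℝ => (Module.finrank ℂ (roseEigenspace L uo ut k) : ℂ) *
      powCut α (k : ℂ) (-s))
  refine h4.2 ?_
  have h5 : ∀ c : ℂ, 2 * (Complex.exp (cutSign α * (Complex.I * Real.pi * s)) + 1) * c =
      2 * c + Complex.exp (cutSign α * (Complex.I * Real.pi * s)) * (2 * c) := fun c => by ring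
  rw [roseDirichlet, h5]
  refine (congrArg (fun f : ℝ → ℂ => HasSum f _) (funext fun k => ?_)).mpr h3
  have hα0 : 0 < α := by rcases hα with h | h <;> linarith [Real.pi_pos]
  have hα2 : α < 2 * Real.pi := by rcases hα with h | h <;> linarith [Real.pi_pos]
  simp only [Function.comp_apply, Equiv.neg_apply]
  rcases lt_trichotomy k 0 with hk | rfl | hk
  · rw [Set.indicator_of_mem (show k ∈ {k : ℝ | k ≠ 0} from hk.ne),
      Set.indicator_of_notMem (show k ∉ Set.Ioi (0 : ℝ) from hk.le.not_gt),
      Set.indicator_of_mem (show -k ∈ Set.Ioi (0 : ℝ) from neg_pos.2 hk),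
      finrank_roseEigenspace_neg hL hθ uo ut (fun b => Real.abs_cos_le_one _) htr]
    have := powCut_of_neg hα (neg_pos.2 hk) s
    rw [neg_neg] at this
    rw [this]
    ring
  · simp
  · rw [Set.indicator_of_mem (show k ∈ {k : ℝ | k ≠ 0} from hk.ne'),
      Set.indicator_of_mem (show k ∈ Set.Ioi (0 : ℝ) from hk),
      Set.indicator_of_notMem (show -k ∉ Set.Ioi (0 : ℝ) from (neg_neg_of_pos hk).le.not_gt),
      powCut_of_pos hα0 hα2 hk]
    ring

include hL in
theorem differentiable_sum_bond_cpow :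
    Differentiable ℂ fun s : ℂ => ∑ b, ((Real.pi / L b : ℝ) : ℂ) ^ (-s) := by
  refine Differentiable.fun_sum fun b _ s => ?_
  have hb : ((Real.pi / L b : ℝ) : ℂ) ≠ 0 := by
    exact_mod_cast (div_pos Real.pi_pos (hL b)).ne'
  exact differentiableAt_id.neg.const_cpow (Or.inl hb)

theorem differentiableAt_roseDirichlet {s : ℂ} (hs : 1 < s.re) :
    DifferentiableAt ℂ (roseDirichlet hL hθ α) s := by
  have h1 : s ≠ 1 := fun h => by simp [h] at hs
  exact DifferentiableAt.mul (by fun_prop)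
    (((differentiableAt_riemannZeta h1).mul (differentiable_sum_bond_cpow hL s)).add
      ((roseCot hL hθ).differentiableAt_ordSeries hs))

theorem integrandNear_eq (hα : (0 < α ∧ α < Real.pi) ∨ (Real.pi < α ∧ α < 2 * Real.pi))
    (s : ℂ) {u : ℝ} (hu : 0 < u) :
    integrandNear L θ α s u = (u : ℂ) ^ (-s) * (roseCot hL hθ).near (cutAngle α) u := by
  rw [integrandNear, logDeriv_mul_fHat hL hθ (sin_ne_zero_of_cut hα) hu.ne',
    (roseCot hL hθ).near_eq_far_add (cutAngle_pos hα) (cutAngle_lt_pi hα) hu,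
    CotSum.far_cutAngle]

theorem integrandFar_eq (hα : (0 < α ∧ α < Real.pi) ∨ (Real.pi < α ∧ α < 2 * Real.pi))
    (s : ℂ) {u : ℝ} (hu : 0 < u) :
    integrandFar L θ α s u = (u : ℂ) ^ (-s) * (roseCot hL hθ).far (cutAngle α) u := by
  rw [integrandFar, logDeriv_fHat hL hθ (sin_ne_zero_of_cut hα) hu.ne', CotSum.far_cutAngle]

include hL hθ in
theorem integrableOn_integrandNear
    (hα : (0 < α ∧ α < Real.pi) ∨ (Real.pi < α ∧ α < 2 * Real.pi)) {s : ℂ} (hs : s.re < 2) :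
    IntegrableOn (integrandNear L θ α s) (Set.Ioc 0 1) :=
  ((roseCot hL hθ).integrableOn_cpow_mul_near (cutAngle_pos hα) (cutAngle_lt_pi hα) hs).congr_fun
    (fun _ hu => (integrandNear_eq hL hθ hα s hu.1).symm) measurableSet_Ioc

include hL hθ in
theorem integrableOn_integrandFar
    (hα : (0 < α ∧ α < Real.pi) ∨ (Real.pi < α ∧ α < 2 * Real.pi)) (s : ℂ) :
    IntegrableOn (integrandFar L θ α s) (Set.Ioi 1) :=
  ((roseCot hL hθ).integrableOn_cpow_mul_far (cutAngle_pos hα) (cutAngle_lt_pi hα) s).congr_fun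
    (fun _ hu => (integrandFar_eq hL hθ hα s (zero_lt_one.trans hu)).symm) measurableSet_Ioi

theorem roseZetaFormula_eq (hα : (0 < α ∧ α < Real.pi) ∨ (Real.pi < α ∧ α < 2 * Real.pi))
    (s : ℂ) : roseZetaFormula L θ α s =
      Complex.exp (Complex.I * (Real.pi - α) * s) * (2 * Complex.sin (Real.pi * s) / Real.pi) *
        ((roseCot hL hθ).nearIntegral (cutAngle α) s +
          (roseCot hL hθ).farIntegral (cutAngle α) s + 1 / s) +
      2 * (Complex.exp (cutSign α * (Complex.I * Real.pi * s)) + 1) *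
        riemannZeta s * ∑ b, ((Real.pi / L b : ℝ) : ℂ) ^ (-s) := by
  rw [roseZetaFormula, CotSum.nearIntegral, CotSum.farIntegral,
    setIntegral_congr_fun measurableSet_Ioc fun u hu => integrandNear_eq hL hθ hα s hu.1,
    setIntegral_congr_fun measurableSet_Ioi fun u hu =>
      integrandFar_eq hL hθ hα s (zero_lt_one.trans hu)]
  rfl

theorem roseZetaFormula_eq_roseDirichlet
    (hα : (0 < α ∧ α < Real.pi) ∨ (Real.pi < α ∧ α < 2 * Real.pi)) {s : ℂ}
    (hs1 : 1 < s.re) (hs2 : s.re < 2) :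
    roseZetaFormula L θ α s = roseDirichlet hL hθ α s := by
  -- The zeros of sin(πs/2) are the even integers, none of which has real part strictly between 1
  -- and 2.
  have hsin : Complex.sin (Real.pi * s / 2) ≠ 0 := by
    intro h
    obtain ⟨n, hn⟩ := Complex.sin_eq_zero_iff.1 h
    have hp : (Real.pi : ℂ) ≠ 0 := by exact_mod_cast Real.pi_ne_zero
    have h2 : s = ((2 * n : ℤ) : ℂ) := by
      field_simp at hn
      push_cast
      linear_combination hn
    rw [h2, Complex.intCast_re] at hs1 hs2
    have h3 : 1 < 2 * n := by exact_mod_cast hs1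
    have h4 : 2 * n < 2 := by exact_mod_cast hs2
    omega
  rw [roseZetaFormula_eq hL hθ hα, roseDirichlet, ← (roseCot hL hθ).ordSeries_mul_eq
    (cutAngle_pos hα) (cutAngle_lt_pi hα) hs1 hs2]
  linear_combination (roseCot hL hθ).ordSeries s * cut_prefactor (α := α) hsin

/-- The formula for the zeta function with its removable singularities at `0` and `1` removed. -/
noncomputable def roseContinuation (α : ℝ) (s : ℂ) : ℂ :=
  Complex.exp (Complex.I * (Real.pi - α) * s) *
      (2 * Complex.sin (Real.pi * s) / Real.pi *
          ((roseCot hL hθ).nearIntegral (cutAngle α) s +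
            (roseCot hL hθ).farIntegral (cutAngle α) s) +
        2 / Real.pi * dslope (fun w => Complex.sin (Real.pi * w)) 0 s) +
    2 * dslope (fun w => Complex.exp (cutSign α * (Complex.I * Real.pi * w)) + 1) 1 s *
      riemannZeta₁ s * ∑ b, ((Real.pi / L b : ℝ) : ℂ) ^ (-s)

theorem Differentiable.dslope {f : ℂ → ℂ} (hf : Differentiable ℂ f) (c : ℂ) :
    Differentiable ℂ (dslope f c) := by
  rw [← differentiableOn_univ] at hf ⊢
  exact (Complex.differentiableOn_dslope univ_mem).2 hf

theorem differentiableAt_roseContinuation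
    (hα : (0 < α ∧ α < Real.pi) ∨ (Real.pi < α ∧ α < 2 * Real.pi)) {s : ℂ} (hs : s.re < 2) :
    DifferentiableAt ℂ (roseContinuation hL hθ α) s := by
  have h1 := (roseCot hL hθ).differentiableAt_nearIntegral (cutAngle_pos hα) (cutAngle_lt_pi hα) hs
  have h2 := (roseCot hL hθ).differentiableAt_farIntegral (cutAngle_pos hα) (cutAngle_lt_pi hα) s
  have h3 := Differentiable.dslope (f := fun w => Complex.sin (Real.pi * w)) (by fun_prop) 0 s
  have h4 := Differentiable.dslope
    (f := fun w => Complex.exp (cutSign α * (Complex.I * Real.pi * w)) + 1) (by fun_prop) 1 s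
  have h5 := differentiable_sum_bond_cpow hL s
  have h6 := differentiable_riemannZeta₁ s
  have h7 : DifferentiableAt ℂ (fun s : ℂ => Complex.exp (Complex.I * (Real.pi - α) * s)) s := by
    fun_prop
  have h8 : DifferentiableAt ℂ (fun s : ℂ => 2 * Complex.sin (Real.pi * s) / Real.pi) s := by
    fun_prop
  exact (h7.mul ((h8.mul (h1.add h2)).add (h3.const_mul _))).add
    (((h4.const_mul 2).mul h6).mul h5)

/-- The divided difference at 0 merges 1/s with sin πs. The one at 1 merges the pole of ζ_R with
e^{±iπs} + 1, which vanishes there for either sign. -/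
theorem roseContinuation_eq_roseZetaFormula
    (hα : (0 < α ∧ α < Real.pi) ∨ (Real.pi < α ∧ α < 2 * Real.pi)) {s : ℂ} (h0 : s ≠ 0)
    (h1 : s ≠ 1) : roseContinuation hL hθ α s = roseZetaFormula L θ α s := by
  have e : Complex.exp (cutSign α * (Complex.I * Real.pi * 1)) = -1 := by
    rw [cutSign]
    split_ifs
    · rw [one_mul, mul_one, mul_comm, Complex.exp_pi_mul_I]
    · rw [mul_one, mul_comm Complex.I, neg_one_mul, Complex.exp_neg, Complex.exp_pi_mul_I]
      norm_num
  rw [roseZetaFormula_eq hL hθ hα, roseContinuation, dslope_of_ne _ h0, dslope_of_ne _ h1,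
    slope_def_field, slope_def_field, e, riemannZeta_eq_inv_sub_mul h1, mul_zero,
    Complex.sin_zero]
  ring

/-- The explicit formula is holomorphic on Re s < 2 and the Dirichlet series on Re s > 1; they agree
on the strip where the Mellin computation is valid. -/
theorem exists_isRoseZeta (uo ut : Fin B → SU2)
    (htr : ∀ b, (bondHolonomy uo ut b).1.trace = 2 * (Real.cos (θ b) : ℂ))
    (hα : (0 < α ∧ α < Real.pi) ∨ (Real.pi < α ∧ α < 2 * Real.pi)) :
    ∃ ζ : ℂ → ℂ, IsRoseZeta L uo ut α ζ ∧
      ∀ s : ℂ, s.re < 2 → ζ s = roseContinuation hL hθ α s := by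
  obtain ⟨ζ, h1, h2, h3⟩ := exists_differentiable_glue one_lt_two
    (f := roseContinuation hL hθ α) (g := roseDirichlet hL hθ α)
    (fun s hs => differentiableAt_roseContinuation hL hθ hα hs)
    (fun s hs => differentiableAt_roseDirichlet hL hθ hs) fun s hs1 hs2 => by
      rw [roseContinuation_eq_roseZetaFormula hL hθ hα (fun h => by simp [h] at hs1; linarith)
        (fun h => by simp [h] at hs1), roseZetaFormula_eq_roseDirichlet hL hθ hα hs1 hs2]
  exact ⟨ζ, ⟨h1, fun s hs => h3 s hs ▸ hasSum_eigenvalues hL hθ uo ut htr hα hs⟩, h2⟩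

theorem tendsto_roseZetaFormula
    (hα : (0 < α ∧ α < Real.pi) ∨ (Real.pi < α ∧ α < 2 * Real.pi)) {s : ℂ} (hs : s.re < 2) :
    Tendsto (roseZetaFormula L θ α) (𝓝[≠] s) (𝓝 (roseContinuation hL hθ α s)) := by
  have hne : ∀ c : ℂ, ∀ᶠ w in 𝓝[≠] s, w ≠ c := fun c => by
    by_cases h : s = c
    · exact h ▸ self_mem_nhdsWithin
    · exact eventually_ne_nhdsWithin h
  refine ((differentiableAt_roseContinuation hL hθ hα hs).continuousAt.tendsto.mono_left
    nhdsWithin_le_nhds).congr' ?_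
  filter_upwards [hne 0, hne 1] with w h0 h1
  exact roseContinuation_eq_roseZetaFormula hL hθ hα h0 h1

end Zeta

theorem theorem1 {B : ℕ} (L : Fin B → ℝ) (hL : ∀ b, 0 < L b) (uo ut : Fin B → SU2)
    (hu : ∃ b, uo b ≠ ut b) (θ : Fin B → ℝ)
    (hθ : ∀ b, (Real.cos (θ b) : ℂ) =
      1 / 2 * Matrix.trace ((uo b * (ut b)⁻¹ : SU2) : Matrix (Fin 2) (Fin 2) ℂ))
    (α : ℝ) (hα : (0 < α ∧ α < Real.pi) ∨ (Real.pi < α ∧ α < 2 * Real.pi)) :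
    -- eigenvalues have finite multiplicity; away from the poles they are the roots of the
    -- secular equation, with multiplicity two
    (∀ k : ℝ, FiniteDimensional ℂ (roseEigenspace L uo ut k)) ∧
    (∀ k : ℝ, (∀ b, Real.sin (k * L b) ≠ 0) →
      ((∑ b, (Real.cos (θ b) - Real.cos (k * L b)) / Real.sin (k * L b) = 0 →
          Module.finrank ℂ (roseEigenspace L uo ut k) = 2) ∧
        (∑ b, (Real.cos (θ b) - Real.cos (k * L b)) / Real.sin (k * L b) ≠ 0 →
          Module.finrank ℂ (roseEigenspace L uo ut k) = 0))) ∧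
    -- the zeta function exists and is unique
    (∃! ζ : ℂ → ℂ, IsRoseZeta L uo ut α ζ) ∧
    -- the logarithmic derivatives are defined and the integrals converge
    (∀ u : ℝ, 0 < u → fHat L θ α u ≠ 0 ∧ DifferentiableAt ℝ (fHat L θ α) u) ∧
    (∀ s : ℂ, s.re < 2 →
      IntegrableOn (integrandNear L θ α s) (Set.Ioc 0 1) ∧
      IntegrableOn (integrandFar L θ α s) (Set.Ioi 1)) ∧
    -- the formula for `Re s < 2`; its removable singularities `0` and `1` are read as limits
    ∀ ζ : ℂ → ℂ, IsRoseZeta L uo ut α ζ → ∀ s : ℂ, s.re < 2 →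
      (s ≠ 0 → s ≠ 1 → ζ s = roseZetaFormula L θ α s) ∧
      Tendsto (roseZetaFormula L θ α) (𝓝[≠] s) (𝓝 (ζ s)) := by
  have htr : ∀ b, (bondHolonomy uo ut b).1.trace = 2 * (Real.cos (θ b) : ℂ) := fun b => by
    rw [hθ b, ← mul_assoc, mul_one_div_cancel two_ne_zero, one_mul]
  obtain ⟨b₀, hb₀⟩ := hu
  -- If cos θ_b = 1, the holonomy has trace 2 and is the identity. A bond with u_o ≠ u_t therefore
  -- supplies a genuine cotangent, that is, the pole of the secular function at the origin.
  have hlt : ∃ b, Real.cos (θ b) < 1 := by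
    refine ⟨b₀, lt_of_le_of_ne (Real.cos_le_one _) fun h => hb₀ ?_⟩
    have h1 : (bondHolonomy uo ut b₀).1 = (1 : ℂ) • (1 : Matrix (Fin 2) (Fin 2) ℂ) :=
      SU2.eq_smul_one_of_trace_eq (one_mul 1) (star_one ℂ) (by rw [htr, h]; simp)
    rw [one_smul] at h1
    have h2 : uo b₀ * (ut b₀)⁻¹ = 1 := Subtype.ext h1
    exact mul_inv_eq_one.1 h2
  obtain ⟨ζ, hζ, hζR⟩ := exists_isRoseZeta hL hlt uo ut htr hα
  refine ⟨fun k => finiteDimensional_roseEigenspace uo ut k hL, fun k hk => ?_,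
    ⟨ζ, hζ, fun ζ' h => h.eq hζ⟩,
    fun u hu => ⟨fHat_ne_zero hL hlt (sin_ne_zero_of_cut hα) hu.ne',
      differentiableAt_fHat hL hlt (sin_ne_zero_of_cut hα) hu.ne'⟩,
    fun s hs => ⟨integrableOn_integrandNear hL hlt hα hs, integrableOn_integrandFar hL hlt hα s⟩,
    fun ζ' h s hs => ?_⟩
  · have h1 := finrank_roseEigenspace_eq uo ut k hL b₀ htr
    have : IsEmpty (ResonantBond L k) := ⟨fun b => hk b.1 b.2⟩
    rw [Fintype.card_eq_zero, if_neg fun ⟨b, hb⟩ => hk b hb.1] at h1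
    refine ⟨fun h => ?_, fun h => ?_⟩
    · rw [if_pos h] at h1
      omega
    · rw [if_neg h] at h1
      omega
  · rw [h.eq hζ, hζR s hs]
    exact ⟨fun h0 h1 => roseContinuation_eq_roseZetaFormula hL hlt hα h0 h1,
      tendsto_roseZetaFormula hL hlt hα hs⟩
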